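/- **Theorem (EPP Theorem for $O_3$).** Let $\mathscr C$ be a collection of choreographic procedures all of whose endpoint projections are defined, and let $\langle C,\Sigma,K\rangle$ be a well-formed $O_3$ choreography configuration (over $\mathscr C$) such that the endpoint projection $[\![C]\!]$ is defined. Let networks run with the projected procedures $[\![\mathscr C]\!]$. 1. (Completeness) If $\langle C,\Sigma,K\rangle \xrightarrow{p} \langle C',\Sigma',K'\rangle$, then $[\![C']\!]$ is defined and $\langle [\![C]\!],\Sigma,K\rangle \xrightarrow{p} \langle N',\Sigma',K'\rangle$ for some well-formed network $N'$ with $N'\sqsupseteq[\![C']\!]$. 2. (Soundness) If $N$ is a well-formed network with $N\sqsupseteq[\![C]\!]$ and $\langle N,\Sigma,K\rangle \xrightarrow{r} \langle N',\Sigma',K'\rangle$, then $\langle C,\Sigma,K\rangle \xrightarrow{r} \langle C',\Sigma',K'\rangle$ for some $C'$ such that $[\![C']\!]$ is defined and $N'\sqsupseteq[\![C']\!]$. The notions are as follows. *Choreographies.* $C ::= 0 \mid I;C$. Instructions are blocks $\{C\}$ and, each with a line number $l\in\mathbb N$ and a token $t$ (its *key* is $(l,t)$): communications $p.e\to q.x$,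 selections $p\to q[L]$, computations $p.x:=e$, conditionals $\mathsf{if}\ p.e\ \mathsf{then}\ C_1\ \mathsf{else}\ C_2$, calls $X(\bar p,\bar a)$, and the runtime instructions $p\rightsquigarrow q.x$ and $p\rightsquigarrow q[L]$ (communication/selection in progress) and $\bar w.X(\bar p,\bar a)\{C\}$ (call in progress; the set $\bar w$ of processes has not entered yet). A token is the placeholder $\mathsf t$ or a list of numbers $\tau$; $\mathsf{nextToken}(l,\tau)=l::\tau$. Expressions are built by function symbols from atoms: located values $v@p$ and variables $p.x$. Variables are bound by $p.e\to q.x$, $p\rightsquigarrow q.x$ and $p.x:=e$ in the rest of the sequence; terms are taken up to renaming of bound variables and substitution avoids capture. A procedure is $X(\bar q,\overline{q.y})=C_X$. $\Sigma$ maps process names to states, $K$ maps process names to multisets of messages $(l,\tau,v)$, $(l,\tau,L)$. An arbitrary relation $\sigma\vdash e\Downarrow(v,\sigma')$ evaluates closed expressions. *Choreography steps* (only for token values $\tau$; $\{0\}⨟C=C$ and $\{I;C_1\}⨟C=\{I;C_1\};C$). Let $k=(l,\tau)$ be the key of the first instruction. - $p.e\to q.x;C \xrightarrow{p} p\rightsquigarrow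 q.x;C$ if $\Sigma(p)\vdash e\Downarrow(v,\sigma)$; $\Sigma(p)$ becomes $\sigma$ and $(l,\tau,v)$ is added to $K(q)$. - $p\rightsquigarrow q.x;C\xrightarrow{q}C[q.x\mapsto v@q]$, removing one $(l,\tau,v)$ from $K(q)$. - $p\to q[L];C\xrightarrow{p}p\rightsquigarrow q[L];C$, adding $(l,\tau,L)$ to $K(q)$; and $p\rightsquigarrow q[L];C\xrightarrow{q}C$, removing one $(l,\tau,L)$ from $K(q)$. - $p.x:=e;C\xrightarrow{p}C[p.x\mapsto v@p]$ if $\Sigma(p)\vdash e\Downarrow(v,\sigma)$; $\Sigma(p)$ becomes $\sigma$. - $\mathsf{if}\ p.e\ \mathsf{then}\ C_1\ \mathsf{else}\ C_2;C\xrightarrow{p}\{C_i\}⨟C$ with $i=1$ if $e$ evaluates to $\mathsf{true}$ and $i=2$ if it evaluates to another value ($\Sigma$ unchanged). - $X(\bar p,\bar a);C\xrightarrow{p}(\bar p\setminus p).X(\bar p,\bar a)\{C_1\};C$ for $p\in\bar p$, where $C_1=C_X[\bar q,\overline{q.y},\mathsf t\mapsto\bar p,\bar a,\mathsf{nextToken}(l,\tau)]$.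 - $\bar w.X(\bar p,\bar a)\{C_1\};C\xrightarrow{p}(\bar w\setminus p).X(\bar p,\bar a)\{C_1\};C$ for $p\in\bar w$; and to $\{C_1\}⨟C$ if $\bar w=\{p\}$. - If $C_1\xrightarrow{p}C_1'$, then $\{C_1\};C\xrightarrow{p}\{C_1'\}⨟C$, and $\bar w.X(\bar p,\bar a)\{C_1\};C\xrightarrow{p}\bar w.X(\bar p,\bar a)\{C_1'\};C$ if $p\notin\bar w$. - If $C\xrightarrow{q}C'$ and $I$ is not a selection (possibly in progress) with receiver $q$, then $I;C\xrightarrow{q}I;C'$. *Processes and networks.* $P::=0\mid I;P$, where $I$ is a send $q!_{l,t}e$, a receive $?_{l,t}x$, an assignment $x:=e$, a choice $q\oplus_{l,t}L$, a branching $\&\{(l_i,t,L_i)\Rightarrow P_i\}_i$ (one token $t$ for all its alternatives), $\mathsf{if}\ e\ \mathsf{then}\ P\ \mathsf{else}\ Q$, a call $X_j(\bar p,\bar a)_{l,t}$ or a block $\{P\}$. A network assigns a process to each name ($0$ if none is written); a step of $N$ by $p$ is a step of $N(p)$, and these are (in process $p$, for token values): $q!_{l,\tau}e;P\to P$, adding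 $(l,\tau,v)$ to $K(q)$ if $\Sigma(p)\vdash e\Downarrow(v,\sigma)$, with $\Sigma(p)$ becoming $\sigma$; $?_{l,\tau}x;P\to P[x\mapsto v]$, removing $(l,\tau,v)$ from $K(p)$; $q\oplus_{l,\tau}L;P\to P$, adding $(l,\tau,L)$ to $K(q)$; $\&\{(l_i,\tau,L_i)\Rightarrow P_i\}_i;P\to\{P_i\};P$, removing $(l_i,\tau,L_i)$ from $K(p)$; $x:=e;P\to P[x\mapsto v]$ with $\Sigma(p)$ updated; $\mathsf{if}\ e\ \mathsf{then}\ P_1\ \mathsf{else}\ P_2;P\to\{P_i\};P$ as for choreographies; $X_j(\bar p,\bar a)_{l,\tau};P\to\{Q[\bar q,\bar y,\mathsf t\mapsto\bar p,\bar a,\mathsf{nextToken}(l,\tau)]\};P$ if $X_j(\bar q,\bar y)=Q$ is declared; $\{P_1\};P\to\{P_1'\};P$ if $P_1\to P_1'$; and $I;P\to I;P'$ for every $I$ if $P\to P'$. A network is *well-formed* if the keys in each of its processes are pairwise distinct (listing the keys of sends, receives, choices, calls and of every alternative, and recursively those of all subprocesses). *The relation $\sqsupseteq$* on processes is the least precongruence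 such that dropping alternatives of a branching goes down ($\&B\sqsupseteq\&B'$ if $B'\subseteq B$) and that identifies $\{0\};P$ with $P$, $\{P\};0$ with $P$, and $\{I;0\};P$ with $I;P$ for branchings $I$; $N\sqsupseteq M$ means $N(p)\sqsupseteq M(p)$ for all $p$. *Endpoint projection.* $[\![C]\!]$ is the network $r\mapsto[\![C]\!]_r$; it is defined if all $[\![C]\!]_r$ are. $[\![0]\!]_r=0$, $[\![\{C_1\};C]\!]_r=\{[\![C_1]\!]_r\};[\![C]\!]_r$. An instruction in front of $C$ contributes, in front of $[\![C]\!]_r$: for $p.e\to q.x$: $q!_{l,t}[\![e]\!]_r$ at $r=p$ and $?_{l,t}x$ at $r=q$; for $p\rightsquigarrow q.x$: $?_{l,t}x$ at $r=q$; for $p.x:=e$: $x:=[\![e]\!]_r$ at $r=p$; for $p\to q[L]$: $q\oplus_{l,t}L$ at $r=p$; for a conditional: $\mathsf{if}\ [\![e]\!]_r\ \mathsf{then}\ [\![C_1]\!]_r\ \mathsf{else}\ [\![C_2]\!]_r$ at $r=p$ and the merge $[\![C_1]\!]_r\sqcup[\![C_2]\!]_r$ at every other $r\in\mathsf{pn}(C_1)\cup\mathsf{pn}(C_2)$;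 for a call: $X_j(\bar p\setminus p_j,[\![\bar a]\!]_r)_{l,t}$ at $r=p_j$; for $\bar w.X(\bar p,\bar a)\{C_1\}$: the same call at $r=p_j\in\bar w$ and $\{[\![C_1]\!]_r\}$ at $r\in\bar p\setminus\bar w$; nothing in all other cases. For $p\to q[L]$ and $p\rightsquigarrow q[L]$ at $r=q$, $[\![I;C]\!]_q=\&\{(l,t,L)\Rightarrow[\![C]\!]_q\};0$. The projection of an expression drops locations and is undefined if an atom is not located at $r$; in argument lists, atoms located elsewhere are left out. The merge is defined only on two single branchings (each followed by $0$) with the same token and disjoint sets of labels, and unites their alternatives. The procedure $X(p_1,\dots,p_n,\overline{p.x})=C_X$ is projected to the procedures $X_j(\bar p\setminus p_j,[\![\overline{p.x}]\!]_{p_j})=[\![C_X]\!]_{p_j}$, $j\le n$. *Names, occurrences, free variables.* $\mathsf{pn}(C)$ collects the processes of all instructions, where $p\rightsquigarrow q.x$ and $p\rightsquigarrow q[L]$ contribute only $q$, and calls, in progress or not, contribute $\bar p$ only. An instruction other than a block *occurs* in $C$ also if it is nested in a block, in a branch of a conditional, or in the body of a call in progress. $\mathsf{fv}$ is the usual set of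 free variables, to which a call, in progress or not, contributes the variables among its arguments only. *Well-formed configurations.* $\langle C,\Sigma,K\rangle$ is well-formed if: - $C$ has no free variables; the keys of the instructions that occur in $C$ are pairwise distinct and contain no placeholder; if $I_1,I_2$ occur in $C$ with keys $(l_1,\tau_1)$, $(l_2,\tau_2)$ and $l_1::\tau_1$ is a proper suffix of $l_2::\tau_2$, then $I_1$ is a call in progress and $I_2$ occurs in its body; - for $p.e\to q.x$ with key $(l,\tau)$: $p\ne q$ and no $(l,\tau,v)$ is in $K(q)$; for $p\to q[L]$: $p\neq q$ and $(l,\tau,L)\notin K(q)$; for $p\rightsquigarrow q.x$: $(l,\tau,v)\in K(q)$ for exactly one $v$; for $p\rightsquigarrow q[L]$: $(l,\tau,L)\in K(q)$; conversely every $(l,\tau,v)$ (or $(l,\tau,L)$) in $K(q)$ has a corresponding $p\rightsquigarrow q.x$ (or $p\rightsquigarrow q[L]$) with key $(l,\tau)$ that occurs in $C$; - the branches of conditionals contain no runtime instructions; - in calls (in progress or not) $X(\bar p,\bar a)$, $X$ is declared, $\bar p$ is a list of distinct processes as long as the list of roles, and there are as many arguments as parameters, each located at the process that plays the role of the corresponding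 parameter; - in $\bar w.X(\bar p,\bar a)\{C_1\}$ with key $(l,\tau)$: $\bar w\subseteq\bar p$, $\mathsf{pn}(C_1)\subseteq\bar p$, and for $r\in\bar w$ both projections $[\![C_X[\bar q,\overline{q.y},\mathsf t\mapsto\bar p,\bar a,\mathsf{nextToken}(l,\tau)]]\!]_r\sqsupseteq[\![C_1]\!]_r$ are defined and so related; - every procedure $X(\bar q,\overline{q.y})=C_X$ has distinct roles and distinct parameters, the latter located at roles, $\mathsf{pn}(C_X)\subseteq\bar q$, no free variables of $C_X$ other than the parameters, no runtime instructions, distinct keys, only placeholder tokens, and its instructions satisfy the conditions above. -/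

import Mathlib

universe u

namespace O3

/-! ## Data, expressions, keys, messages -/

/-- Ground expressions: values and applications of function symbols, no variables. -/
inductive GExpr (F V : Type u) : Type u
  | val (v : V)
  | app (f : F) (es : List (GExpr F V))

/-- The data over which the calculus is built: process names, values, selection labels,
function symbols, process states, procedure names, the value `true`, and an arbitrary evaluation
relation `eval σ e v σ'` (in state `σ` the ground expression `e` evaluates to `v`, leaving the
process in state `σ'`). -/
structure Lang : Type (u + 1) where
  Name : Type u
  Val : Type u
  Lab : Type u
  Fn : Type u
  State : Type u
  PName : Type u
  decName : DecidableEq Name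
  decLab : DecidableEq Lab
  tt : Val
  eval : State → GExpr Fn Val → Val → State → Prop

attribute [instance] Lang.decName Lang.decLab

/-- Token annotations: the placeholder `hole`, or a token value. Token values are lists of line
numbers. -/
inductive Tok : Type
  | hole
  | tok (τ : List ℕ)
  deriving DecidableEq

/-- `nextToken l τ` prepends the line number. -/
def nextToken (l : ℕ) (τ : List ℕ) : List ℕ := l :: τ

/-- Replace the placeholder by the token value `τ`. -/
def Tok.inst (τ : List ℕ) : Tok → Tok
  | .hole => .tok τ
  | .tok τ' => .tok τ'

/-- An integrity key: a line number and a token. -/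
abbrev Key : Type := ℕ × Tok

/-- `Key.Anc k₁ k₂` (written `k₁ ≺ k₂` on paper): the instruction with key `k₁` is a proper
ancestor of the one with key `k₂` in the call stack. Since `nextToken` prepends, the list
`l₁ :: τ₁` is then a proper suffix of `l₂ :: τ₂`. -/
def Key.Anc (k₁ k₂ : Key) : Prop :=
  ∃ l₁ τ₁ l₂ τ₂, k₁ = (l₁, Tok.tok τ₁) ∧ k₂ = (l₂, Tok.tok τ₂) ∧
    (l₁ :: τ₁) <:+ (l₂ :: τ₂) ∧ l₁ :: τ₁ ≠ l₂ :: τ₂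

/-- What a message carries: a value or a selection label. -/
inductive Payload (𝓛 : Lang.{u}) : Type u
  | val (v : 𝓛.Val)
  | lab (L : 𝓛.Lab)

/-- Messages `(l, τ, v)` and `(l, τ, L)`. -/
structure Msg (𝓛 : Lang.{u}) : Type u where
  line : ℕ
  token : List ℕ
  payload : Payload 𝓛

/-- States of all processes. -/
abbrev Store (𝓛 : Lang.{u}) : Type u := 𝓛.Name → 𝓛.State

/-- Undelivered messages of all processes. -/
abbrev Pool (𝓛 : Lang.{u}) : Type u := 𝓛.Name → Multiset (Msg 𝓛)

/-- Add one message to the undelivered messages of `q`. -/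
def Pool.add {𝓛 : Lang.{u}} (K : Pool 𝓛) (q : 𝓛.Name) (m : Msg 𝓛) : Pool 𝓛 :=
  Function.update K q (m ::ₘ K q)

/-- The map sending the members of the list `qs` to the corresponding members of `ps`, and every
other name to itself. -/
def renameRoles {𝓛 : Lang.{u}} (qs ps : List 𝓛.Name) (n : 𝓛.Name) : 𝓛.Name :=
  ((qs.zip ps).lookup n).getD n

/-! ## Choreographies

Terms are taken up to renaming of bound variables, which is implemented by De Bruijn indices that
are counted separately for each process: `var p i` refers to the `i`-th innermost enclosing binder
*at process `p`*. The binders are `comm` and `recv` (at the receiver) and `expr` (at the process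
that computes); their scope is the continuation. -/

/-- Atoms: a value located at `p`, or a variable of `p`. -/
inductive CAtom (𝓛 : Lang.{u}) : Type u
  | val (v : 𝓛.Val) (p : 𝓛.Name)
  | var (p : 𝓛.Name) (i : ℕ)

inductive CExpr (𝓛 : Lang.{u}) : Type u
  | atom (a : CAtom 𝓛)
  | app (f : 𝓛.Fn) (es : List (CExpr 𝓛))

mutual
/-- Choreographies: `0` and `I; C`. -/
inductive Chor (𝓛 : Lang.{u}) : Type u
  | nil
  | seq (I : Instr 𝓛) (C : Chor 𝓛)
/-- Choreography instructions, with line number `l` and token `t`.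
* `comm l t p e q`: `p` evaluates `e` and sends the result to `q`, which binds it;
* `sel l t p q L`: `p` sends the selection `L` to `q`;
* `expr l t p e`: `p` evaluates `e` and binds the result;
* `cond l t p e C₁ C₂`: `p` evaluates the guard `e`;
* `call l t X ps as`: procedure call;
* `block C`: a block `{C}`;
* runtime instructions: `recv l t p q` (communication in progress), `recvSel l t p q L`
  (selection in progress), and `calling l t ws X ps as C` (call in progress, where `ws` is the set
  of processes that have not entered yet). -/
inductive Instr (𝓛 : Lang.{u}) : Type u
  | comm (l : ℕ) (t : Tok) (p : 𝓛.Name) (e : CExpr 𝓛) (q : 𝓛.Name)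
  | sel (l : ℕ) (t : Tok) (p q : 𝓛.Name) (L : 𝓛.Lab)
  | expr (l : ℕ) (t : Tok) (p : 𝓛.Name) (e : CExpr 𝓛)
  | cond (l : ℕ) (t : Tok) (p : 𝓛.Name) (e : CExpr 𝓛) (C₁ C₂ : Chor 𝓛)
  | call (l : ℕ) (t : Tok) (X : 𝓛.PName) (ps : List 𝓛.Name) (as : List (CAtom 𝓛))
  | block (C : Chor 𝓛)
  | recv (l : ℕ) (t : Tok) (p q : 𝓛.Name)
  | recvSel (l : ℕ) (t : Tok) (p q : 𝓛.Name) (L : 𝓛.Lab)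
  | calling (l : ℕ) (t : Tok) (ws : Finset 𝓛.Name) (X : 𝓛.PName) (ps : List 𝓛.Name)
      (as : List (CAtom 𝓛)) (C : Chor 𝓛)
end

/-- A choreographic procedure `X(roles, params) = body`. The `k`-th parameter is a variable of the
role `params[k]`; in the body, `var q i` refers (outside all binders) to the `i`-th of the
parameters located at `q`. -/
structure CDef (𝓛 : Lang.{u}) : Type u where
  roles : List 𝓛.Name
  params : List 𝓛.Name
  body : Chor 𝓛

/-- Collections of choreographic procedures. -/
abbrev CDecls (𝓛 : Lang.{u}) : Type u := 𝓛.PName → Option (CDef 𝓛)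

section Chor
variable {𝓛 : Lang.{u}}

/-- The process at which an atom is located. -/
def CAtom.loc : CAtom 𝓛 → 𝓛.Name
  | .val _ p => p
  | .var p _ => p

/-- Variable substitutions. -/
abbrev CSub (𝓛 : Lang.{u}) : Type u := 𝓛.Name → ℕ → CAtom 𝓛

def CAtom.subst (σ : CSub 𝓛) : CAtom 𝓛 → CAtom 𝓛
  | .val v p => .val v p
  | .var p i => σ p i

/-- Move an atom under one more binder at `q`. -/
def CAtom.shift (q : 𝓛.Name) : CAtom 𝓛 → CAtom 𝓛
  | .val v p => .val v p
  | .var p i => if p = q then .var p (i + 1) else .var p i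

/-- Move a substitution under a binder at `q`. -/
def CSub.lift (q : 𝓛.Name) (σ : CSub 𝓛) : CSub 𝓛 := fun p i =>
  if p = q then
    match i with
    | 0 => .var p 0
    | j + 1 => (σ p j).shift q
  else (σ p i).shift q

/-- The substitution `[q.x ↦ v@q]` for the variable of the outermost binder at `q`. -/
def CSub.single (q : 𝓛.Name) (v : 𝓛.Val) : CSub 𝓛 := fun p i =>
  if p = q then
    match i with
    | 0 => .val v q
    | j + 1 => .var p j
  else .var p i

/-- The substitution of the arguments `as` for the parameters of a procedure: the `i`-th variable
of `p` is replaced by the `i`-th argument located at `p`. -/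
def CSub.ofArgs (as : List (CAtom 𝓛)) : CSub 𝓛 := fun p i =>
  let asp := as.filter (fun a => a.loc = p)
  (asp[i]?).getD (.var p (i - asp.length))

mutual
def CExpr.subst (σ : CSub 𝓛) : CExpr 𝓛 → CExpr 𝓛
  | .atom a => .atom (a.subst σ)
  | .app f es => .app f (CExpr.substList σ es)
def CExpr.substList (σ : CSub 𝓛) : List (CExpr 𝓛) → List (CExpr 𝓛)
  | [] => []
  | e :: es => e.subst σ :: CExpr.substList σ es
end

/-- The substitution to be applied to the continuation of an instruction. -/
def Instr.under (σ : CSub 𝓛) : Instr 𝓛 → CSub 𝓛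
  | .comm _ _ _ _ q => σ.lift q
  | .recv _ _ _ q => σ.lift q
  | .expr _ _ p _ => σ.lift p
  | _ => σ

mutual
def Chor.subst (σ : CSub 𝓛) : Chor 𝓛 → Chor 𝓛
  | .nil => .nil
  | .seq I C => .seq (I.subst σ) (C.subst (I.under σ))
def Instr.subst (σ : CSub 𝓛) : Instr 𝓛 → Instr 𝓛
  | .comm l t p e q => .comm l t p (e.subst σ) q
  | .sel l t p q L => .sel l t p q L
  | .expr l t p e => .expr l t p (e.subst σ)
  | .cond l t p e C₁ C₂ => .cond l t p (e.subst σ) (C₁.subst σ) (C₂.subst σ)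
  | .call l t X ps as => .call l t X ps (as.map (CAtom.subst σ))
  | .block C => .block (C.subst σ)
  | .recv l t p q => .recv l t p q
  | .recvSel l t p q L => .recvSel l t p q L
  | .calling l t ws X ps as C =>
      .calling l t ws X ps (as.map (CAtom.subst σ)) (C.subst σ)
end

/-! Replacing roles by processes (`ρ`) and the token placeholder by a token value (`τ`). -/

def CAtom.inst (ρ : 𝓛.Name → 𝓛.Name) : CAtom 𝓛 → CAtom 𝓛
  | .val v p => .val v (ρ p)
  | .var p i => .var (ρ p) i

mutual
def CExpr.inst (ρ : 𝓛.Name → 𝓛.Name) : CExpr 𝓛 → CExpr 𝓛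
  | .atom a => .atom (a.inst ρ)
  | .app f es => .app f (CExpr.instList ρ es)
def CExpr.instList (ρ : 𝓛.Name → 𝓛.Name) : List (CExpr 𝓛) → List (CExpr 𝓛)
  | [] => []
  | e :: es => e.inst ρ :: CExpr.instList ρ es
end

mutual
def Chor.inst (ρ : 𝓛.Name → 𝓛.Name) (τ : List ℕ) : Chor 𝓛 → Chor 𝓛
  | .nil => .nil
  | .seq I C => .seq (I.inst ρ τ) (C.inst ρ τ)
def Instr.inst (ρ : 𝓛.Name → 𝓛.Name) (τ : List ℕ) : Instr 𝓛 → Instr 𝓛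
  | .comm l t p e q => .comm l (t.inst τ) (ρ p) (e.inst ρ) (ρ q)
  | .sel l t p q L => .sel l (t.inst τ) (ρ p) (ρ q) L
  | .expr l t p e => .expr l (t.inst τ) (ρ p) (e.inst ρ)
  | .cond l t p e C₁ C₂ =>
      .cond l (t.inst τ) (ρ p) (e.inst ρ) (C₁.inst ρ τ) (C₂.inst ρ τ)
  | .call l t X ps as => .call l (t.inst τ) X (ps.map ρ) (as.map (CAtom.inst ρ))
  | .block C => .block (C.inst ρ τ)
  | .recv l t p q => .recv l (t.inst τ) (ρ p) (ρ q)
  | .recvSel l t p q L => .recvSel l (t.inst τ) (ρ p) (ρ q) L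
  | .calling l t ws X ps as C =>
      .calling l (t.inst τ) (ws.image ρ) X (ps.map ρ) (as.map (CAtom.inst ρ)) (C.inst ρ τ)
end

/-- The body of `d` with processes `ps` for the roles, `as` for the parameters and `τ` for the
token placeholder. -/
def CDef.instantiate (d : CDef 𝓛) (ps : List 𝓛.Name) (as : List (CAtom 𝓛)) (τ : List ℕ) :
    Chor 𝓛 :=
  (d.body.inst (renameRoles d.roles ps) τ).subst (CSub.ofArgs as)

mutual
/-- The ground expression denoted by `e` at process `p`; undefined if `e` has a variable or a
value of another process. -/
def CExpr.ground (p : 𝓛.Name) : CExpr 𝓛 → Option (GExpr 𝓛.Fn 𝓛.Val)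
  | .atom (.val v q) => if q = p then some (.val v) else none
  | .atom (.var _ _) => none
  | .app f es => (CExpr.groundList p es).map (GExpr.app f)
def CExpr.groundList (p : 𝓛.Name) : List (CExpr 𝓛) → Option (List (GExpr 𝓛.Fn 𝓛.Val))
  | [] => some []
  | e :: es => do
      let g ← e.ground p
      let gs ← CExpr.groundList p es
      return g :: gs
end

/-- `s ⊢ e ⇓ (v, s')` at process `p`. -/
def CExpr.Eval (p : 𝓛.Name) (s : 𝓛.State) (e : CExpr 𝓛) (v : 𝓛.Val) (s' : 𝓛.State) : Prop :=
  ∃ g, e.ground p = some g ∧ 𝓛.eval s g v s'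

/-- `{C₁} ⨟ C₂`: an empty block is garbage collected. -/
def Chor.blockSeq : Chor 𝓛 → Chor 𝓛 → Chor 𝓛
  | .nil, C₂ => C₂
  | .seq I C, C₂ => .seq (.block (.seq I C)) C₂

/-- `I` is a selection at `q`, i.e. a selection (possibly in progress) with receiver `q`. -/
def Instr.IsSelAt (q : 𝓛.Name) : Instr 𝓛 → Prop
  | .sel _ _ _ r _ => r = q
  | .recvSel _ _ _ r _ => r = q
  | _ => False

/-- Transitions `⟨C, Σ, K⟩ →ₚ ⟨C', Σ', K'⟩` of choreographies. -/
inductive CStep (𝒟 : CDecls 𝓛) :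
    Chor 𝓛 → Store 𝓛 → Pool 𝓛 → 𝓛.Name → Chor 𝓛 → Store 𝓛 → Pool 𝓛 → Prop
  | send {l τ p e q C S K v s} :
      e.Eval p (S p) v s →
      CStep 𝒟 (.seq (.comm l (.tok τ) p e q) C) S K p
        (.seq (.recv l (.tok τ) p q) C) (Function.update S p s) (K.add q ⟨l, τ, .val v⟩)
  | recv {l τ p q C S K v M} :
      K q = ⟨l, τ, .val v⟩ ::ₘ M →
      CStep 𝒟 (.seq (.recv l (.tok τ) p q) C) S K q
        (C.subst (CSub.single q v)) S (Function.update K q M)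
  | select {l τ p q L C S K} :
      CStep 𝒟 (.seq (.sel l (.tok τ) p q L) C) S K p
        (.seq (.recvSel l (.tok τ) p q L) C) S (K.add q ⟨l, τ, .lab L⟩)
  | onSelect {l τ p q L C S K M} :
      K q = ⟨l, τ, .lab L⟩ ::ₘ M →
      CStep 𝒟 (.seq (.recvSel l (.tok τ) p q L) C) S K q C S (Function.update K q M)
  | compute {l τ p e C S K v s} :
      e.Eval p (S p) v s →
      CStep 𝒟 (.seq (.expr l (.tok τ) p e) C) S K p
        (C.subst (CSub.single p v)) (Function.update S p s) K
  | ifTrue {l τ p e C₁ C₂ C S K s} :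
      e.Eval p (S p) 𝓛.tt s →
      CStep 𝒟 (.seq (.cond l (.tok τ) p e C₁ C₂) C) S K p (C₁.blockSeq C) S K
  | ifFalse {l τ p e C₁ C₂ C S K v s} :
      e.Eval p (S p) v s → v ≠ 𝓛.tt →
      CStep 𝒟 (.seq (.cond l (.tok τ) p e C₁ C₂) C) S K p (C₂.blockSeq C) S K
  | block {C₁ C₁' C₂ S S' K K' p} :
      CStep 𝒟 C₁ S K p C₁' S' K' →
      CStep 𝒟 (.seq (.block C₁) C₂) S K p (C₁'.blockSeq C₂) S' K'
  | delay {I C C' S S' K K' q} :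
      CStep 𝒟 C S K q C' S' K' → ¬ I.IsSelAt q →
      CStep 𝒟 (.seq I C) S K q (.seq I C') S' K'
  | first {l τ X ps as d C₂ S K p} :
      𝒟 X = some d → p ∈ ps →
      CStep 𝒟 (.seq (.call l (.tok τ) X ps as) C₂) S K p
        (.seq (.calling l (.tok τ) (ps.toFinset.erase p) X ps as
          (d.instantiate ps as (nextToken l τ))) C₂) S K
  | enter {l τ ws X ps as C₁ C₂ S K p} :
      p ∈ ws →
      CStep 𝒟 (.seq (.calling l (.tok τ) ws X ps as C₁) C₂) S K p
        (.seq (.calling l (.tok τ) (ws.erase p) X ps as C₁) C₂) S K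
  | last {l τ X ps as C₁ C₂ S K p} :
      CStep 𝒟 (.seq (.calling l (.tok τ) {p} X ps as C₁) C₂) S K p (C₁.blockSeq C₂) S K
  | delayProc {l τ ws X ps as C₁ C₁' C₂ S S' K K' p} :
      CStep 𝒟 C₁ S K p C₁' S' K' → p ∉ ws →
      CStep 𝒟 (.seq (.calling l (.tok τ) ws X ps as C₁) C₂) S K p
        (.seq (.calling l (.tok τ) ws X ps as C₁') C₂) S' K'

mutual
/-- Process names of a choreography. -/
def Chor.pn : Chor 𝓛 → Finset 𝓛.Name
  | .nil => ∅
  | .seq I C => I.pn ∪ C.pn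
def Instr.pn : Instr 𝓛 → Finset 𝓛.Name
  | .comm _ _ p _ q => {p, q}
  | .sel _ _ p q _ => {p, q}
  | .expr _ _ p _ => {p}
  | .cond _ _ p _ C₁ C₂ => {p} ∪ C₁.pn ∪ C₂.pn
  | .call _ _ _ ps _ => ps.toFinset
  | .block C => C.pn
  | .recv _ _ _ q => {q}
  | .recvSel _ _ _ q _ => {q}
  | .calling _ _ _ _ ps _ _ => ps.toFinset
end

mutual
/-- The instructions (other than blocks) that occur in a choreography. -/
def Chor.stats : Chor 𝓛 → List (Instr 𝓛)
  | .nil => []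
  | .seq I C => I.stats ++ C.stats
def Instr.stats : Instr 𝓛 → List (Instr 𝓛)
  | .block C => C.stats
  | .cond l t p e C₁ C₂ => .cond l t p e C₁ C₂ :: (C₁.stats ++ C₂.stats)
  | .calling l t ws X ps as C => .calling l t ws X ps as C :: C.stats
  | .comm l t p e q => [.comm l t p e q]
  | .sel l t p q L => [.sel l t p q L]
  | .expr l t p e => [.expr l t p e]
  | .call l t X ps as => [.call l t X ps as]
  | .recv l t p q => [.recv l t p q]
  | .recvSel l t p q L => [.recvSel l t p q L]
end

/-- The integrity key of an instruction (blocks have none). -/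
def Instr.key : Instr 𝓛 → Option Key
  | .comm l t _ _ _ => some (l, t)
  | .sel l t _ _ _ => some (l, t)
  | .expr l t _ _ => some (l, t)
  | .cond l t _ _ _ _ => some (l, t)
  | .call l t _ _ _ => some (l, t)
  | .block _ => none
  | .recv l t _ _ => some (l, t)
  | .recvSel l t _ _ _ => some (l, t)
  | .calling l t _ _ _ _ _ => some (l, t)

def Chor.keys (C : Chor 𝓛) : List Key := C.stats.filterMap Instr.key

/-- Variables of atoms and expressions. -/
def CAtom.fv : CAtom 𝓛 → Set (𝓛.Name × ℕ)
  | .val _ _ => ∅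
  | .var p i => {(p, i)}

mutual
def CExpr.fv : CExpr 𝓛 → Set (𝓛.Name × ℕ)
  | .atom a => a.fv
  | .app _ es => CExpr.fvList es
def CExpr.fvList : List (CExpr 𝓛) → Set (𝓛.Name × ℕ)
  | [] => ∅
  | e :: es => e.fv ∪ CExpr.fvList es
end

/-- Remove the variable bound at `q` from a set of free variables. -/
def unbind (q : 𝓛.Name) (s : Set (𝓛.Name × ℕ)) : Set (𝓛.Name × ℕ) :=
  {x | (if x.1 = q then (x.1, x.2 + 1) else x) ∈ s}

mutual
/-- Free variables. -/
def Chor.fv : Chor 𝓛 → Set (𝓛.Name × ℕ)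
  | .nil => ∅
  | .seq I C => I.fv ∪
      (match I with
        | .comm _ _ _ _ q => unbind q C.fv
        | .recv _ _ _ q => unbind q C.fv
        | .expr _ _ p _ => unbind p C.fv
        | _ => C.fv)
def Instr.fv : Instr 𝓛 → Set (𝓛.Name × ℕ)
  | .comm _ _ _ e _ => e.fv
  | .sel _ _ _ _ _ => ∅
  | .expr _ _ _ e => e.fv
  | .cond _ _ _ e C₁ C₂ => e.fv ∪ C₁.fv ∪ C₂.fv
  | .call _ _ _ _ as => {x | ∃ a ∈ as, x ∈ a.fv}
  | .block C => C.fv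
  | .recv _ _ _ _ => ∅
  | .recvSel _ _ _ _ _ => ∅
  | .calling _ _ _ _ _ as _ => {x | ∃ a ∈ as, x ∈ a.fv}
end

def Instr.IsRuntime : Instr 𝓛 → Prop
  | .recv _ _ _ _ => True
  | .recvSel _ _ _ _ _ => True
  | .calling _ _ _ _ _ _ _ => True
  | _ => False

/-- `C` contains no runtime instructions. -/
def Chor.NoRuntime (C : Chor 𝓛) : Prop := ∀ I ∈ C.stats, ¬ I.IsRuntime

end Chor

/-! ## Processes and networks -/

/-- Atoms of process expressions; variables are De Bruijn indices. -/
inductive PAtom (𝓛 : Lang.{u}) : Type u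
  | val (v : 𝓛.Val)
  | var (i : ℕ)

inductive PExpr (𝓛 : Lang.{u}) : Type u
  | atom (a : PAtom 𝓛)
  | app (f : 𝓛.Fn) (es : List (PExpr 𝓛))

mutual
/-- Processes: `0` and `I; P`. -/
inductive Proc (𝓛 : Lang.{u}) : Type u
  | nil
  | seq (I : PInstr 𝓛) (P : Proc 𝓛)
/-- Process instructions: send, receive (a binder), local computation (a binder), choice of a
label, branching, conditional, call, block. The alternatives of one branching instruction carry
their own line numbers and labels, and share one token. Process procedures are named `(X, j)`:
the `j`-th role of the choreographic procedure `X`. -/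
inductive PInstr (𝓛 : Lang.{u}) : Type u
  | send (q : 𝓛.Name) (l : ℕ) (t : Tok) (e : PExpr 𝓛)
  | recv (l : ℕ) (t : Tok)
  | set (e : PExpr 𝓛)
  | choice (q : 𝓛.Name) (l : ℕ) (t : Tok) (L : 𝓛.Lab)
  | branch (t : Tok) (bs : Branches 𝓛)
  | cond (e : PExpr 𝓛) (P Q : Proc 𝓛)
  | call (X : 𝓛.PName × ℕ) (ps : List 𝓛.Name) (as : List (PAtom 𝓛)) (l : ℕ) (t : Tok)
  | block (P : Proc 𝓛)
/-- Lists of alternatives `(lᵢ, Lᵢ) ⇒ Pᵢ`. -/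
inductive Branches (𝓛 : Lang.{u}) : Type u
  | nil
  | cons (l : ℕ) (L : 𝓛.Lab) (P : Proc 𝓛) (bs : Branches 𝓛)
end

/-- A process procedure, with its process parameters, its number of variable parameters and its
body, in which the `i`-th parameter is the free variable `i`. -/
structure PDef (𝓛 : Lang.{u}) : Type u where
  roles : List 𝓛.Name
  arity : ℕ
  body : Proc 𝓛

abbrev PDecls (𝓛 : Lang.{u}) : Type u := 𝓛.PName × ℕ → Option (PDef 𝓛)

/-- A network `p₁[P₁] | ⋯ | pₙ[Pₙ]` as the map from names to behaviours, `0` where no process is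
mentioned. -/
abbrev Net (𝓛 : Lang.{u}) : Type u := 𝓛.Name → Proc 𝓛

section Proc
variable {𝓛 : Lang.{u}}

def Branches.toList : Branches 𝓛 → List (ℕ × 𝓛.Lab × Proc 𝓛)
  | .nil => []
  | .cons l L P bs => (l, L, P) :: bs.toList

def Branches.append : Branches 𝓛 → Branches 𝓛 → Branches 𝓛
  | .nil, bs' => bs'
  | .cons l L P bs, bs' => .cons l L P (bs.append bs')

abbrev PSub (𝓛 : Lang.{u}) : Type u := ℕ → PAtom 𝓛

def PAtom.subst (σ : PSub 𝓛) : PAtom 𝓛 → PAtom 𝓛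
  | .val v => .val v
  | .var i => σ i

def PAtom.shift : PAtom 𝓛 → PAtom 𝓛
  | .val v => .val v
  | .var i => .var (i + 1)

def PSub.lift (σ : PSub 𝓛) : PSub 𝓛
  | 0 => .var 0
  | i + 1 => (σ i).shift

/-- The substitution `[x ↦ v]` for the variable of the outermost binder. -/
def PSub.single (v : 𝓛.Val) : PSub 𝓛
  | 0 => .val v
  | i + 1 => .var i

def PSub.ofArgs (as : List (PAtom 𝓛)) : PSub 𝓛 := fun i =>
  (as[i]?).getD (.var (i - as.length))

mutual
def PExpr.subst (σ : PSub 𝓛) : PExpr 𝓛 → PExpr 𝓛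
  | .atom a => .atom (a.subst σ)
  | .app f es => .app f (PExpr.substList σ es)
def PExpr.substList (σ : PSub 𝓛) : List (PExpr 𝓛) → List (PExpr 𝓛)
  | [] => []
  | e :: es => e.subst σ :: PExpr.substList σ es
end

/-- The substitution to be applied to the continuation of an instruction. -/
def PInstr.under (σ : PSub 𝓛) : PInstr 𝓛 → PSub 𝓛
  | .recv _ _ => σ.lift
  | .set _ => σ.lift
  | _ => σ

mutual
def Proc.subst (σ : PSub 𝓛) : Proc 𝓛 → Proc 𝓛
  | .nil => .nil
  | .seq I P => .seq (I.subst σ) (P.subst (I.under σ))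
def PInstr.subst (σ : PSub 𝓛) : PInstr 𝓛 → PInstr 𝓛
  | .send q l t e => .send q l t (e.subst σ)
  | .recv l t => .recv l t
  | .set e => .set (e.subst σ)
  | .choice q l t L => .choice q l t L
  | .branch t bs => .branch t (bs.subst σ)
  | .cond e P Q => .cond (e.subst σ) (P.subst σ) (Q.subst σ)
  | .call X ps as l t => .call X ps (as.map (PAtom.subst σ)) l t
  | .block P => .block (P.subst σ)
def Branches.subst (σ : PSub 𝓛) : Branches 𝓛 → Branches 𝓛
  | .nil => .nil
  | .cons l L P bs => .cons l L (P.subst σ) (bs.subst σ)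
end

mutual
/-- Replace roles by processes and the token placeholder by a token value. -/
def Proc.inst (ρ : 𝓛.Name → 𝓛.Name) (τ : List ℕ) : Proc 𝓛 → Proc 𝓛
  | .nil => .nil
  | .seq I P => .seq (I.inst ρ τ) (P.inst ρ τ)
def PInstr.inst (ρ : 𝓛.Name → 𝓛.Name) (τ : List ℕ) : PInstr 𝓛 → PInstr 𝓛
  | .send q l t e => .send (ρ q) l (t.inst τ) e
  | .recv l t => .recv l (t.inst τ)
  | .set e => .set e
  | .choice q l t L => .choice (ρ q) l (t.inst τ) L
  | .branch t bs => .branch (t.inst τ) (bs.inst ρ τ)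
  | .cond e P Q => .cond e (P.inst ρ τ) (Q.inst ρ τ)
  | .call X ps as l t => .call X (ps.map ρ) as l (t.inst τ)
  | .block P => .block (P.inst ρ τ)
def Branches.inst (ρ : 𝓛.Name → 𝓛.Name) (τ : List ℕ) : Branches 𝓛 → Branches 𝓛
  | .nil => .nil
  | .cons l L P bs => .cons l L (P.inst ρ τ) (bs.inst ρ τ)
end

mutual
def PExpr.ground : PExpr 𝓛 → Option (GExpr 𝓛.Fn 𝓛.Val)
  | .atom (.val v) => some (.val v)
  | .atom (.var _) => none
  | .app f es => (PExpr.groundList es).map (GExpr.app f)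
def PExpr.groundList : List (PExpr 𝓛) → Option (List (GExpr 𝓛.Fn 𝓛.Val))
  | [] => some []
  | e :: es => do
      let g ← e.ground
      let gs ← PExpr.groundList es
      return g :: gs
end

def PExpr.Eval (s : 𝓛.State) (e : PExpr 𝓛) (v : 𝓛.Val) (s' : 𝓛.State) : Prop :=
  ∃ g, e.ground = some g ∧ 𝓛.eval s g v s'

/-- Transitions of a single process named `p`. -/
inductive PStep (𝒬 : PDecls 𝓛) (p : 𝓛.Name) :
    Proc 𝓛 → Store 𝓛 → Pool 𝓛 → Proc 𝓛 → Store 𝓛 → Pool 𝓛 → Prop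
  | send {q l τ e P S K v s} :
      e.Eval (S p) v s →
      PStep 𝒬 p (.seq (.send q l (.tok τ) e) P) S K
        P (Function.update S p s) (K.add q ⟨l, τ, .val v⟩)
  | recv {l τ Q S K v M} :
      K p = ⟨l, τ, .val v⟩ ::ₘ M →
      PStep 𝒬 p (.seq (.recv l (.tok τ)) Q) S K
        (Q.subst (PSub.single v)) S (Function.update K p M)
  | select {q l τ L P S K} :
      PStep 𝒬 p (.seq (.choice q l (.tok τ) L) P) S K P S (K.add q ⟨l, τ, .lab L⟩)
  | onSelect {τ bs l L Qᵢ Q S K M} :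
      K p = ⟨l, τ, .lab L⟩ ::ₘ M → (l, L, Qᵢ) ∈ bs.toList →
      PStep 𝒬 p (.seq (.branch (.tok τ) bs) Q) S K
        (.seq (.block Qᵢ) Q) S (Function.update K p M)
  | compute {e P S K v s} :
      e.Eval (S p) v s →
      PStep 𝒬 p (.seq (.set e) P) S K
        (P.subst (PSub.single v)) (Function.update S p s) K
  | ifTrue {e P₁ P₂ P S K s} :
      e.Eval (S p) 𝓛.tt s →
      PStep 𝒬 p (.seq (.cond e P₁ P₂) P) S K (.seq (.block P₁) P) S K
  | ifFalse {e P₁ P₂ P S K v s} :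
      e.Eval (S p) v s → v ≠ 𝓛.tt →
      PStep 𝒬 p (.seq (.cond e P₁ P₂) P) S K (.seq (.block P₂) P) S K
  | block {P₁ P₁' P₂ S S' K K'} :
      PStep 𝒬 p P₁ S K P₁' S' K' →
      PStep 𝒬 p (.seq (.block P₁) P₂) S K (.seq (.block P₁') P₂) S' K'
  | delay {I P P' S S' K K'} :
      PStep 𝒬 p P S K P' S' K' →
      PStep 𝒬 p (.seq I P) S K (.seq I P') S' K'
  | call {X ps as l τ d P S K} :
      𝒬 X = some d → ps.length = d.roles.length → as.length = d.arity →
      PStep 𝒬 p (.seq (.call X ps as l (.tok τ)) P) S K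
        (.seq (.block ((d.body.inst (renameRoles d.roles ps) (nextToken l τ)).subst
          (PSub.ofArgs as))) P) S K

/-- Transitions `⟨N, Σ, K⟩ →ₚ ⟨N', Σ', K'⟩` of networks: the process `p` makes a step. -/
def NStep (𝒬 : PDecls 𝓛) (N : Net 𝓛) (S : Store 𝓛) (K : Pool 𝓛) (p : 𝓛.Name)
    (N' : Net 𝓛) (S' : Store 𝓛) (K' : Pool 𝓛) : Prop :=
  ∃ P', PStep 𝒬 p (N p) S K P' S' K' ∧ N' = Function.update N p P'

mutual
/-- The integrity keys in a process. -/
def Proc.keys : Proc 𝓛 → List Key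
  | .nil => []
  | .seq I P => I.keys ++ P.keys
def PInstr.keys : PInstr 𝓛 → List Key
  | .send _ l t _ => [(l, t)]
  | .recv l t => [(l, t)]
  | .set _ => []
  | .choice _ l t _ => [(l, t)]
  | .branch t bs => bs.keys t
  | .cond _ P Q => P.keys ++ Q.keys
  | .call _ _ _ l t => [(l, t)]
  | .block P => P.keys
def Branches.keys (t : Tok) : Branches 𝓛 → List Key
  | .nil => []
  | .cons l _ P bs => (l, t) :: (P.keys ++ bs.keys t)
end

/-- A network is well-formed if the keys in each process are distinct. -/
def Net.WF (N : Net 𝓛) : Prop := ∀ p, (N p).keys.Nodup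

/-- The relation `P ⊒ Q`: up to redundant blocks, `P` is `Q` with additional alternatives in
branching instructions. It is the least precongruence that allows alternatives to be dropped
(`drop`) and identifies `{0}; P` with `P`, `{P}; 0` with `P`, and `{I; 0}; P` with `I; P` for
a branching instruction `I`. -/
inductive Proc.Sup : Proc 𝓛 → Proc 𝓛 → Prop
  | refl (P) : Proc.Sup P P
  | trans {P Q R} : Proc.Sup P Q → Proc.Sup Q R → Proc.Sup P R
  | seq (I) {P Q} : Proc.Sup P Q → Proc.Sup (.seq I P) (.seq I Q)
  | block {P Q} (R) : Proc.Sup P Q → Proc.Sup (.seq (.block P) R) (.seq (.block Q) R)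
  | cond (e) {P₁ P₂ Q₁ Q₂} (R) : Proc.Sup P₁ Q₁ → Proc.Sup P₂ Q₂ →
      Proc.Sup (.seq (.cond e P₁ P₂) R) (.seq (.cond e Q₁ Q₂) R)
  | branch (t l L) {P Q} (bs R) : Proc.Sup P Q →
      Proc.Sup (.seq (.branch t (.cons l L P bs)) R) (.seq (.branch t (.cons l L Q bs)) R)
  | drop (t) {bs bs'} (R) : bs'.toList.Subperm bs.toList →
      Proc.Sup (.seq (.branch t bs) R) (.seq (.branch t bs') R)
  | empty (P) : Proc.Sup (.seq (.block .nil) P) P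
  | empty' (P) : Proc.Sup P (.seq (.block .nil) P)
  | tail (P) : Proc.Sup (.seq (.block P) .nil) P
  | tail' (P) : Proc.Sup P (.seq (.block P) .nil)
  | single (t bs P) : Proc.Sup (.seq (.block (.seq (.branch t bs) .nil)) P) (.seq (.branch t bs) P)
  | single' (t bs P) :
      Proc.Sup (.seq (.branch t bs) P) (.seq (.block (.seq (.branch t bs) .nil)) P)

/-- `N ⊒ M` for networks. -/
def Net.Sup (N M : Net 𝓛) : Prop := ∀ p, (N p).Sup (M p)

end Proc

/-! ## Endpoint projection -/

section EPP
variable {𝓛 : Lang.{u}}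

/-- Projection of atoms; `none` where the atom is located elsewhere. -/
def CAtom.proj (r : 𝓛.Name) : CAtom 𝓛 → Option (PAtom 𝓛)
  | .val v p => if r = p then some (.val v) else none
  | .var p i => if r = p then some (.var i) else none

mutual
def CExpr.proj (r : 𝓛.Name) : CExpr 𝓛 → Option (PExpr 𝓛)
  | .atom a => (a.proj r).map PExpr.atom
  | .app f es => (CExpr.projList r es).map (PExpr.app f)
def CExpr.projList (r : 𝓛.Name) : List (CExpr 𝓛) → Option (List (PExpr 𝓛))
  | [] => some []
  | e :: es => do
      let e' ← e.proj r
      let es' ← CExpr.projList r es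
      return e' :: es'
end

/-- The partial merge operator `⊔`: defined on two branching instructions with the same token and
disjoint sets of labels. -/
def merge : Proc 𝓛 → Proc 𝓛 → Option (PInstr 𝓛)
  | .seq (.branch t bs) .nil, .seq (.branch t' bs') .nil =>
      if t = t' ∧ ∀ b ∈ bs.toList, ∀ b' ∈ bs'.toList, b.2.1 ≠ b'.2.1 then
        some (.branch t (bs.append bs'))
      else none
  | _, _ => none

/-- Projection `⟦C⟧ᵣ` of a choreography on the process `r`; `none` if it is undefined. In argument
lists, the arguments located elsewhere are left out. -/
def Chor.proj (r : 𝓛.Name) : Chor 𝓛 → Option (Proc 𝓛)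
  | .nil => some .nil
  | .seq (.comm l t p e q) C => do
      let P ← C.proj r
      if r = p then
        let e' ← e.proj r
        return .seq (.send q l t e') P
      else if r = q then return .seq (.recv l t) P
      else return P
  | .seq (.recv l t _ q) C => do
      let P ← C.proj r
      if r = q then return .seq (.recv l t) P else return P
  | .seq (.expr _ _ p e) C => do
      let P ← C.proj r
      if r = p then
        let e' ← e.proj r
        return .seq (.set e') P
      else return P
  | .seq (.sel l t p q L) C => do
      let P ← C.proj r
      if r = p then return .seq (.choice q l t L) P
      else if r = q then return .seq (.branch t (.cons l L P .nil)) .nil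
      else return P
  | .seq (.recvSel l t _ q L) C => do
      let P ← C.proj r
      if r = q then return .seq (.branch t (.cons l L P .nil)) .nil else return P
  | .seq (.cond _ _ p e C₁ C₂) C => do
      let P ← C.proj r
      if r = p then
        let e' ← e.proj r
        let P₁ ← C₁.proj r
        let P₂ ← C₂.proj r
        return .seq (.cond e' P₁ P₂) P
      else if r ∈ C₁.pn ∪ C₂.pn then
        let P₁ ← C₁.proj r
        let P₂ ← C₂.proj r
        let I ← merge P₁ P₂
        return .seq I P
      else return P
  | .seq (.call l t X ps as) C => do
      let P ← C.proj r
      if r ∈ ps then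
        return .seq (.call (X, ps.idxOf r) (ps.erase r) (as.filterMap (CAtom.proj r)) l t) P
      else return P
  | .seq (.calling l t ws X ps as C₁) C => do
      let P ← C.proj r
      if r ∈ ps then
        if r ∈ ws then
          return .seq (.call (X, ps.idxOf r) (ps.erase r) (as.filterMap (CAtom.proj r)) l t) P
        else
          let P₁ ← C₁.proj r
          return .seq (.block P₁) P
      else return P
  | .seq (.block C₁) C => do
      let P ← C.proj r
      let P₁ ← C₁.proj r
      return .seq (.block P₁) P

/-- `EPP C N`: the endpoint projection of `C` is defined and equal to the network `N`. -/
def EPP (C : Chor 𝓛) (N : Net 𝓛) : Prop := ∀ r, C.proj r = some (N r)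

/-- The process procedures `⟦𝒟⟧` projected from the choreographic procedures `𝒟`. -/
def CDecls.proj (𝒟 : CDecls 𝓛) : PDecls 𝓛 := fun X => do
  let d ← 𝒟 X.1
  let r ← d.roles[X.2]?
  let P ← d.body.proj r
  return ⟨d.roles.erase r, d.params.count r, P⟩

/-- The projection of all the procedures is defined. -/
def CDecls.Projectable (𝒟 : CDecls 𝓛) : Prop :=
  ∀ X d, 𝒟 X = some d → ∀ r ∈ d.roles, ∃ P, d.body.proj r = some P

end EPP

/-! ## Well-formedness of choreographies -/

section WF
variable {𝓛 : Lang.{u}}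

/-- A call `X(ps, as)` is well-formed: `X` is declared, the processes are distinct and as many as
the roles, and each argument is located at the process that plays the role of the corresponding
parameter. -/
def CallWF (𝒟 : CDecls 𝓛) (X : 𝓛.PName) (ps : List 𝓛.Name) (as : List (CAtom 𝓛)) : Prop :=
  ∃ d, 𝒟 X = some d ∧ ps.Nodup ∧ ps.length = d.roles.length ∧
    as.map CAtom.loc = d.params.map (renameRoles d.roles ps)

/-- `⟨I, K⟩ ✓`. In a call in progress, the local behaviour of a process that waits to enter is
that of its role in the procedure, up to `⊒`. -/
def Instr.WF (𝒟 : CDecls 𝓛) (K : Pool 𝓛) : Instr 𝓛 → Prop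
  | .comm l t p _ q => p ≠ q ∧ ∀ τ, t = .tok τ → ∀ v, (⟨l, τ, .val v⟩ : Msg 𝓛) ∉ K q
  | .sel l t p q L => p ≠ q ∧ ∀ τ, t = .tok τ → (⟨l, τ, .lab L⟩ : Msg 𝓛) ∉ K q
  | .expr _ _ _ _ => True
  | .cond _ _ _ _ C₁ C₂ => C₁.NoRuntime ∧ C₂.NoRuntime
  | .call _ _ X ps as => CallWF 𝒟 X ps as
  | .block _ => True
  | .recv l t _ q => ∃ τ, t = .tok τ ∧ ∃! v, (⟨l, τ, .val v⟩ : Msg 𝓛) ∈ K q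
  | .recvSel l t _ q L => ∃ τ, t = .tok τ ∧ (⟨l, τ, .lab L⟩ : Msg 𝓛) ∈ K q
  | .calling l t ws X ps as C =>
      CallWF 𝒟 X ps as ∧ ws ⊆ ps.toFinset ∧ C.pn ⊆ ps.toFinset ∧
      ∃ τ d, t = .tok τ ∧ 𝒟 X = some d ∧
        ∀ r ∈ ws, ∃ P Q, (d.instantiate ps as (nextToken l τ)).proj r = some P ∧
          C.proj r = some Q ∧ P.Sup Q

/-- A procedure `X(roles, params) = body` is well-formed. -/
structure CDef.WF (𝒟 : CDecls 𝓛) (K : Pool 𝓛) (d : CDef 𝓛) : Prop where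
  roles_nodup : d.roles.Nodup
  params_mem : ∀ r ∈ d.params, r ∈ d.roles
  pn_subset : ∀ r ∈ d.body.pn, r ∈ d.roles
  fv_subset : ∀ x ∈ d.body.fv, x.2 < d.params.count x.1
  stats_wf : ∀ I ∈ d.body.stats, I.WF 𝒟 K
  noRuntime : d.body.NoRuntime
  keys_nodup : d.body.keys.Nodup
  keys_hole : ∀ k ∈ d.body.keys, k.2 = .hole

/-- The configuration `⟨C, Σ, K⟩` is well-formed with respect to the procedures `𝒟` (the states in
`Σ` are not constrained). The undelivered messages are exactly those of the communications and
selections in progress: `stats_wf` says that these have their message, `val_of_mem` and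
`lab_of_mem` that there are no other messages. -/
structure ConfigWF (𝒟 : CDecls 𝓛) (C : Chor 𝓛) (K : Pool 𝓛) : Prop where
  closed : C.fv = ∅
  keys_nodup : C.keys.Nodup
  keys_tok : ∀ k ∈ C.keys, k.2 ≠ .hole
  anc : ∀ I₁ ∈ C.stats, ∀ I₂ ∈ C.stats, ∀ k₁ k₂, I₁.key = some k₁ → I₂.key = some k₂ →
    Key.Anc k₁ k₂ → ∃ l t ws X ps as C', I₁ = .calling l t ws X ps as C' ∧ I₂ ∈ C'.stats
  defs_wf : ∀ X d, 𝒟 X = some d → d.WF 𝒟 K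
  stats_wf : ∀ I ∈ C.stats, I.WF 𝒟 K
  val_of_mem : ∀ q l τ v, (⟨l, τ, .val v⟩ : Msg 𝓛) ∈ K q →
    ∃ p, Instr.recv l (.tok τ) p q ∈ C.stats
  lab_of_mem : ∀ q l τ L, (⟨l, τ, .lab L⟩ : Msg 𝓛) ∈ K q →
    ∃ p, Instr.recvSel l (.tok τ) p q L ∈ C.stats

end WF

end O3

/-!
A choreography and its projection make the same steps, because projection is compatible with
everything a step does.

`Proj r C P` presents the partial function `C.proj r = some P` as a relation with one rule for each
way in which an instruction contributes to the behaviour of `r`; the steps are compared by induction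
on it. Projection commutes with substitution (`Proj.subst`) as long as the two ends of a
communication are distinct, since the binders of `r` in `C` are then those of its projection. It
commutes with the instantiation of procedure bodies (`Proj.inst`) because the roles are renamed
injectively. Together these show that a projected call at `r` unfolds to the projection of the
unfolded call (`CallWF.exists_proj`).

Completeness: when `p` acts, every other process sees nothing but the loss of the alternatives of an
untaken branch and some redundant blocks, so its behaviour goes down along `⊒`
(`CStep.sup_of_ne`), while the projection of `p` makes the step (`CStep.exists_pStep`). Keys stay
distinct in the network because those created by a call with key `(l, τ)` have the token `l :: τ`,
which by the ancestor condition nothing visible to `p` can have before `p` has entered the call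
(`ConfigWF.nodup_keys_of_pStep`).

Soundness: for the projection itself, the choreography can delay whatever comes before the
instruction that acts; a branching merged from the branches of a conditional cannot act before the
conditional is resolved, since no label has been sent to it (`Proj.exists_cStep`). A larger network
`N ⊒ ⟦C⟧` could in addition choose an alternative that `⟦C⟧` does not have. That requires a message
with its key, hence a selection in progress in `C` with this key. If the receiver sees this
selection, its key occurs in `⟦C⟧` and would occur twice in `N`. Otherwise it is inside a call that
the receiver has not entered, its token extends the key of the call, and by the ancestor condition
no branching instruction with that token is reachable (`ConfigWF.mem_keys_or`). Hence the step of
`N` is matched by `⟦C⟧` (`Proc.Sup.exists_pStep`).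
-/

namespace O3

/-! ### Endpoint projection as a relation -/

section Projection
variable {𝓛 : Lang.{u}}

/-- Induction over choreographies with one case for each form of the first instruction. -/
theorem Chor.induction {motive : Chor 𝓛 → Prop} (nil : motive .nil)
    (comm : ∀ l t p e q C, motive C → motive (.seq (.comm l t p e q) C))
    (sel : ∀ l t p q L C, motive C → motive (.seq (.sel l t p q L) C))
    (expr : ∀ l t p e C, motive C → motive (.seq (.expr l t p e) C))
    (cond : ∀ l t p e C₁ C₂ C, motive C₁ → motive C₂ → motive C →
      motive (.seq (.cond l t p e C₁ C₂) C))
    (call : ∀ l t X ps as C, motive C → motive (.seq (.call l t X ps as) C))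
    (block : ∀ C₁ C, motive C₁ → motive C → motive (.seq (.block C₁) C))
    (recv : ∀ l t p q C, motive C → motive (.seq (.recv l t p q) C))
    (recvSel : ∀ l t p q L C, motive C → motive (.seq (.recvSel l t p q L) C))
    (calling : ∀ l t ws X ps as C₁ C, motive C₁ → motive C →
      motive (.seq (.calling l t ws X ps as C₁) C))
    (C : Chor 𝓛) : motive C :=
  Chor.rec (motive_1 := motive) (motive_2 := fun I => ∀ C, motive C → motive (.seq I C))
    nil (fun _ C hI hC => hI C hC) (fun l t p e q C => comm l t p e q C)
    (fun l t p q L C => sel l t p q L C) (fun l t p e C => expr l t p e C)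
    (fun l t p e C₁ C₂ h₁ h₂ C => cond l t p e C₁ C₂ C h₁ h₂)
    (fun l t X ps as C => call l t X ps as C) (fun C₁ h C => block C₁ C h)
    (fun l t p q C => recv l t p q C) (fun l t p q L C => recvSel l t p q L C)
    (fun l t ws X ps as C₁ h C => calling l t ws X ps as C₁ C h) C

/-- `Proj r C P`: the projection of `C` on `r` is defined and equal to `P`. The constructor `skip`
covers all the instructions that contribute nothing at `r`. -/
inductive Proj (r : 𝓛.Name) : Chor 𝓛 → Proc 𝓛 → Prop
  | nil : Proj r .nil .nil
  | skip {I C P} : r ∉ I.pn → (∀ C', I ≠ .block C') → Proj r C P → Proj r (.seq I C) P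
  | send {l t e q C e' P} : e.proj r = some e' → Proj r C P →
      Proj r (.seq (.comm l t r e q) C) (.seq (.send q l t e') P)
  | commRecv {l t p e C P} : r ≠ p → Proj r C P →
      Proj r (.seq (.comm l t p e r) C) (.seq (.recv l t) P)
  | recv {l t p C P} : Proj r C P → Proj r (.seq (.recv l t p r) C) (.seq (.recv l t) P)
  | expr {l t e C e' P} : e.proj r = some e' → Proj r C P →
      Proj r (.seq (.expr l t r e) C) (.seq (.set e') P)
  | choice {l t q L C P} : Proj r C P →
      Proj r (.seq (.sel l t r q L) C) (.seq (.choice q l t L) P)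
  | selBranch {l t p L C P} : r ≠ p → Proj r C P →
      Proj r (.seq (.sel l t p r L) C) (.seq (.branch t (.cons l L P .nil)) .nil)
  | recvSel {l t p L C P} : Proj r C P →
      Proj r (.seq (.recvSel l t p r L) C) (.seq (.branch t (.cons l L P .nil)) .nil)
  | cond {l t e C₁ C₂ C e' P₁ P₂ P} : e.proj r = some e' → Proj r C₁ P₁ → Proj r C₂ P₂ →
      Proj r C P → Proj r (.seq (.cond l t r e C₁ C₂) C) (.seq (.cond e' P₁ P₂) P)
  | merge {l t p e C₁ C₂ C t' bs₁ bs₂ P} : r ≠ p → r ∈ C₁.pn ∪ C₂.pn →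
      (∀ b ∈ bs₁.toList, ∀ b' ∈ bs₂.toList, b.2.1 ≠ b'.2.1) →
      Proj r C₁ (.seq (.branch t' bs₁) .nil) → Proj r C₂ (.seq (.branch t' bs₂) .nil) →
      Proj r C P →
      Proj r (.seq (.cond l t p e C₁ C₂) C) (.seq (.branch t' (bs₁.append bs₂)) P)
  | call {l t X ps as C P} : r ∈ ps → Proj r C P →
      Proj r (.seq (.call l t X ps as) C)
        (.seq (.call (X, ps.idxOf r) (ps.erase r) (as.filterMap (CAtom.proj r)) l t) P)
  | wait {l t ws X ps as C₁ C P} : r ∈ ps → r ∈ ws → Proj r C P →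
      Proj r (.seq (.calling l t ws X ps as C₁) C)
        (.seq (.call (X, ps.idxOf r) (ps.erase r) (as.filterMap (CAtom.proj r)) l t) P)
  | entered {l t ws X ps as C₁ C P₁ P} : r ∈ ps → r ∉ ws → Proj r C₁ P₁ → Proj r C P →
      Proj r (.seq (.calling l t ws X ps as C₁) C) (.seq (.block P₁) P)
  | block {C₁ C P₁ P} : Proj r C₁ P₁ → Proj r C P →
      Proj r (.seq (.block C₁) C) (.seq (.block P₁) P)

theorem merge_eq_some {P₁ P₂ : Proc 𝓛} {I : PInstr 𝓛} :
    merge P₁ P₂ = some I ↔ ∃ t bs₁ bs₂, P₁ = .seq (.branch t bs₁) .nil ∧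
      P₂ = .seq (.branch t bs₂) .nil ∧ I = .branch t (bs₁.append bs₂) ∧
      ∀ b ∈ bs₁.toList, ∀ b' ∈ bs₂.toList, b.2.1 ≠ b'.2.1 := by
  constructor
  · intro h
    unfold merge at h
    split at h
    · split at h
      · rename_i h'
        obtain ⟨rfl, h'⟩ := h'
        simp only [Option.some.injEq] at h
        exact ⟨_, _, _, rfl, rfl, h.symm, h'⟩
      · simp at h
    · simp at h
  · rintro ⟨t, bs₁, bs₂, rfl, rfl, rfl, h⟩
    simp only [merge]
    rw [if_pos ⟨trivial, h⟩]

theorem Proj.of_proj {r : 𝓛.Name} {C : Chor 𝓛} : ∀ {P}, C.proj r = some P → Proj r C P := by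
  induction C using Chor.induction with
  | nil => intro P h; simp only [Chor.proj, Option.some.injEq] at h; subst h; exact .nil
  | comm l t p e q C ih =>
    intro P h
    simp only [Chor.proj, Option.bind_eq_bind, Option.bind_eq_some_iff, Option.pure_def] at h
    obtain ⟨Q, hQ, h⟩ := h
    split at h
    · subst_vars
      simp only [Option.bind_eq_some_iff, Option.some.injEq] at h
      obtain ⟨e', he, rfl⟩ := h
      exact .send he (ih hQ)
    · split at h
      · subst_vars; simp only [Option.some.injEq] at h; subst h; exact .commRecv ‹_› (ih hQ)
      · simp only [Option.some.injEq] at h; subst h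
        exact .skip (by simp [Instr.pn, *]) (by simp) (ih hQ)
  | sel l t p q L C ih =>
    intro P h
    simp only [Chor.proj, Option.bind_eq_bind, Option.bind_eq_some_iff, Option.pure_def] at h
    obtain ⟨Q, hQ, h⟩ := h
    split at h
    · subst_vars; simp only [Option.some.injEq] at h; subst h; exact .choice (ih hQ)
    · split at h
      · subst_vars; simp only [Option.some.injEq] at h; subst h; exact .selBranch ‹_› (ih hQ)
      · simp only [Option.some.injEq] at h; subst h
        exact .skip (by simp [Instr.pn, *]) (by simp) (ih hQ)
  | expr l t p e C ih =>
    intro P h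
    simp only [Chor.proj, Option.bind_eq_bind, Option.bind_eq_some_iff, Option.pure_def] at h
    obtain ⟨Q, hQ, h⟩ := h
    split at h
    · subst_vars
      simp only [Option.bind_eq_some_iff, Option.some.injEq] at h
      obtain ⟨e', he, rfl⟩ := h
      exact .expr he (ih hQ)
    · simp only [Option.some.injEq] at h; subst h
      exact .skip (by simp [Instr.pn, *]) (by simp) (ih hQ)
  | cond l t p e C₁ C₂ C ih₁ ih₂ ih =>
    intro P h
    simp only [Chor.proj, Option.bind_eq_bind, Option.bind_eq_some_iff, Option.pure_def] at h
    obtain ⟨Q, hQ, h⟩ := h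
    split at h
    · subst_vars
      simp only [Option.bind_eq_some_iff, Option.some.injEq] at h
      obtain ⟨e', he, P₁, h₁, P₂, h₂, rfl⟩ := h
      exact .cond he (ih₁ h₁) (ih₂ h₂) (ih hQ)
    · split at h
      · simp only [Option.bind_eq_some_iff, Option.some.injEq] at h
        obtain ⟨P₁, h₁, P₂, h₂, I, hI, rfl⟩ := h
        obtain ⟨t', bs₁, bs₂, rfl, rfl, rfl, hd⟩ := merge_eq_some.1 hI
        exact .merge ‹_› ‹_› hd (ih₁ h₁) (ih₂ h₂) (ih hQ)
      · simp only [Option.some.injEq] at h; subst h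
        refine .skip ?_ (by simp) (ih hQ)
        simp only [Instr.pn, Finset.union_assoc, Finset.mem_union, Finset.mem_singleton]
        simp_all
  | call l t X ps as C ih =>
    intro P h
    simp only [Chor.proj, Option.bind_eq_bind, Option.bind_eq_some_iff, Option.pure_def] at h
    obtain ⟨Q, hQ, h⟩ := h
    split at h <;> simp only [Option.some.injEq] at h <;> subst h
    · exact .call ‹_› (ih hQ)
    · exact .skip (by simp [Instr.pn, *]) (by simp) (ih hQ)
  | block C₁ C ih₁ ih =>
    intro P h
    simp only [Chor.proj, Option.bind_eq_bind, Option.bind_eq_some_iff, Option.pure_def,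
      Option.some.injEq] at h
    obtain ⟨Q, hQ, P₁, h₁, rfl⟩ := h
    exact .block (ih₁ h₁) (ih hQ)
  | recv l t p q C ih =>
    intro P h
    simp only [Chor.proj, Option.bind_eq_bind, Option.bind_eq_some_iff, Option.pure_def] at h
    obtain ⟨Q, hQ, h⟩ := h
    split at h <;> simp only [Option.some.injEq] at h <;> subst_vars
    · exact .recv (ih hQ)
    · exact .skip (by simp [Instr.pn, *]) (by simp) (ih hQ)
  | recvSel l t p q L C ih =>
    intro P h
    simp only [Chor.proj, Option.bind_eq_bind, Option.bind_eq_some_iff, Option.pure_def] at h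
    obtain ⟨Q, hQ, h⟩ := h
    split at h <;> simp only [Option.some.injEq] at h <;> subst_vars
    · exact .recvSel (ih hQ)
    · exact .skip (by simp [Instr.pn, *]) (by simp) (ih hQ)
  | calling l t ws X ps as C₁ C ih₁ ih =>
    intro P h
    simp only [Chor.proj, Option.bind_eq_bind, Option.bind_eq_some_iff, Option.pure_def] at h
    obtain ⟨Q, hQ, h⟩ := h
    split at h
    · split at h
      · simp only [Option.some.injEq] at h; subst h; exact .wait ‹_› ‹_› (ih hQ)
      · simp only [Option.bind_eq_some_iff, Option.some.injEq] at h
        obtain ⟨P₁, h₁, rfl⟩ := h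
        exact .entered ‹_› ‹_› (ih₁ h₁) (ih hQ)
    · simp only [Option.some.injEq] at h; subst h
      exact .skip (by simp [Instr.pn, *]) (by simp) (ih hQ)

theorem Proj.proj_eq {r : 𝓛.Name} {C : Chor 𝓛} {P : Proc 𝓛} (h : Proj r C P) :
    C.proj r = some P := by
  induction h with
  | nil => rfl
  | @skip I C P hr hb h ih =>
    cases I <;> simp only [Instr.pn, Finset.mem_insert, Finset.mem_singleton, Finset.mem_union,
      List.mem_toFinset, not_or] at hr
    case block C' => exact absurd rfl (hb C')
    all_goals simp [Chor.proj, ih, hr]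
  | merge hr hpn hd h₁ h₂ h ih₁ ih₂ ih =>
    simp only [Chor.proj, ih, ih₁, ih₂, hr, hpn, Option.bind_eq_bind, Option.bind_some,
      if_true, if_false, Option.pure_def, merge_eq_some.2 ⟨_, _, _, rfl, rfl, rfl, hd⟩]
  | _ => simp [Chor.proj, *]

theorem Proj.unique {r : 𝓛.Name} {C : Chor 𝓛} {P Q : Proc 𝓛} (h : Proj r C P)
    (h' : Proj r C Q) : P = Q :=
  Option.some.inj (h.proj_eq.symm.trans h'.proj_eq)

end Projection

/-! ### Expressions -/

section Expr
variable {𝓛 : Lang.{u}}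

theorem CAtom.proj_of_loc {r : 𝓛.Name} {a : CAtom 𝓛} (h : a.loc = r) : ∃ b, a.proj r = some b := by
  cases a <;> simp_all [CAtom.proj, CAtom.loc]

theorem CAtom.proj_of_loc_ne {r : 𝓛.Name} {a : CAtom 𝓛} (h : a.loc ≠ r) : a.proj r = none := by
  cases a <;> simp only [CAtom.loc] at h <;> simp [CAtom.proj, h.symm]

mutual
theorem CExpr.ground_eq_of_proj {r : 𝓛.Name} :
    ∀ {e : CExpr 𝓛} {e'}, e.proj r = some e' → e.ground r = e'.ground
  | .atom (.val v p), e', h => by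
    simp only [CExpr.proj, CAtom.proj] at h
    split at h
    · simp only [Option.map_some, Option.some.injEq] at h
      subst h
      simp_all [CExpr.ground, PExpr.ground]
    · simp at h
  | .atom (.var p i), e', h => by
    simp only [CExpr.proj, CAtom.proj] at h
    split at h
    · simp only [Option.map_some, Option.some.injEq] at h
      subst h
      simp [CExpr.ground, PExpr.ground]
    · simp at h
  | .app f es, e', h => by
    simp only [CExpr.proj, Option.map_eq_some_iff] at h
    obtain ⟨es', h, rfl⟩ := h
    simp only [CExpr.ground, PExpr.ground, CExpr.groundList_eq_of_proj h]
theorem CExpr.groundList_eq_of_proj {r : 𝓛.Name} :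
    ∀ {es : List (CExpr 𝓛)} {es'}, CExpr.projList r es = some es' →
      CExpr.groundList r es = PExpr.groundList es'
  | [], es', h => by
    simp only [CExpr.projList, Option.some.injEq] at h
    subst h
    rfl
  | e :: es, es', h => by
    simp only [CExpr.projList, Option.bind_eq_bind, Option.bind_eq_some_iff, Option.pure_def,
      Option.some.injEq] at h
    obtain ⟨e', he, es', hes, rfl⟩ := h
    simp only [CExpr.groundList, PExpr.groundList, CExpr.ground_eq_of_proj he,
      CExpr.groundList_eq_of_proj hes]
end

theorem CExpr.eval_iff_of_proj {r : 𝓛.Name} {e : CExpr 𝓛} {e'} (h : e.proj r = some e')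
    {s v s'} : e.Eval r s v s' ↔ e'.Eval s v s' := by
  simp only [CExpr.Eval, PExpr.Eval, CExpr.ground_eq_of_proj h]

/-- `SubRel r σ π`: the substitution `σ` replaces variables by atoms of the same process, and acts
on the variables of `r` as `π` does. -/
structure SubRel (r : 𝓛.Name) (σ : CSub 𝓛) (π : PSub 𝓛) : Prop where
  loc : ∀ p i, (σ p i).loc = p
  proj : ∀ i, (σ r i).proj r = some (π i)

theorem CAtom.loc_shift (q : 𝓛.Name) (a : CAtom 𝓛) : (a.shift q).loc = a.loc := by
  cases a
  · rfl
  · simp only [CAtom.shift]; split <;> rfl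

theorem SubRel.loc_lift {r : 𝓛.Name} {σ : CSub 𝓛} {π : PSub 𝓛} (h : SubRel r σ π) (q p : 𝓛.Name)
    (i : ℕ) : (σ.lift q p i).loc = p := by
  unfold CSub.lift
  split
  · cases i
    · rfl
    · simp only [CAtom.loc_shift, h.loc]
  · simp only [CAtom.loc_shift, h.loc]

theorem CAtom.proj_shift_self {r : 𝓛.Name} {a : CAtom 𝓛} {b} (h : a.proj r = some b) :
    (a.shift r).proj r = some b.shift := by
  cases a with
  | val v p => simp only [CAtom.proj] at h; split at h <;> simp_all [CAtom.proj, CAtom.shift]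
               subst h; rfl
  | var p i =>
    simp only [CAtom.proj] at h
    split at h <;> simp_all [CAtom.proj, CAtom.shift]
    subst h; rfl

theorem CAtom.shift_of_loc_ne {q : 𝓛.Name} {a : CAtom 𝓛} (h : a.loc ≠ q) : a.shift q = a := by
  cases a
  · rfl
  · simp_all [CAtom.shift, CAtom.loc]

theorem SubRel.lift {r : 𝓛.Name} {σ : CSub 𝓛} {π : PSub 𝓛} (h : SubRel r σ π) :
    SubRel r (σ.lift r) π.lift where
  loc := h.loc_lift r
  proj i := by
    cases i with
    | zero => simp [CSub.lift, PSub.lift, CAtom.proj]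
    | succ i => simpa [CSub.lift, PSub.lift] using CAtom.proj_shift_self (h.proj i)

theorem SubRel.lift_of_ne {r q : 𝓛.Name} {σ : CSub 𝓛} {π : PSub 𝓛} (h : SubRel r σ π)
    (hq : r ≠ q) : SubRel r (σ.lift q) π where
  loc := h.loc_lift q
  proj i := by
    simp only [CSub.lift, hq, if_false]
    rw [CAtom.shift_of_loc_ne (by rw [h.loc]; exact hq), h.proj]

theorem SubRel.single_self (r : 𝓛.Name) (v : 𝓛.Val) :
    SubRel r (CSub.single r v) (PSub.single v) where
  loc p i := by
    unfold CSub.single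
    split
    · cases i <;> simp_all [CAtom.loc]
    · rfl
  proj i := by cases i <;> simp [CSub.single, PSub.single, CAtom.proj]

theorem SubRel.single_of_ne {r q : 𝓛.Name} (h : r ≠ q) (v : 𝓛.Val) :
    SubRel r (CSub.single q v) PAtom.var where
  loc p i := by
    unfold CSub.single
    split
    · cases i <;> simp_all [CAtom.loc]
    · rfl
  proj i := by simp [CSub.single, CAtom.proj, h]

theorem CAtom.loc_subst {r : 𝓛.Name} {σ : CSub 𝓛} {π : PSub 𝓛} (h : SubRel r σ π)
    (a : CAtom 𝓛) : (a.subst σ).loc = a.loc := by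
  cases a
  · rfl
  · exact h.loc _ _

theorem CAtom.proj_subst {r : 𝓛.Name} {σ : CSub 𝓛} {π : PSub 𝓛} (h : SubRel r σ π)
    (a : CAtom 𝓛) : (a.subst σ).proj r = (a.proj r).map (PAtom.subst π) := by
  by_cases hr : a.loc = r
  · cases a with
    | val v p => simp only [CAtom.loc] at hr; subst hr; simp [CAtom.subst, CAtom.proj, PAtom.subst]
    | var p i =>
      simp only [CAtom.loc] at hr; subst hr
      simpa [CAtom.subst, CAtom.proj, PAtom.subst] using h.proj i
  · rw [CAtom.proj_of_loc_ne hr, CAtom.proj_of_loc_ne (by rwa [CAtom.loc_subst h])]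
    rfl

theorem filterMap_proj_subst {r : 𝓛.Name} {σ : CSub 𝓛} {π : PSub 𝓛} (h : SubRel r σ π)
    (as : List (CAtom 𝓛)) : (as.map (CAtom.subst σ)).filterMap (CAtom.proj r) =
      (as.filterMap (CAtom.proj r)).map (PAtom.subst π) := by
  rw [List.filterMap_map, List.map_filterMap]
  congr 1
  funext a
  exact CAtom.proj_subst h a

mutual
theorem CExpr.proj_subst {r : 𝓛.Name} {σ : CSub 𝓛} {π : PSub 𝓛} (h : SubRel r σ π) :
    ∀ e : CExpr 𝓛, (e.subst σ).proj r = (e.proj r).map (PExpr.subst π)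
  | .atom a => by
    simp only [CExpr.subst, CExpr.proj, CAtom.proj_subst h, Option.map_map]
    rfl
  | .app f es => by
    simp only [CExpr.subst, CExpr.proj, CExpr.projList_subst h, Option.map_map]
    rfl
theorem CExpr.projList_subst {r : 𝓛.Name} {σ : CSub 𝓛} {π : PSub 𝓛} (h : SubRel r σ π) :
    ∀ es : List (CExpr 𝓛),
      CExpr.projList r (CExpr.substList σ es) = (CExpr.projList r es).map (PExpr.substList π)
  | [] => rfl
  | e :: es => by
    simp only [CExpr.substList, CExpr.projList, CExpr.proj_subst h, CExpr.projList_subst h]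
    cases e.proj r <;> cases CExpr.projList r es <;> rfl
end

mutual
theorem PExpr.subst_var : ∀ e : PExpr 𝓛, e.subst PAtom.var = e
  | .atom a => by cases a <;> rfl
  | .app f es => by simp only [PExpr.subst, PExpr.substList_var]
theorem PExpr.substList_var : ∀ es : List (PExpr 𝓛), PExpr.substList PAtom.var es = es
  | [] => rfl
  | e :: es => by simp only [PExpr.substList, PExpr.subst_var, PExpr.substList_var]
end

theorem PSub.lift_var : PSub.lift (𝓛 := 𝓛) PAtom.var = PAtom.var := by
  funext i
  cases i <;> rfl

theorem PAtom.subst_var (a : PAtom 𝓛) : a.subst PAtom.var = a := by cases a <;> rfl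

mutual
theorem Proc.subst_var : ∀ P : Proc 𝓛, P.subst PAtom.var = P
  | .nil => rfl
  | .seq I P => by
    have : I.under PAtom.var = PAtom.var := by cases I <;> simp [PInstr.under, PSub.lift_var]
    simp only [Proc.subst, this, PInstr.subst_var, Proc.subst_var]
theorem PInstr.subst_var : ∀ I : PInstr 𝓛, I.subst PAtom.var = I
  | .send _ _ _ e => by simp only [PInstr.subst, PExpr.subst_var]
  | .recv _ _ => rfl
  | .set e => by simp only [PInstr.subst, PExpr.subst_var]
  | .choice _ _ _ _ => rfl
  | .branch _ bs => by simp only [PInstr.subst, Branches.subst_var]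
  | .cond e P Q => by simp only [PInstr.subst, PExpr.subst_var, Proc.subst_var]
  | .call _ _ as _ _ => by
    simp only [PInstr.subst]
    congr 1
    simpa using List.map_congr_left (g := id) fun a _ => PAtom.subst_var a
  | .block P => by simp only [PInstr.subst, Proc.subst_var]
theorem Branches.subst_var : ∀ bs : Branches 𝓛, bs.subst PAtom.var = bs
  | .nil => rfl
  | .cons _ _ P bs => by simp only [Branches.subst, Proc.subst_var, Branches.subst_var]
end

end Expr

/-! ### Substitution and instantiation commute with projection -/

section Chor
variable {𝓛 : Lang.{u}}

theorem forall_stats_seq {I : Instr 𝓛} {C : Chor 𝓛} {q : Instr 𝓛 → Prop} :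
    (∀ J ∈ (Chor.seq I C).stats, q J) ↔ (∀ J ∈ I.stats, q J) ∧ ∀ J ∈ C.stats, q J := by
  simp only [Chor.stats, List.forall_mem_append]

/-- Communications and selections have two distinct ends. -/
def Instr.Distinct : Instr 𝓛 → Prop
  | .comm _ _ p _ q => p ≠ q
  | .sel _ _ p q _ => p ≠ q
  | _ => True

/-- The processes of a call are distinct and the arguments are located at them. -/
def Instr.ArgsLocal : Instr 𝓛 → Prop
  | .call _ _ _ ps as => ps.Nodup ∧ ∀ a ∈ as, a.loc ∈ ps
  | _ => True

theorem Branches.toList_append :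
    ∀ bs bs' : Branches 𝓛, (bs.append bs').toList = bs.toList ++ bs'.toList
  | .nil, _ => rfl
  | .cons _ _ _ bs, bs' => by
    simp only [Branches.append, Branches.toList, Branches.toList_append bs bs', List.cons_append]

theorem Branches.toList_subst (σ : PSub 𝓛) : ∀ bs : Branches 𝓛,
    (bs.subst σ).toList = bs.toList.map fun b => (b.1, b.2.1, b.2.2.subst σ)
  | .nil => rfl
  | .cons _ _ _ bs => by
    simp only [Branches.subst, Branches.toList, Branches.toList_subst σ bs, List.map_cons]

theorem Branches.toList_inst (ρ : 𝓛.Name → 𝓛.Name) (τ : List ℕ) : ∀ bs : Branches 𝓛,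
    (bs.inst ρ τ).toList = bs.toList.map fun b => (b.1, b.2.1, b.2.2.inst ρ τ)
  | .nil => rfl
  | .cons _ _ _ bs => by
    simp only [Branches.inst, Branches.toList, Branches.toList_inst ρ τ bs, List.map_cons]

theorem Branches.subst_append (σ : PSub 𝓛) : ∀ bs bs' : Branches 𝓛,
    (bs.append bs').subst σ = (bs.subst σ).append (bs'.subst σ)
  | .nil, _ => rfl
  | .cons _ _ _ bs, bs' => by
    simp only [Branches.append, Branches.subst, Branches.subst_append σ bs bs']

theorem Branches.inst_append (ρ : 𝓛.Name → 𝓛.Name) (τ : List ℕ) : ∀ bs bs' : Branches 𝓛,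
    (bs.append bs').inst ρ τ = (bs.inst ρ τ).append (bs'.inst ρ τ)
  | .nil, _ => rfl
  | .cons _ _ _ bs, bs' => by
    simp only [Branches.append, Branches.inst, Branches.inst_append ρ τ bs bs']

mutual
theorem Chor.pn_subst : ∀ (C : Chor 𝓛) (σ : CSub 𝓛), (C.subst σ).pn = C.pn
  | .nil, _ => rfl
  | .seq I C, σ => by simp only [Chor.subst, Chor.pn, Instr.pn_subst I, Chor.pn_subst C]
theorem Instr.pn_subst : ∀ (I : Instr 𝓛) (σ : CSub 𝓛), (I.subst σ).pn = I.pn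
  | .cond _ _ _ _ C₁ C₂, σ => by
    simp only [Instr.subst, Instr.pn, Chor.pn_subst C₁, Chor.pn_subst C₂]
  | .block C, σ => by simp only [Instr.subst, Instr.pn, Chor.pn_subst C]
  | .comm .., _ | .sel .., _ | .expr .., _ | .call .., _ | .recv .., _ | .recvSel .., _
  | .calling .., _ => by simp only [Instr.subst, Instr.pn]
end

mutual
theorem Chor.pn_inst (ρ : 𝓛.Name → 𝓛.Name) (τ : List ℕ) :
    ∀ C : Chor 𝓛, (C.inst ρ τ).pn = C.pn.image ρ
  | .nil => rfl
  | .seq I C => by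
    simp only [Chor.inst, Chor.pn, Instr.pn_inst ρ τ I, Chor.pn_inst ρ τ C, Finset.image_union]
theorem Instr.pn_inst (ρ : 𝓛.Name → 𝓛.Name) (τ : List ℕ) :
    ∀ I : Instr 𝓛, (I.inst ρ τ).pn = I.pn.image ρ
  | .cond _ _ _ _ C₁ C₂ => by
    simp only [Instr.inst, Instr.pn, Chor.pn_inst ρ τ C₁, Chor.pn_inst ρ τ C₂,
      Finset.image_union, Finset.image_singleton]
  | .block C => by simp only [Instr.inst, Instr.pn, Chor.pn_inst ρ τ C]
  | .comm .. | .sel .. | .expr .. | .recv .. | .recvSel .. => by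
    simp [Instr.inst, Instr.pn, Finset.image_insert]
  | .call .. | .calling .. => by ext; simp [Instr.inst, Instr.pn]
end

mutual
theorem Chor.stats_inst (ρ : 𝓛.Name → 𝓛.Name) (τ : List ℕ) :
    ∀ C : Chor 𝓛, (C.inst ρ τ).stats = C.stats.map (Instr.inst ρ τ)
  | .nil => rfl
  | .seq I C => by
    simp only [Chor.inst, Chor.stats, Instr.stats_inst ρ τ I, Chor.stats_inst ρ τ C,
      List.map_append]
theorem Instr.stats_inst (ρ : 𝓛.Name → 𝓛.Name) (τ : List ℕ) :
    ∀ I : Instr 𝓛, (I.inst ρ τ).stats = I.stats.map (Instr.inst ρ τ)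
  | .cond _ _ _ _ C₁ C₂ => by
    simp only [Instr.inst, Instr.stats, Chor.stats_inst ρ τ C₁, Chor.stats_inst ρ τ C₂,
      List.map_append, List.map_cons]
  | .block C => by simp only [Instr.inst, Instr.stats, Chor.stats_inst ρ τ C]
  | .calling _ _ _ _ _ _ C => by
    simp only [Instr.inst, Instr.stats, Chor.stats_inst ρ τ C, List.map_cons]
  | .comm .. | .sel .. | .expr .. | .recv .. | .recvSel .. | .call .. => by
    simp only [Instr.inst, Instr.stats, List.map_cons, List.map_nil]
end

/-- An instruction that contributes nothing at `r` binds no variable of `r`. -/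
theorem SubRel.under {r : 𝓛.Name} {σ : CSub 𝓛} {π : PSub 𝓛} (h : SubRel r σ π) {I : Instr 𝓛}
    (hr : r ∉ I.pn) : SubRel r (I.under σ) π := by
  cases I <;> simp only [Instr.pn, Finset.mem_insert, Finset.mem_singleton, not_or] at hr <;>
    simp only [Instr.under] <;> first | exact h | exact h.lift_of_ne (by tauto)

theorem Proj.subst {r : 𝓛.Name} {C : Chor 𝓛} {P : Proc 𝓛} (h : Proj r C P) {σ : CSub 𝓛}
    {π : PSub 𝓛} (hσ : SubRel r σ π) (hd : ∀ I ∈ C.stats, I.Distinct) :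
    Proj r (C.subst σ) (P.subst π) := by
  induction h generalizing σ π with
  | nil => exact .nil
  | @skip I C P hr hb h ih =>
    rw [forall_stats_seq] at hd
    refine .skip (by rwa [Instr.pn_subst]) ?_ (ih (hσ.under hr) hd.2)
    intro C'
    cases I <;> simp [Instr.subst]
    exact absurd rfl (hb _)
  | @send l t e q C e' P he h ih =>
    simp only [forall_stats_seq, Instr.stats, List.forall_mem_singleton, Instr.Distinct] at hd
    exact .send (by rw [CExpr.proj_subst hσ, he]; rfl) (ih (hσ.lift_of_ne hd.1) hd.2)
  | commRecv hr h ih => exact .commRecv hr (ih hσ.lift (forall_stats_seq.1 hd).2)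
  | recv h ih => exact .recv (ih hσ.lift (forall_stats_seq.1 hd).2)
  | expr he h ih =>
    exact .expr (by rw [CExpr.proj_subst hσ, he]; rfl) (ih hσ.lift (forall_stats_seq.1 hd).2)
  | choice h ih => exact .choice (ih hσ (forall_stats_seq.1 hd).2)
  | selBranch hr h ih => exact .selBranch hr (ih hσ (forall_stats_seq.1 hd).2)
  | recvSel h ih => exact .recvSel (ih hσ (forall_stats_seq.1 hd).2)
  | cond he h₁ h₂ h ih₁ ih₂ ih =>
    simp only [forall_stats_seq, Instr.stats, List.forall_mem_cons, List.forall_mem_append] at hd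
    exact .cond (by rw [CExpr.proj_subst hσ, he]; rfl) (ih₁ hσ hd.1.2.1) (ih₂ hσ hd.1.2.2)
      (ih hσ hd.2)
  | merge hr hpn hl h₁ h₂ h ih₁ ih₂ ih =>
    simp only [forall_stats_seq, Instr.stats, List.forall_mem_cons, List.forall_mem_append] at hd
    simp only [Proc.subst, PInstr.subst, Branches.subst_append]
    refine .merge hr (by rwa [Chor.pn_subst, Chor.pn_subst]) ?_ (ih₁ hσ hd.1.2.1)
      (ih₂ hσ hd.1.2.2) (ih hσ hd.2)
    simp only [Branches.toList_subst, List.mem_map]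
    rintro _ ⟨b, hb, rfl⟩ _ ⟨b', hb', rfl⟩
    exact hl b hb b' hb'
  | call hr h ih =>
    simp only [Proc.subst, PInstr.subst, ← filterMap_proj_subst hσ]
    exact .call hr (ih hσ (forall_stats_seq.1 hd).2)
  | wait hr hw h ih =>
    simp only [Proc.subst, PInstr.subst, ← filterMap_proj_subst hσ]
    exact .wait hr hw (ih hσ (forall_stats_seq.1 hd).2)
  | entered hr hw h₁ h ih₁ ih =>
    simp only [forall_stats_seq, Instr.stats, List.forall_mem_cons] at hd
    exact .entered hr hw (ih₁ hσ hd.1.2) (ih hσ hd.2)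
  | block h₁ h ih₁ ih =>
    simp only [forall_stats_seq, Instr.stats] at hd
    exact .block (ih₁ hσ hd.1) (ih hσ hd.2)

mutual
theorem CExpr.proj_inst {r : 𝓛.Name} (ρ : 𝓛.Name → 𝓛.Name) :
    ∀ {e : CExpr 𝓛} {e'}, e.proj r = some e' → (e.inst ρ).proj (ρ r) = some e'
  | .atom (.val v p), e', h => by
    simp only [CExpr.proj, CAtom.proj] at h
    split at h
    · simp_all [CExpr.inst, CAtom.inst, CExpr.proj, CAtom.proj]
    · simp at h
  | .atom (.var p i), e', h => by
    simp only [CExpr.proj, CAtom.proj] at h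
    split at h
    · simp_all [CExpr.inst, CAtom.inst, CExpr.proj, CAtom.proj]
    · simp at h
  | .app f es, e', h => by
    simp only [CExpr.proj, Option.map_eq_some_iff] at h
    obtain ⟨es', h, rfl⟩ := h
    simp only [CExpr.inst, CExpr.proj, CExpr.projList_inst ρ h, Option.map_some]
theorem CExpr.projList_inst {r : 𝓛.Name} (ρ : 𝓛.Name → 𝓛.Name) :
    ∀ {es : List (CExpr 𝓛)} {es'}, CExpr.projList r es = some es' →
      CExpr.projList (ρ r) (CExpr.instList ρ es) = some es'
  | [], es', h => h
  | e :: es, es', h => by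
    simp only [CExpr.projList, Option.bind_eq_bind, Option.bind_eq_some_iff, Option.pure_def,
      Option.some.injEq] at h
    obtain ⟨e', he, es', hes, rfl⟩ := h
    simp only [CExpr.instList, CExpr.projList, CExpr.proj_inst ρ he, CExpr.projList_inst ρ hes]
    rfl
end

theorem CAtom.proj_inst {ρ : 𝓛.Name → 𝓛.Name} {A : Set 𝓛.Name} (hρ : A.InjOn ρ) {r : 𝓛.Name}
    (hr : r ∈ A) {a : CAtom 𝓛} (ha : a.loc ∈ A) : (a.inst ρ).proj (ρ r) = a.proj r := by
  cases a <;> simp only [CAtom.loc] at ha <;>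
    simp only [CAtom.inst, CAtom.proj, hρ.eq_iff hr ha]

theorem idxOf_map_of_injOn {α β : Type*} [DecidableEq α] [DecidableEq β] {ρ : α → β}
    {A : Set α} (hρ : A.InjOn ρ) {r : α} (hr : r ∈ A) :
    ∀ {ps : List α}, (∀ p ∈ ps, p ∈ A) → (ps.map ρ).idxOf (ρ r) = ps.idxOf r
  | [], _ => rfl
  | p :: ps, h => by
    rw [List.forall_mem_cons] at h
    have : (ρ p == ρ r) = (p == r) := by
      rw [Bool.eq_iff_iff, beq_iff_eq, beq_iff_eq, hρ.eq_iff h.1 hr]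
    simp only [List.map_cons, List.idxOf_cons, idxOf_map_of_injOn hρ hr h.2, this]

theorem erase_map_of_injOn {α β : Type*} [DecidableEq α] [DecidableEq β] {ρ : α → β}
    {A : Set α} (hρ : A.InjOn ρ) {r : α} (hr : r ∈ A) :
    ∀ {ps : List α}, (∀ p ∈ ps, p ∈ A) → (ps.map ρ).erase (ρ r) = (ps.erase r).map ρ
  | [], _ => rfl
  | p :: ps, h => by
    rw [List.forall_mem_cons] at h
    simp only [List.map_cons, List.erase_cons, beq_iff_eq, erase_map_of_injOn hρ hr h.2]
    by_cases hp : p = r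
    · simp [hp]
    · simp [hp, show ρ p ≠ ρ r from fun e => hp (hρ h.1 hr e)]

/-- The projection of an instance of a procedure body. The process that plays the role `r` is not
among its own parameters, so its behaviour is instantiated by a renaming `ρ'` that need only agree
with `ρ` on the other roles. -/
theorem Proj.inst {r : 𝓛.Name} {C : Chor 𝓛} {P : Proc 𝓛} (h : Proj r C P)
    {ρ ρ' : 𝓛.Name → 𝓛.Name} (τ : List ℕ) {A : Set 𝓛.Name} (hρ : A.InjOn ρ) (hr : r ∈ A)
    (hρ' : ∀ n ∈ A, n ≠ r → ρ' n = ρ n) (hpn : ∀ n ∈ C.pn, n ∈ A)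
    (hd : ∀ I ∈ C.stats, I.Distinct) (ha : ∀ I ∈ C.stats, I.ArgsLocal)
    (hn : ∀ I ∈ C.stats, ¬ I.IsRuntime) :
    Proj (ρ r) (C.inst ρ τ) (P.inst ρ' τ) := by
  have hne : ∀ {p}, p ∈ A → r ≠ p → ρ r ≠ ρ p := fun hp h e => h (hρ hr hp e)
  induction h with
  | nil => exact .nil
  | @skip I C P hrI hb h ih =>
    rw [forall_stats_seq] at hd ha hn
    simp only [Chor.pn, Finset.mem_union, or_imp, forall_and] at hpn
    refine .skip ?_ ?_ (ih hpn.2 hd.2 ha.2 hn.2)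
    · rw [Instr.pn_inst, Finset.mem_image]
      rintro ⟨p, hp, e⟩
      exact hrI (hρ (hpn.1 p hp) hr e ▸ hp)
    · intro C'
      cases I <;> simp [Instr.inst]
      exact absurd rfl (hb _)
  | @send l t e q C e' P he h ih =>
    simp only [forall_stats_seq, Instr.stats, List.forall_mem_singleton, Instr.Distinct] at hd ha hn
    simp only [Chor.pn, Instr.pn, Finset.mem_union, Finset.mem_insert, Finset.mem_singleton, or_imp,
      forall_and, forall_eq] at hpn
    simp only [Chor.inst, Instr.inst, Proc.inst, PInstr.inst, hρ' q hpn.1.2 hd.1.symm]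
    exact .send (CExpr.proj_inst ρ he) (ih hpn.2 hd.2 ha.2 hn.2)
  | commRecv hrp h ih =>
    rw [forall_stats_seq] at hd ha hn
    simp only [Chor.pn, Instr.pn, Finset.mem_union, Finset.mem_insert, Finset.mem_singleton, or_imp,
      forall_and, forall_eq] at hpn
    exact .commRecv (hne hpn.1.1 hrp) (ih hpn.2 hd.2 ha.2 hn.2)
  | recv h ih =>
    simp [forall_stats_seq, Instr.stats, Instr.IsRuntime] at hn
  | expr he h ih =>
    rw [forall_stats_seq] at hd ha hn
    simp only [Chor.pn, Finset.mem_union, or_imp, forall_and] at hpn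
    exact .expr (CExpr.proj_inst ρ he) (ih hpn.2 hd.2 ha.2 hn.2)
  | @choice l t q L C P h ih =>
    simp only [forall_stats_seq, Instr.stats, List.forall_mem_singleton, Instr.Distinct] at hd ha hn
    simp only [Chor.pn, Instr.pn, Finset.mem_union, Finset.mem_insert, Finset.mem_singleton, or_imp,
      forall_and, forall_eq] at hpn
    simp only [Chor.inst, Instr.inst, Proc.inst, PInstr.inst, hρ' q hpn.1.2 hd.1.symm]
    exact .choice (ih hpn.2 hd.2 ha.2 hn.2)
  | selBranch hrp h ih =>
    rw [forall_stats_seq] at hd ha hn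
    simp only [Chor.pn, Instr.pn, Finset.mem_union, Finset.mem_insert, Finset.mem_singleton, or_imp,
      forall_and, forall_eq] at hpn
    exact .selBranch (hne hpn.1.1 hrp) (ih hpn.2 hd.2 ha.2 hn.2)
  | recvSel h ih =>
    simp [forall_stats_seq, Instr.stats, Instr.IsRuntime] at hn
  | cond he h₁ h₂ h ih₁ ih₂ ih =>
    simp only [forall_stats_seq, Instr.stats, List.forall_mem_cons, List.forall_mem_append]
      at hd ha hn
    simp only [Chor.pn, Instr.pn, Finset.mem_union, or_imp, forall_and] at hpn
    exact .cond (CExpr.proj_inst ρ he) (ih₁ hpn.1.1.2 hd.1.2.1 ha.1.2.1 hn.1.2.1)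
      (ih₂ hpn.1.2 hd.1.2.2 ha.1.2.2 hn.1.2.2) (ih hpn.2 hd.2 ha.2 hn.2)
  | merge hrp hmem hl h₁ h₂ h ih₁ ih₂ ih =>
    simp only [forall_stats_seq, Instr.stats, List.forall_mem_cons, List.forall_mem_append]
      at hd ha hn
    simp only [Chor.pn, Instr.pn, Finset.mem_union, Finset.mem_singleton, or_imp, forall_and,
      forall_eq] at hpn
    simp only [Proc.inst, PInstr.inst, Branches.inst_append]
    refine .merge (hne hpn.1.1.1 hrp) ?_ ?_ (ih₁ hpn.1.1.2 hd.1.2.1 ha.1.2.1 hn.1.2.1)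
      (ih₂ hpn.1.2 hd.1.2.2 ha.1.2.2 hn.1.2.2) (ih hpn.2 hd.2 ha.2 hn.2)
    · rw [Chor.pn_inst, Chor.pn_inst, ← Finset.image_union]
      exact Finset.mem_image_of_mem ρ hmem
    · simp only [Branches.toList_inst, List.mem_map]
      rintro _ ⟨b, hb, rfl⟩ _ ⟨b', hb', rfl⟩
      exact hl b hb b' hb'
  | @call l t X ps as C P hrp h ih =>
    simp only [forall_stats_seq, Instr.stats, List.forall_mem_singleton, Instr.ArgsLocal]
      at hd ha hn
    simp only [Chor.pn, Instr.pn, Finset.mem_union, List.mem_toFinset, or_imp, forall_and] at hpn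
    have := Proj.call (l := l) (t := t.inst τ) (X := X) (as := as.map (CAtom.inst ρ))
      (List.mem_map_of_mem hrp) (ih hpn.2 hd.2 ha.2 hn.2)
    rw [idxOf_map_of_injOn hρ hr hpn.1, erase_map_of_injOn hρ hr hpn.1, List.filterMap_map] at this
    simp only [Chor.inst, Instr.inst, Proc.inst, PInstr.inst]
    have h₁ : (ps.erase r).map ρ' = (ps.erase r).map ρ := List.map_congr_left fun p hp => by
      have := (List.Nodup.mem_erase_iff ha.1.1).1 hp
      exact hρ' p (hpn.1 p this.2) this.1
    have h₂ : as.filterMap (CAtom.proj (ρ r) ∘ CAtom.inst ρ) = as.filterMap (CAtom.proj r) :=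
      List.filterMap_congr fun a hm => CAtom.proj_inst hρ hr (hpn.1 _ (ha.1.2 a hm))
    rw [h₁, ← h₂]
    exact this
  | wait hr hw h ih =>
    simp [forall_stats_seq, Instr.stats, Instr.IsRuntime] at hn
  | entered hr hw h₁ h ih₁ ih =>
    simp [forall_stats_seq, Instr.stats, Instr.IsRuntime] at hn
  | block h₁ h ih₁ ih =>
    simp only [forall_stats_seq, Instr.stats] at hd ha hn
    simp only [Chor.pn, Instr.pn, Finset.mem_union, or_imp, forall_and] at hpn
    exact .block (ih₁ hpn.1 hd.1 ha.1 hn.1) (ih hpn.2 hd.2 ha.2 hn.2)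

end Chor

/-! ### Procedure calls -/

section Calls
variable {𝓛 : Lang.{u}}

theorem renameRoles_cons (q p : 𝓛.Name) (qs ps : List 𝓛.Name) (n : 𝓛.Name) :
    renameRoles (q :: qs) (p :: ps) n = if n = q then p else renameRoles qs ps n := by
  simp only [renameRoles, List.zip_cons_cons, List.lookup_cons]
  by_cases h : n = q
  · simp [h]
  · rw [beq_false_of_ne h, if_neg h]

theorem renameRoles_mem : ∀ {qs ps : List 𝓛.Name}, ps.length = qs.length → ∀ {n}, n ∈ qs →
    renameRoles qs ps n ∈ ps
  | [], _, _, _, hn => by simp at hn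
  | q :: qs, [], hl, _, _ => by simp at hl
  | q :: qs, p :: ps, hl, n, hn => by
    rw [renameRoles_cons]
    split
    · exact List.mem_cons_self
    · exact List.mem_cons_of_mem _ (renameRoles_mem (by simpa using hl)
        ((List.mem_cons.1 hn).resolve_left ‹_›))

theorem renameRoles_injOn : ∀ {qs ps : List 𝓛.Name}, ps.length = qs.length → ps.Nodup →
    Set.InjOn (renameRoles qs ps) {n | n ∈ qs}
  | [], _, _, _ => by simp
  | q :: qs, [], hl, _ => by simp at hl
  | q :: qs, p :: ps, hl, hn => by
    rw [List.nodup_cons] at hn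
    have hl : ps.length = qs.length := by simpa using hl
    intro a ha b hb e
    simp only [Set.mem_ofPred_eq, List.mem_cons] at ha hb
    rw [renameRoles_cons, renameRoles_cons] at e
    by_cases h₁ : a = q <;> by_cases h₂ : b = q
    · rw [h₁, h₂]
    · rw [if_pos h₁, if_neg h₂] at e
      exact absurd (e ▸ renameRoles_mem hl (hb.resolve_left h₂)) hn.1
    · rw [if_neg h₁, if_pos h₂] at e
      exact absurd (e ▸ renameRoles_mem hl (ha.resolve_left h₁)) hn.1
    · rw [if_neg h₁, if_neg h₂] at e
      exact renameRoles_injOn hl hn.2 (ha.resolve_left h₁) (hb.resolve_left h₂) e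

theorem map_renameRoles : ∀ {qs ps : List 𝓛.Name}, ps.length = qs.length → qs.Nodup →
    qs.map (renameRoles qs ps) = ps
  | [], ps, hl, _ => by simpa using (List.length_eq_zero_iff.1 hl).symm
  | q :: qs, [], hl, _ => by simp at hl
  | q :: qs, p :: ps, hl, hn => by
    rw [List.nodup_cons] at hn
    rw [List.map_cons, renameRoles_cons, if_pos rfl]
    congr 1
    rw [← map_renameRoles (ps := ps) (by simpa using hl) hn.2]
    refine List.map_congr_left fun n hm => ?_
    rw [map_renameRoles (by simpa using hl) hn.2, renameRoles_cons,
      if_neg fun e => hn.1 (by rwa [e] at hm)]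

/-- Dropping a role together with the process that plays it does not affect the other roles. -/
theorem renameRoles_erase : ∀ {qs ps : List 𝓛.Name}, ps.length = qs.length → ps.Nodup →
    ∀ {r n}, r ∈ qs → n ≠ r →
    renameRoles (qs.erase r) (ps.erase (renameRoles qs ps r)) n = renameRoles qs ps n
  | [], _, _, _, _, _, hr, _ => by simp at hr
  | q :: qs, [], hl, _, _, _, _, _ => by simp at hl
  | q :: qs, p :: ps, hl, hn, r, n, hr, hnr => by
    rw [List.nodup_cons] at hn
    have hl : ps.length = qs.length := by simpa using hl
    rw [renameRoles_cons, renameRoles_cons]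
    by_cases h : r = q
    · subst h
      rw [if_pos rfl, if_neg hnr, List.erase_cons_head, List.erase_cons_head]
    · have hr : r ∈ qs := (List.mem_cons.1 hr).resolve_left h
      have hp : p ≠ renameRoles qs ps r := fun e => hn.1 (e ▸ renameRoles_mem hl hr)
      rw [if_neg h, List.erase_cons_tail (by simpa using Ne.symm h),
        List.erase_cons_tail (by simpa using hp), renameRoles_cons,
        renameRoles_erase hl hn.2 hr hnr]

theorem Instr.WF.distinct {𝒟 : CDecls 𝓛} {K : Pool 𝓛} {I : Instr 𝓛} (h : I.WF 𝒟 K) :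
    I.Distinct := by
  cases I <;> first | exact h.1 | trivial

theorem Instr.WF.argsLocal {𝒟 : CDecls 𝓛} {K : Pool 𝓛} (h𝒟 : ∀ X d, 𝒟 X = some d → d.WF 𝒟 K)
    {I : Instr 𝓛} (h : I.WF 𝒟 K) : I.ArgsLocal := by
  cases I
  case call l t X ps as =>
    obtain ⟨d, hd, hn, hl, ha⟩ := h
    refine ⟨hn, fun a hm => ?_⟩
    have : a.loc ∈ as.map CAtom.loc := List.mem_map_of_mem hm
    rw [ha, List.mem_map] at this
    obtain ⟨q, hq, e⟩ := this
    exact e ▸ renameRoles_mem hl ((h𝒟 _ _ hd).params_mem q hq)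
  all_goals trivial

theorem Chor.pn_subset_of_mem_stats {C : Chor 𝓛}
    (hc : ∀ l t ws X ps as C', Instr.calling l t ws X ps as C' ∈ C.stats → C'.pn ⊆ ps.toFinset)
    {J : Instr 𝓛} (hJ : J ∈ C.stats) : J.pn ⊆ C.pn := by
  induction C using Chor.induction with
  | nil => simp [Chor.stats] at hJ
  | cond l t p e C₁ C₂ C ih₁ ih₂ ih =>
    simp only [Chor.stats, Instr.stats, List.mem_append, List.mem_cons] at hJ hc
    simp only [Chor.pn]
    rcases hJ with (rfl | hJ | hJ) | hJ
    · exact Finset.subset_union_left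
    · exact (ih₁ (fun l t ws X ps as C' h => hc l t ws X ps as C' (by tauto)) hJ).trans
        fun _ _ => by simp_all [Instr.pn]
    · exact (ih₂ (fun l t ws X ps as C' h => hc l t ws X ps as C' (by tauto)) hJ).trans
        fun _ _ => by simp_all [Instr.pn]
    · exact (ih (fun l t ws X ps as C' h => hc l t ws X ps as C' (by tauto)) hJ).trans
        Finset.subset_union_right
  | block C₁ C ih₁ ih =>
    simp only [Chor.stats, Instr.stats, List.mem_append] at hJ hc
    rcases hJ with hJ | hJ
    · exact (ih₁ (fun l t ws X ps as C' h => hc l t ws X ps as C' (.inl h)) hJ).trans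
        Finset.subset_union_left
    · exact (ih (fun l t ws X ps as C' h => hc l t ws X ps as C' (.inr h)) hJ).trans
        Finset.subset_union_right
  | calling l t ws X ps as C₁ C ih₁ ih =>
    simp only [Chor.stats, Instr.stats, List.mem_append, List.mem_cons] at hJ hc
    rcases hJ with (rfl | hJ) | hJ
    · exact Finset.subset_union_left
    · exact ((ih₁ (fun l t ws X ps as C' h => hc l t ws X ps as C' (by tauto)) hJ).trans
        (hc _ _ _ _ _ _ _ (.inl (.inl rfl)))).trans Finset.subset_union_left
    · exact (ih (fun l t ws X ps as C' h => hc l t ws X ps as C' (by tauto)) hJ).trans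
        Finset.subset_union_right
  | _ =>
    simp only [Chor.stats, Instr.stats, List.mem_append, List.mem_singleton] at hJ hc
    rcases hJ with rfl | hJ
    · exact Finset.subset_union_left
    · rename_i ih
      exact (ih (fun l t ws X ps as C' h => hc l t ws X ps as C' (.inr h)) hJ).trans
        Finset.subset_union_right

theorem map_some_filterMap_proj (r : 𝓛.Name) : ∀ as : List (CAtom 𝓛),
    (as.filterMap (CAtom.proj r)).map some = (as.filter (fun a => a.loc = r)).map (CAtom.proj r)
  | [] => rfl
  | a :: as => by
    by_cases h : a.loc = r
    · obtain ⟨b, hb⟩ := CAtom.proj_of_loc h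
      rw [List.filterMap_cons_some hb, List.filter_cons_of_pos (by simpa using h), List.map_cons,
        List.map_cons, map_some_filterMap_proj r as, hb]
    · rw [List.filterMap_cons_none (CAtom.proj_of_loc_ne h),
        List.filter_cons_of_neg (by simpa using h), map_some_filterMap_proj r as]

theorem length_filterMap_proj (r : 𝓛.Name) (as : List (CAtom 𝓛)) :
    (as.filterMap (CAtom.proj r)).length = (as.filter (fun a => a.loc = r)).length := by
  simpa using congrArg List.length (map_some_filterMap_proj r as)

theorem SubRel.ofArgs (r : 𝓛.Name) (as : List (CAtom 𝓛)) :
    SubRel r (CSub.ofArgs as) (PSub.ofArgs (as.filterMap (CAtom.proj r))) where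
  loc p i := by
    simp only [CSub.ofArgs]
    cases h : (as.filter (fun a => a.loc = p))[i]? with
    | none => rfl
    | some a => simpa using (List.mem_filter.1 (List.mem_of_getElem? h)).2
  proj i := by
    have h := congrArg (fun l => l[i]?) (map_some_filterMap_proj r as)
    simp only [List.getElem?_map] at h
    simp only [CSub.ofArgs, PSub.ofArgs, length_filterMap_proj]
    cases h₁ : (as.filter (fun a => a.loc = r))[i]? with
    | none =>
      rw [h₁] at h
      cases h₂ : (as.filterMap (CAtom.proj r))[i]? with
      | none => simp [CAtom.proj]
      | some b => rw [h₂] at h; simp at h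
    | some a =>
      rw [h₁] at h
      cases h₂ : (as.filterMap (CAtom.proj r))[i]? with
      | none => rw [h₂] at h; simp at h
      | some b => rw [h₂] at h; simpa using h.symm

/-- The procedure that the projection of a call at `r` refers to exists, has the right numbers of
parameters, and its body is instantiated to the projection at `r` of the instantiated
choreographic body. -/
theorem CallWF.exists_proj {𝒟 : CDecls 𝓛} {K : Pool 𝓛} (hp : 𝒟.Projectable)
    (h𝒟 : ∀ X d, 𝒟 X = some d → d.WF 𝒟 K) {X : 𝓛.PName} {ps : List 𝓛.Name}
    {as : List (CAtom 𝓛)} (h : CallWF 𝒟 X ps as) {r : 𝓛.Name} (hr : r ∈ ps) :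
    ∃ d d', 𝒟 X = some d ∧ 𝒟.proj (X, ps.idxOf r) = some d' ∧
      (ps.erase r).length = d'.roles.length ∧
      (as.filterMap (CAtom.proj r)).length = d'.arity ∧
      ∀ τ, Proj r (d.instantiate ps as τ)
        ((d'.body.inst (renameRoles d'.roles (ps.erase r)) τ).subst
          (PSub.ofArgs (as.filterMap (CAtom.proj r)))) := by
  obtain ⟨d, hd, hn, hl, ha⟩ := h
  have hw := h𝒟 X d hd
  have hj : ps.idxOf r < d.roles.length := hl ▸ List.idxOf_lt_length_of_mem hr
  obtain ⟨q, hq⟩ : ∃ q, q = d.roles[ps.idxOf r] := ⟨_, rfl⟩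
  have hqm : q ∈ d.roles := hq ▸ List.getElem_mem hj
  have hqr : renameRoles d.roles ps q = r := by
    have h₁ : (d.roles.map (renameRoles d.roles ps))[ps.idxOf r]? = ps[ps.idxOf r]? := by
      rw [map_renameRoles hl hw.roles_nodup]
    rw [List.getElem?_map, List.getElem?_eq_getElem hj, ← hq,
      List.getElem?_eq_getElem (hl ▸ hj), List.getElem_idxOf] at h₁
    simpa using h₁
  have hinj := renameRoles_injOn hl hn
  obtain ⟨P, hP⟩ := hp X d hd q hqm
  have hP := Proj.of_proj hP
  refine ⟨d, ⟨d.roles.erase q, d.params.count q, P⟩, hd, ?_, ?_, ?_, fun τ => ?_⟩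
  · simp only [CDecls.proj, hd, List.getElem?_eq_getElem hj, ← hq, Option.bind_eq_bind,
      Option.bind_some, hP.proj_eq, Option.pure_def]
  · simp only [List.length_erase_of_mem hr, List.length_erase_of_mem hqm, hl]
  · rw [length_filterMap_proj, ← List.countP_eq_length_filter]
    have h₁ : as.countP (fun a => a.loc = r) = (as.map CAtom.loc).count r := by
      rw [List.count, List.countP_map]
      exact List.countP_congr fun a _ => by simp
    rw [h₁, ha, List.count, List.count, List.countP_map]
    refine List.countP_congr fun n hm => ?_
    simp only [Function.comp, beq_iff_eq]
    rw [← hqr, hinj.eq_iff (hw.params_mem n hm) hqm]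
  · have h₁ := hP.inst (ρ := renameRoles d.roles ps)
      (ρ' := renameRoles (d.roles.erase q) (ps.erase r)) τ hinj hqm
      (fun n _ hnq => by rw [← hqr]; exact renameRoles_erase hl hn hqm hnq) hw.pn_subset
      (fun I hI => (hw.stats_wf I hI).distinct) (fun I hI => (hw.stats_wf I hI).argsLocal h𝒟)
      hw.noRuntime
    rw [hqr] at h₁
    refine h₁.subst (SubRel.ofArgs r as) fun I hI => ?_
    rw [Chor.stats_inst, List.mem_map] at hI
    obtain ⟨J, hJ, rfl⟩ := hI
    have hJd := (hw.stats_wf J hJ).distinct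
    have hJpn : ∀ n ∈ J.pn, n ∈ d.roles := fun n hn => hw.pn_subset n
      (Chor.pn_subset_of_mem_stats (fun l t ws X ps as C' h => absurd trivial (hw.noRuntime _ h))
        hJ hn)
    -- Distinct ends stay distinct, as both are roles and the roles are renamed injectively.
    cases J <;> simp only [Instr.pn, Finset.mem_insert, Finset.mem_singleton, forall_eq_or_imp,
      forall_eq] at hJpn <;>
      first | exact fun e => hJd (hinj hJpn.1 hJpn.2 e) | trivial

end Calls

/-! ### Completeness -/

section Completeness
variable {𝓛 : Lang.{u}}

theorem Proc.Sup.subst {P Q : Proc 𝓛} (h : P.Sup Q) (σ : PSub 𝓛) :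
    (P.subst σ).Sup (Q.subst σ) := by
  induction h generalizing σ with
  | refl P => exact .refl _
  | trans _ _ ih₁ ih₂ => exact (ih₁ σ).trans (ih₂ σ)
  | seq I _ ih => exact .seq _ (ih _)
  | block R _ ih => exact .block _ (ih _)
  | cond e R _ _ ih₁ ih₂ => exact .cond _ _ (ih₁ _) (ih₂ _)
  | branch t l L bs R _ ih => exact .branch _ _ _ _ _ (ih _)
  | drop t R h =>
    refine .drop _ _ ?_
    rw [Branches.toList_subst, Branches.toList_subst]
    obtain ⟨l, hp, hs⟩ := h
    exact ⟨_, hp.map _, hs.map _⟩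
  | empty P => exact .empty _
  | empty' P => exact .empty' _
  | tail P => exact .tail _
  | tail' P => exact .tail' _
  | single t bs P => exact .single _ _ _
  | single' t bs P => exact .single' _ _ _

/-- The projection of a choreography at a process that takes no part in it consists of empty
blocks. -/
theorem Proj.exists_of_notMem_pn {r : 𝓛.Name} {C : Chor 𝓛} (hr : r ∉ C.pn) :
    ∃ P, Proj r C P ∧ Proc.Sup .nil P := by
  induction C using Chor.induction with
  | nil => exact ⟨_, .nil, .refl _⟩
  | block C₁ C ih₁ ih =>
    simp only [Chor.pn, Instr.pn, Finset.mem_union, not_or] at hr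
    obtain ⟨P₁, h₁, hs₁⟩ := ih₁ hr.1
    obtain ⟨P, h, hs⟩ := ih hr.2
    exact ⟨_, .block h₁ h, (hs.trans (.empty' P)).trans (.block P hs₁)⟩
  | cond l t p e C₁ C₂ C ih₁ ih₂ ih =>
    rw [Chor.pn, Finset.mem_union, not_or] at hr
    obtain ⟨P, h, hs⟩ := ih hr.2
    exact ⟨P, .skip hr.1 (by simp) h, hs⟩
  | calling l t ws X ps as C₁ C ih₁ ih =>
    rw [Chor.pn, Finset.mem_union, not_or] at hr
    obtain ⟨P, h, hs⟩ := ih hr.2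
    exact ⟨P, .skip hr.1 (by simp) h, hs⟩
  | _ =>
    rename_i ih
    rw [Chor.pn, Finset.mem_union, not_or] at hr
    obtain ⟨P, h, hs⟩ := ih hr.2
    exact ⟨P, .skip hr.1 (by simp) h, hs⟩

theorem Proj.blockSeq {r : 𝓛.Name} {C₁ C : Chor 𝓛} {P₁ P : Proc 𝓛} (h₁ : Proj r C₁ P₁)
    (h : Proj r C P) : ∃ Q, Proj r (C₁.blockSeq C) Q ∧ Proc.Sup (.seq (.block P₁) P) Q := by
  cases C₁ with
  | nil => cases h₁; exact ⟨P, h, .empty P⟩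
  | seq I C₁ => exact ⟨_, .block h₁ h, .refl _⟩

/-- The projection of `I; C` depends on that of `C` through one of three contexts. -/
theorem Proj.exists_context {r : 𝓛.Name} {I : Instr 𝓛} {C : Chor 𝓛} {P : Proc 𝓛}
    (h : Proj r (.seq I C) P) : ∃ (f : Proc 𝓛 → Proc 𝓛) (Q : Proc 𝓛), Proj r C Q ∧ P = f Q ∧
      (∀ C' Q', Proj r C' Q' → Proj r (.seq I C') (f Q')) ∧
      (f = id ∨ (∃ J, f = Proc.seq J) ∨ I.IsSelAt r ∧ ∃ t l L,
        f = fun Q => .seq (.branch t (.cons l L Q .nil)) .nil) := by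
  cases h with
  | skip hr hb h => exact ⟨id, _, h, rfl, fun _ _ h => .skip hr hb h, .inl rfl⟩
  | send he h => exact ⟨_, _, h, rfl, fun _ _ h => .send he h, .inr (.inl ⟨_, rfl⟩)⟩
  | commRecv hr h => exact ⟨_, _, h, rfl, fun _ _ h => .commRecv hr h, .inr (.inl ⟨_, rfl⟩)⟩
  | recv h => exact ⟨_, _, h, rfl, fun _ _ h => .recv h, .inr (.inl ⟨_, rfl⟩)⟩
  | expr he h => exact ⟨_, _, h, rfl, fun _ _ h => .expr he h, .inr (.inl ⟨_, rfl⟩)⟩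
  | choice h => exact ⟨_, _, h, rfl, fun _ _ h => .choice h, .inr (.inl ⟨_, rfl⟩)⟩
  | selBranch hr h =>
    exact ⟨fun Q => .seq (.branch _ (.cons _ _ Q .nil)) .nil, _, h, rfl,
      fun _ _ h => .selBranch hr h, .inr (.inr ⟨rfl, _, _, _, rfl⟩)⟩
  | recvSel h =>
    exact ⟨fun Q => .seq (.branch _ (.cons _ _ Q .nil)) .nil, _, h, rfl,
      fun _ _ h => .recvSel h, .inr (.inr ⟨rfl, _, _, _, rfl⟩)⟩
  | cond he h₁ h₂ h => exact ⟨_, _, h, rfl, fun _ _ h => .cond he h₁ h₂ h, .inr (.inl ⟨_, rfl⟩)⟩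
  | merge hr hm hl h₁ h₂ h =>
    exact ⟨_, _, h, rfl, fun _ _ h => .merge hr hm hl h₁ h₂ h, .inr (.inl ⟨_, rfl⟩)⟩
  | call hr h => exact ⟨_, _, h, rfl, fun _ _ h => .call hr h, .inr (.inl ⟨_, rfl⟩)⟩
  | wait hr hw h => exact ⟨_, _, h, rfl, fun _ _ h => .wait hr hw h, .inr (.inl ⟨_, rfl⟩)⟩
  | entered hr hw h₁ h =>
    exact ⟨_, _, h, rfl, fun _ _ h => .entered hr hw h₁ h, .inr (.inl ⟨_, rfl⟩)⟩
  | block h₁ h => exact ⟨_, _, h, rfl, fun _ _ h => .block h₁ h, .inr (.inl ⟨_, rfl⟩)⟩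

/-- Only processes of a choreography can act in it. -/
theorem CStep.mem_pn {𝒟 : CDecls 𝓛} {K₀ : Pool 𝓛} {C C' : Chor 𝓛} {S S' : Store 𝓛}
    {K K' : Pool 𝓛} {p : 𝓛.Name} (h : CStep 𝒟 C S K p C' S' K')
    (hwf : ∀ I ∈ C.stats, I.WF 𝒟 K₀) : p ∈ C.pn := by
  induction h with
  | block _ ih =>
    simp only [forall_stats_seq, Instr.stats] at hwf
    exact Finset.mem_union_left _ (ih hwf.1)
  | delay _ _ ih => exact Finset.mem_union_right _ (ih (forall_stats_seq.1 hwf).2)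
  | enter hp =>
    simp only [forall_stats_seq, Instr.stats, List.forall_mem_cons] at hwf
    exact Finset.mem_union_left _ (hwf.1.1.2.1 hp)
  | last =>
    simp only [forall_stats_seq, Instr.stats, List.forall_mem_cons] at hwf
    exact Finset.mem_union_left _ (hwf.1.1.2.1 (Finset.mem_singleton_self _))
  | delayProc _ _ ih =>
    simp only [forall_stats_seq, Instr.stats, List.forall_mem_cons] at hwf
    exact Finset.mem_union_left _ (hwf.1.1.2.2.1 (ih hwf.1.2))
  | first _ hp => exact Finset.mem_union_left _ (List.mem_toFinset.2 hp)
  | _ => simp [Chor.pn, Instr.pn]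

/-- What an outsider sees of the choice of the branch `C₁` in a conditional. -/
theorem Proj.sup_of_merge {r : 𝓛.Name} {C₁ C : Chor 𝓛} {t : Tok} {bs bs₁ : Branches 𝓛}
    {P : Proc 𝓛} (hs : bs₁.toList.Subperm bs.toList)
    (h₁ : Proj r C₁ (.seq (.branch t bs₁) .nil)) (h : Proj r C P) :
    ∃ P', Proj r (C₁.blockSeq C) P' ∧ Proc.Sup (.seq (.branch t bs) P) P' := by
  obtain ⟨Q, hQ, hs'⟩ := h₁.blockSeq h
  exact ⟨Q, hQ, ((Proc.Sup.drop t P hs).trans (.single' t bs₁ P)).trans hs'⟩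

/-- A step by `p` leaves the behaviour of the other processes as it is, up to `⊒`. -/
theorem CStep.sup_of_ne {𝒟 : CDecls 𝓛} {K₀ : Pool 𝓛} {C C' : Chor 𝓛} {S S' : Store 𝓛}
    {K K' : Pool 𝓛} {p r : 𝓛.Name} (h : CStep 𝒟 C S K p C' S' K')
    (hwf : ∀ I ∈ C.stats, I.WF 𝒟 K₀) (hr : r ≠ p) {P : Proc 𝓛} (hP : Proj r C P) :
    ∃ P', Proj r C' P' ∧ P.Sup P' := by
  induction h generalizing P with
  | @send l τ p e q C S K v s hv =>
    cases hP with
    | skip hr' hb h =>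
      refine ⟨P, .skip ?_ (by simp) h, .refl _⟩
      simp_all [Instr.pn]
    | send => exact absurd rfl hr
    | commRecv _ h => exact ⟨_, .recv h, .refl _⟩
  | @recv l τ p q C S K v M hM =>
    have hd : ∀ I ∈ C.stats, I.Distinct := fun I hI => ((forall_stats_seq.1 hwf).2 I hI).distinct
    cases hP with
    | skip hr' hb h =>
      have := h.subst (SubRel.single_of_ne hr v) hd
      rw [Proc.subst_var] at this
      exact ⟨P, this, .refl _⟩
    | recv h => exact absurd rfl hr
  | @select l τ p q L C S K =>
    cases hP with
    | skip hr' hb h =>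
      refine ⟨P, .skip ?_ (by simp) h, .refl _⟩
      simp_all [Instr.pn]
    | choice => exact absurd rfl hr
    | selBranch _ h => exact ⟨_, .recvSel h, .refl _⟩
  | @onSelect l τ p q L C S K M hM =>
    cases hP with
    | skip hr' hb h => exact ⟨P, h, .refl _⟩
    | recvSel h => exact absurd rfl hr
  | @compute l τ p e C S K v s hv =>
    have hd : ∀ I ∈ C.stats, I.Distinct := fun I hI => ((forall_stats_seq.1 hwf).2 I hI).distinct
    cases hP with
    | skip hr' hb h =>
      have := h.subst (SubRel.single_of_ne hr v) hd
      rw [Proc.subst_var] at this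
      exact ⟨P, this, .refl _⟩
    | expr he h => exact absurd rfl hr
  | ifTrue hv =>
    cases hP with
    | skip hr' hb h =>
      simp only [Instr.pn, Finset.mem_union, not_or] at hr'
      obtain ⟨P₁, h₁, hs₁⟩ := Proj.exists_of_notMem_pn hr'.1.2
      obtain ⟨Q, hQ, hs⟩ := h₁.blockSeq h
      exact ⟨Q, hQ, ((Proc.Sup.empty' P).trans (.block P hs₁)).trans hs⟩
    | cond => exact absurd rfl hr
    | merge _ _ _ h₁ h₂ h =>
      refine h₁.sup_of_merge ?_ h
      rw [Branches.toList_append]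
      exact (List.sublist_append_left _ _).subperm
  | ifFalse hv _ =>
    cases hP with
    | skip hr' hb h =>
      simp only [Instr.pn, Finset.mem_union, not_or] at hr'
      obtain ⟨P₁, h₁, hs₁⟩ := Proj.exists_of_notMem_pn hr'.2
      obtain ⟨Q, hQ, hs⟩ := h₁.blockSeq h
      exact ⟨Q, hQ, ((Proc.Sup.empty' P).trans (.block P hs₁)).trans hs⟩
    | cond => exact absurd rfl hr
    | merge _ _ _ h₁ h₂ h =>
      refine h₂.sup_of_merge ?_ h
      rw [Branches.toList_append]
      exact (List.sublist_append_right _ _).subperm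
  | block _ ih =>
    simp only [forall_stats_seq, Instr.stats] at hwf
    cases hP with
    | skip _ hb _ => exact absurd rfl (hb _)
    | block h₁ h =>
      obtain ⟨P₁', h₁', hs₁⟩ := ih hwf.1 hr h₁
      obtain ⟨Q, hQ, hs⟩ := h₁'.blockSeq h
      exact ⟨Q, hQ, (Proc.Sup.block _ hs₁).trans hs⟩
  | delay _ _ ih =>
    obtain ⟨f, Q, hQ, rfl, hf, hf'⟩ := hP.exists_context
    obtain ⟨Q', hQ', hs⟩ := ih (forall_stats_seq.1 hwf).2 hr hQ
    refine ⟨_, hf _ _ hQ', ?_⟩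
    rcases hf' with rfl | ⟨J, rfl⟩ | ⟨_, t, l, L, rfl⟩
    · exact hs
    · exact .seq J hs
    · exact .branch _ _ _ _ _ hs
  | first hX hp =>
    cases hP with
    | skip hr' hb h => exact ⟨P, .skip hr' (by simp) h, .refl _⟩
    | call hr' h => exact ⟨_, .wait hr' (by simp [hr, hr']) h, .refl _⟩
  | enter hp =>
    cases hP with
    | skip hr' hb h => exact ⟨P, .skip hr' (by simp) h, .refl _⟩
    | wait hr' hw h => exact ⟨_, .wait hr' (by simp [hr, hw]) h, .refl _⟩
    | entered hr' hw h₁ h => exact ⟨_, .entered hr' (by simp [hw]) h₁ h, .refl _⟩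
  | last =>
    simp only [forall_stats_seq, Instr.stats, List.forall_mem_cons] at hwf
    cases hP with
    | skip hr' hb h =>
      obtain ⟨P₁, h₁, hs₁⟩ := Proj.exists_of_notMem_pn fun h => hr' (hwf.1.1.2.2.1 h)
      obtain ⟨Q, hQ, hs⟩ := h₁.blockSeq h
      exact ⟨Q, hQ, ((Proc.Sup.empty' P).trans (.block P hs₁)).trans hs⟩
    | wait _ hw _ => exact absurd (Finset.mem_singleton.1 hw) hr
    | entered hr' hw h₁ h => exact h₁.blockSeq h
  | delayProc _ _ ih =>
    simp only [forall_stats_seq, Instr.stats, List.forall_mem_cons] at hwf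
    cases hP with
    | skip hr' hb h => exact ⟨P, .skip hr' (by simp) h, .refl _⟩
    | wait hr' hw h => exact ⟨_, .wait hr' hw h, .refl _⟩
    | entered hr' hw h₁ h =>
      obtain ⟨P₁', h₁', hs₁⟩ := ih hwf.1.2 hr h₁
      exact ⟨_, .entered hr' hw h₁' h, .block _ hs₁⟩

/-- The projection of the process that acts can follow. -/
theorem CStep.exists_pStep {𝒟 : CDecls 𝓛} {K₀ : Pool 𝓛} (hp𝒟 : 𝒟.Projectable)
    (h𝒟 : ∀ X d, 𝒟 X = some d → d.WF 𝒟 K₀) {C C' : Chor 𝓛} {S S' : Store 𝓛}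
    {K K' : Pool 𝓛} {p : 𝓛.Name} (h : CStep 𝒟 C S K p C' S' K')
    (hwf : ∀ I ∈ C.stats, I.WF 𝒟 K₀) {P : Proc 𝓛} (hP : Proj p C P) :
    ∃ P' Q, PStep 𝒟.proj p P S K P' S' K' ∧ Proj p C' Q ∧ P'.Sup Q := by
  induction h generalizing P with
  | @send l τ p e q C S K v s hv =>
    simp only [forall_stats_seq, Instr.stats, List.forall_mem_singleton] at hwf
    cases hP with
    | skip hr' hb h => simp [Instr.pn] at hr'
    | send he h =>
      refine ⟨_, _, .send ((CExpr.eval_iff_of_proj he).1 hv), .skip ?_ (by simp) h, .refl _⟩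
      simpa [Instr.pn] using hwf.1.1
    | commRecv hne h => exact absurd rfl hne
  | @recv l τ p q C S K v M hM =>
    have hd : ∀ I ∈ C.stats, I.Distinct := fun I hI => ((forall_stats_seq.1 hwf).2 I hI).distinct
    cases hP with
    | skip hr' hb h => simp [Instr.pn] at hr'
    | recv h => exact ⟨_, _, .recv hM, h.subst (SubRel.single_self q v) hd, .refl _⟩
  | @select l τ p q L C S K =>
    simp only [forall_stats_seq, Instr.stats, List.forall_mem_singleton] at hwf
    cases hP with
    | skip hr' hb h => simp [Instr.pn] at hr'
    | choice h =>
      refine ⟨_, _, .select, .skip ?_ (by simp) h, .refl _⟩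
      simpa [Instr.pn] using hwf.1.1
    | selBranch hne h => exact absurd rfl hne
  | @onSelect l τ p q L C S K M hM =>
    cases hP with
    | skip hr' hb h => simp [Instr.pn] at hr'
    | recvSel h =>
      exact ⟨_, _, .onSelect hM (by simp [Branches.toList]), h, .tail _⟩
  | @compute l τ p e C S K v s hv =>
    have hd : ∀ I ∈ C.stats, I.Distinct := fun I hI => ((forall_stats_seq.1 hwf).2 I hI).distinct
    cases hP with
    | skip hr' hb h => simp [Instr.pn] at hr'
    | expr he h =>
      exact ⟨_, _, .compute ((CExpr.eval_iff_of_proj he).1 hv),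
        h.subst (SubRel.single_self p v) hd, .refl _⟩
  | ifTrue hv =>
    cases hP with
    | skip hr' hb h => simp [Instr.pn] at hr'
    | cond he h₁ h₂ h =>
      obtain ⟨Q, hQ, hs⟩ := h₁.blockSeq h
      exact ⟨_, Q, .ifTrue ((CExpr.eval_iff_of_proj he).1 hv), hQ, hs⟩
    | merge hne => exact absurd rfl hne
  | ifFalse hv hne =>
    cases hP with
    | skip hr' hb h => simp [Instr.pn] at hr'
    | cond he h₁ h₂ h =>
      obtain ⟨Q, hQ, hs⟩ := h₂.blockSeq h
      exact ⟨_, Q, .ifFalse ((CExpr.eval_iff_of_proj he).1 hv) hne, hQ, hs⟩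
    | merge hne => exact absurd rfl hne
  | block _ ih =>
    simp only [forall_stats_seq, Instr.stats] at hwf
    cases hP with
    | skip _ hb _ => exact absurd rfl (hb _)
    | block h₁ h =>
      obtain ⟨P₁', Q₁, hstep, h₁', hs₁⟩ := ih hwf.1 h₁
      obtain ⟨Q, hQ, hs⟩ := h₁'.blockSeq h
      exact ⟨_, Q, .block hstep, hQ, (Proc.Sup.block _ hs₁).trans hs⟩
  | delay _ hsel ih =>
    obtain ⟨f, Q, hQ, rfl, hf, hf'⟩ := hP.exists_context
    obtain ⟨P', Q', hstep, hQ', hs⟩ := ih (forall_stats_seq.1 hwf).2 hQ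
    rcases hf' with rfl | ⟨J, rfl⟩ | ⟨h, _⟩
    · exact ⟨P', _, hstep, hf _ _ hQ', hs⟩
    · exact ⟨_, _, .delay hstep, hf _ _ hQ', .seq J hs⟩
    · exact absurd h hsel
  | first hX hp =>
    simp only [forall_stats_seq, Instr.stats, List.forall_mem_singleton] at hwf
    cases hP with
    | skip hr' hb h => simp [Instr.pn, hp] at hr'
    | call hr' h =>
      obtain ⟨d, d', hd, hd', hl, ha, hproj⟩ := hwf.1.exists_proj hp𝒟 h𝒟 hp
      obtain rfl := Option.some.inj (hX.symm.trans hd)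
      exact ⟨_, _, .call hd' hl ha, .entered hp (by simp) (hproj _) h, .refl _⟩
  | @enter l τ ws X ps as C₁ C₂ S K p hp =>
    simp only [forall_stats_seq, Instr.stats, List.forall_mem_cons] at hwf
    obtain ⟨⟨⟨hcall, hws, hpn, τ', d₀, hτ, hd₀, hw⟩, _⟩, _⟩ := hwf
    cases hP with
    | skip hr' hb h => exact absurd (hws hp) hr'
    | wait hr' _ h =>
      obtain ⟨d, d', hd, hd', hl, ha, hproj⟩ := hcall.exists_proj hp𝒟 h𝒟 hr'
      obtain rfl := Option.some.inj (hd₀.symm.trans hd)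
      obtain rfl : τ = τ' := by simpa using hτ
      obtain ⟨P₀, Q₀, hP₀, hQ₀, hs⟩ := hw p hp
      obtain rfl := (Proj.of_proj hP₀).unique (hproj _)
      exact ⟨_, _, .call hd' hl ha, .entered hr' (by simp) (Proj.of_proj hQ₀) h, .block _ hs⟩
    | entered _ hw _ _ => exact absurd hp hw
  | @last l τ X ps as C₁ C₂ S K p =>
    simp only [forall_stats_seq, Instr.stats, List.forall_mem_cons] at hwf
    obtain ⟨⟨⟨hcall, hws, hpn, τ', d₀, hτ, hd₀, hw⟩, _⟩, _⟩ := hwf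
    have hp := Finset.mem_singleton_self p
    cases hP with
    | skip hr' hb h => exact absurd (hws hp) hr'
    | wait hr' _ h =>
      obtain ⟨d, d', hd, hd', hl, ha, hproj⟩ := hcall.exists_proj hp𝒟 h𝒟 hr'
      obtain rfl := Option.some.inj (hd₀.symm.trans hd)
      obtain rfl : τ = τ' := by simpa using hτ
      obtain ⟨P₀, Q₀, hP₀, hQ₀, hs⟩ := hw p hp
      obtain rfl := (Proj.of_proj hP₀).unique (hproj _)
      obtain ⟨Q, hQ, hs'⟩ := (Proj.of_proj hQ₀).blockSeq h
      exact ⟨_, Q, .call hd' hl ha, hQ, (Proc.Sup.block _ hs).trans hs'⟩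
    | entered _ hw _ _ => exact absurd hp hw
  | delayProc hstep hp ih =>
    simp only [forall_stats_seq, Instr.stats, List.forall_mem_cons] at hwf
    cases hP with
    | skip hr' hb h => exact absurd (hwf.1.1.2.2.1 (hstep.mem_pn hwf.1.2)) hr'
    | wait hr' hw h => exact absurd hw hp
    | entered hr' hw h₁ h =>
      obtain ⟨P₁', Q₁, hstep, h₁', hs₁⟩ := ih hwf.1.2 h₁
      exact ⟨_, _, .block hstep, .entered hr' hw h₁' h, .block _ hs₁⟩

end Completeness

/-! ### Simulation along `⊒` -/

section Simulation
variable {𝓛 : Lang.{u}}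

theorem Branches.keys_eq (t : Tok) : ∀ bs : Branches 𝓛,
    bs.keys t = bs.toList.flatMap fun b => (b.1, t) :: b.2.2.keys
  | .nil => rfl
  | .cons l L P bs => by
    simp only [Branches.keys, Branches.toList, List.flatMap_cons, Branches.keys_eq t bs,
      List.cons_append]

theorem Proc.Sup.keys_subperm {P Q : Proc 𝓛} (h : P.Sup Q) : Q.keys.Subperm P.keys := by
  induction h with
  | refl P => exact .refl _
  | trans _ _ ih₁ ih₂ => exact ih₂.trans ih₁
  | seq I _ ih => exact (List.Subperm.refl _).append ih
  | block R _ ih => exact ih.append (.refl _)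
  | cond e R _ _ ih₁ ih₂ => exact (ih₁.append ih₂).append (.refl _)
  | branch t l L bs R _ ih =>
    exact (((List.Subperm.refl [(l, t)]).append (ih.append (.refl _))).append (.refl _))
  | drop t R h =>
    obtain ⟨l, hp, hs⟩ := h
    simp only [Proc.keys, PInstr.keys, Branches.keys_eq]
    exact .append ⟨_, hp.flatMap_right _, hs.flatMap _⟩ (.refl _)
  | _ => simp [Proc.keys, PInstr.keys, List.Subperm.refl]

mutual
/-- The process can come to a branching instruction with token `t` without making a choice. -/
def Proc.ActiveToken (t : Tok) : Proc 𝓛 → Prop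
  | .nil => False
  | .seq I P => I.ActiveToken t ∨ P.ActiveToken t
def PInstr.ActiveToken (t : Tok) : PInstr 𝓛 → Prop
  | .branch t' _ => t' = t
  | .block P => P.ActiveToken t
  | .send .. | .recv .. | .set .. | .choice .. | .cond .. | .call .. => False
end

theorem Proc.Sup.activeToken_iff {P Q : Proc 𝓛} (h : P.Sup Q) (t : Tok) :
    P.ActiveToken t ↔ Q.ActiveToken t := by
  induction h with
  | trans _ _ ih₁ ih₂ => exact ih₁.trans ih₂
  | _ => simp_all [Proc.ActiveToken, PInstr.ActiveToken]

/-- The steps of the larger process are matched by the smaller one, unless they choose an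
alternative that was dropped. The hypothesis `hm` excludes this: a label that has been sent to a
branching instruction of `Q` with the right token, and that `P` knows about, is one that `Q` knows
about. -/
theorem Proc.Sup.exists_pStep {𝒬 : PDecls 𝓛} {p : 𝓛.Name} {P Q P' : Proc 𝓛}
    {S S' : Store 𝓛} {K K' : Pool 𝓛} (h : P.Sup Q) (hk : P.keys.Nodup)
    (hm : ∀ l τ L, (⟨l, τ, .lab L⟩ : Msg 𝓛) ∈ K p → Q.ActiveToken (.tok τ) →
      (l, Tok.tok τ) ∈ P.keys → (l, Tok.tok τ) ∈ Q.keys)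
    (hs : PStep 𝒬 p P S K P' S' K') : ∃ Q', PStep 𝒬 p Q S K Q' S' K' ∧ P'.Sup Q' := by
  induction h generalizing P' with
  | refl P => exact ⟨_, hs, .refl _⟩
  | @trans P R Q h₁ h₂ ih₁ ih₂ =>
    obtain ⟨R', hR, hs₁⟩ := ih₁ hk (fun l τ L h ha hl => h₂.keys_subperm.subset
      (hm l τ L h ((h₂.activeToken_iff _).1 ha) hl)) hs
    obtain ⟨Q', hQ, hs₂⟩ := ih₂ (by
        obtain ⟨l, hp, hl⟩ := h₁.keys_subperm
        exact hp.nodup_iff.1 (hk.sublist hl))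
      (fun l τ L h ha hl => hm l τ L h ha (h₁.keys_subperm.subset hl)) hR
    exact ⟨Q', hQ, hs₁.trans hs₂⟩
  | @seq I P Q h ih =>
    rw [Proc.keys, List.nodup_append] at hk
    cases hs with
    | send hv => exact ⟨_, .send hv, h⟩
    | recv hK => exact ⟨_, .recv hK, h.subst _⟩
    | select => exact ⟨_, .select, h⟩
    | onSelect hK hb => exact ⟨_, .onSelect hK hb, .seq _ h⟩
    | compute hv => exact ⟨_, .compute hv, h.subst _⟩
    | ifTrue hv => exact ⟨_, .ifTrue hv, .seq _ h⟩
    | ifFalse hv hne => exact ⟨_, .ifFalse hv hne, .seq _ h⟩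
    | block hs => exact ⟨_, .block hs, .seq _ h⟩
    | delay hs =>
      obtain ⟨Q', hQ, hs'⟩ := ih hk.2.1 (fun l τ L hl ha hlk => by
        have := hm l τ L hl (.inr ha) (List.mem_append_right _ hlk)
        exact (List.mem_append.1 this).resolve_left fun hI => hk.2.2 _ hI _ hlk rfl) hs
      exact ⟨_, .delay hQ, .seq _ hs'⟩
    | call hd hl ha => exact ⟨_, .call hd hl ha, .seq _ h⟩
  | @block P Q R h ih =>
    rw [Proc.keys, PInstr.keys, List.nodup_append] at hk
    cases hs with
    | block hs =>
      obtain ⟨Q', hQ, hs'⟩ := ih hk.1 (fun l τ L hl ha hlk => by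
        have := hm l τ L hl (.inl ha) (List.mem_append_left _ hlk)
        exact (List.mem_append.1 this).resolve_right fun hI => hk.2.2 _ hlk _ hI rfl) hs
      exact ⟨_, .block hQ, .block _ hs'⟩
    | delay hs => exact ⟨_, .delay hs, .block _ h⟩
  | cond e R h₁ h₂ =>
    cases hs with
    | ifTrue hv => exact ⟨_, .ifTrue hv, .block _ h₁⟩
    | ifFalse hv hne => exact ⟨_, .ifFalse hv hne, .block _ h₂⟩
    | delay hs => exact ⟨_, .delay hs, .cond _ _ h₁ h₂⟩
  | branch t l L bs R h =>
    cases hs with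
    | onSelect hK hb =>
      rcases List.mem_cons.1 hb with hb | hb
      · obtain ⟨rfl, rfl, rfl⟩ : _ ∧ _ ∧ _ := by simpa using hb
        exact ⟨_, .onSelect hK List.mem_cons_self, .block _ h⟩
      · exact ⟨_, .onSelect hK (List.mem_cons_of_mem _ hb), .refl _⟩
    | delay hs => exact ⟨_, .delay hs, .branch _ _ _ _ _ h⟩
  | @drop t bs bs' R h =>
    cases hs with
    | @onSelect τ _ l L Q₁ _ _ _ M hK hb =>
      have hlk : (l, Tok.tok τ) ∈ (Proc.seq (.branch (.tok τ) bs) R).keys := by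
        simp only [Proc.keys, PInstr.keys, Branches.keys_eq, List.mem_append, List.mem_flatMap]
        exact .inl ⟨_, hb, List.mem_cons_self⟩
      have := hm l τ L (by rw [hK]; exact Multiset.mem_cons_self _ _) (.inl rfl) hlk
      simp only [Proc.keys, PInstr.keys, Branches.keys_eq] at hk this
      rw [List.nodup_append, List.nodup_flatMap] at hk
      -- Keys being distinct, the alternative chosen is the one of `bs'` that has the same key.
      rcases List.mem_append.1 this with h' | h'
      · obtain ⟨b', hb', hlb'⟩ := List.mem_flatMap.1 h'
        have : b' = (l, L, Q₁) := by
          by_contra hne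
          exact @List.Pairwise.forall _ _ _ ⟨fun _ _ h => List.Disjoint.symm h⟩ hk.1.2 _
            (h.subset hb') _ hb hne _ hlb' List.mem_cons_self
        exact ⟨_, .onSelect hK (this ▸ hb'), .refl _⟩
      · exact absurd rfl (hk.2.2 _ (List.mem_flatMap.2 ⟨_, hb, List.mem_cons_self⟩) _ h')
    | delay hs => exact ⟨_, .delay hs, .drop _ _ h⟩
  | empty P =>
    cases hs with
    | block hs => cases hs
    | delay hs => exact ⟨_, hs, .empty _⟩
  | empty' P => exact ⟨_, .delay hs, .empty' _⟩
  | tail P =>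
    cases hs with
    | block hs => exact ⟨_, hs, .tail _⟩
    | delay hs => cases hs
  | tail' P => exact ⟨_, .block hs, .tail' _⟩
  | single t bs P =>
    cases hs with
    | block hs =>
      cases hs with
      | onSelect hK hb => exact ⟨_, .onSelect hK hb, .block _ (.tail _)⟩
      | delay hs => cases hs
    | delay hs => exact ⟨_, .delay hs, .single _ _ _⟩
  | single' t bs P =>
    cases hs with
    | onSelect hK hb => exact ⟨_, .block (.onSelect hK hb), .block _ (.tail' _)⟩
    | delay hs => exact ⟨_, .delay hs, .single' _ _ _⟩

end Simulation

/-! ### Integrity keys -/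

section Keys
variable {𝓛 : Lang.{u}}

mutual
/-- The instructions that occur in a choreography, except those in the bodies of the calls that
`r` has not entered yet. -/
def Chor.live (r : 𝓛.Name) : Chor 𝓛 → List (Instr 𝓛)
  | .nil => []
  | .seq I C => I.live r ++ C.live r
def Instr.live (r : 𝓛.Name) : Instr 𝓛 → List (Instr 𝓛)
  | .block C => C.live r
  | .cond l t p e C₁ C₂ => .cond l t p e C₁ C₂ :: (C₁.live r ++ C₂.live r)
  | .calling l t ws X ps as C =>
      .calling l t ws X ps as C :: if r ∈ ws then [] else C.live r
  | .comm l t p e q => [.comm l t p e q]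
  | .sel l t p q L => [.sel l t p q L]
  | .expr l t p e => [.expr l t p e]
  | .call l t X ps as => [.call l t X ps as]
  | .recv l t p q => [.recv l t p q]
  | .recvSel l t p q L => [.recvSel l t p q L]
end

theorem Chor.live_sublist (r : 𝓛.Name) (C : Chor 𝓛) : (C.live r).Sublist C.stats := by
  induction C using Chor.induction with
  | nil => exact .refl _
  | cond l t p e C₁ C₂ C ih₁ ih₂ ih =>
    simp only [Chor.live, Chor.stats, Instr.live, Instr.stats]
    exact ((ih₁.append ih₂).cons_cons _).append ih
  | block C₁ C ih₁ ih => exact ih₁.append ih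
  | calling l t ws X ps as C₁ C ih₁ ih =>
    simp only [Chor.live, Chor.stats, Instr.live, Instr.stats]
    refine List.Sublist.append (.cons_cons _ ?_) ih
    split
    · exact List.nil_sublist _
    · exact ih₁
  | _ =>
    rename_i ih
    exact (List.Sublist.refl _).append ih

theorem Chor.cons_stats_sublist {l : ℕ} {t : Tok} {ws : Finset 𝓛.Name} {X : 𝓛.PName}
    {ps : List 𝓛.Name} {as : List (CAtom 𝓛)} {C' C : Chor 𝓛}
    (h : Instr.calling l t ws X ps as C' ∈ C.stats) :
    (Instr.calling l t ws X ps as C' :: C'.stats).Sublist C.stats := by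
  induction C using Chor.induction with
  | nil => simp [Chor.stats] at h
  | cond l t p e C₁ C₂ C ih₁ ih₂ ih =>
    simp only [Chor.stats, Instr.stats, List.mem_append, List.mem_cons, reduceCtorEq,
      false_or] at h ⊢
    rcases h with (h | h) | h
    · exact (((ih₁ h).trans (List.sublist_append_left _ _)).cons _).trans
        (List.sublist_append_left _ _)
    · exact (((ih₂ h).trans (List.sublist_append_right _ _)).cons _).trans
        (List.sublist_append_left _ _)
    · exact (ih h).trans (List.sublist_append_right _ _)
  | block C₁ C ih₁ ih =>
    rcases List.mem_append.1 h with h | h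
    · exact (ih₁ h).trans (List.sublist_append_left _ _)
    · exact (ih h).trans (List.sublist_append_right _ _)
  | calling l t ws X ps as C₁ C ih₁ ih =>
    simp only [Chor.stats, Instr.stats, List.mem_append, List.mem_cons] at h ⊢
    rcases h with (h | h) | h
    · cases h
      exact List.sublist_append_left _ _
    · exact ((ih₁ h).cons _).trans (List.sublist_append_left _ _)
    · exact (ih h).trans (List.sublist_append_right _ _)
  | _ =>
    rename_i ih
    simp only [Chor.stats, Instr.stats, List.mem_append, List.mem_singleton, reduceCtorEq,
      false_or] at h ⊢
    exact (ih h).trans (List.sublist_append_right _ _)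

open Classical in
/-- The body of a call that `r` has not entered is disjoint from what `r` can see, also if an
instruction occurs several times. -/
theorem Chor.count_live_add_count_stats {r : 𝓛.Name} {l : ℕ} {t : Tok} {ws : Finset 𝓛.Name}
    {X : 𝓛.PName} {ps : List 𝓛.Name} {as : List (CAtom 𝓛)} {C' C : Chor 𝓛}
    (h : Instr.calling l t ws X ps as C' ∈ C.live r) (hr : r ∈ ws) (J : Instr 𝓛) :
    (C.live r).count J + C'.stats.count J ≤ C.stats.count J := by
  induction C using Chor.induction with
  | nil => simp [Chor.live] at h
  | cond l t p e C₁ C₂ C ih₁ ih₂ ih =>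
    have h₁ := (C₁.live_sublist r).count_le J
    have h₂ := (C₂.live_sublist r).count_le J
    have h₃ := (C.live_sublist r).count_le J
    simp only [Chor.live, Instr.live, List.mem_append, List.mem_cons, reduceCtorEq,
      false_or] at h
    simp only [Chor.stats, Instr.stats, Chor.live, Instr.live, List.count_append, List.count_cons]
    rcases h with (h | h) | h
    · have := ih₁ h; omega
    · have := ih₂ h; omega
    · have := ih h; omega
  | block C₁ C ih₁ ih =>
    have h₁ := (C₁.live_sublist r).count_le J
    have h₃ := (C.live_sublist r).count_le J
    simp only [Chor.live, Instr.live, List.mem_append] at h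
    simp only [Chor.stats, Instr.stats, Chor.live, Instr.live, List.count_append]
    rcases h with h | h
    · have := ih₁ h; omega
    · have := ih h; omega
  | calling l t ws X ps as C₁ C ih₁ ih =>
    have h₁ := (C₁.live_sublist r).count_le J
    have h₃ := (C.live_sublist r).count_le J
    simp only [Chor.live, Instr.live, List.mem_append, List.mem_cons] at h
    simp only [Chor.stats, Instr.stats, Chor.live, Instr.live, List.count_append, List.count_cons]
    rcases h with (h | h) | h
    · cases h
      rw [if_pos hr, List.count_nil]
      omega
    · split at h
      · simp at h
      · have := ih₁ h
        rw [if_neg ‹_›]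
        omega
    · have := ih h
      split
      · rw [List.count_nil]; omega
      · omega
  | _ =>
    rename_i ih
    simp only [Chor.live, Instr.live, List.mem_append, List.mem_singleton, reduceCtorEq,
      false_or] at h
    have := ih h
    simp only [Chor.stats, Instr.stats, Chor.live, Instr.live, List.count_append]
    omega

open Classical in
/-- The keys that `r` can see are not keys of the body of a call that `r` has not entered. -/
theorem Chor.false_of_mem_live {r : 𝓛.Name} {l : ℕ} {t : Tok} {ws : Finset 𝓛.Name}
    {X : 𝓛.PName} {ps : List 𝓛.Name} {as : List (CAtom 𝓛)} {C' C : Chor 𝓛}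
    (hn : C.keys.Nodup) (h : Instr.calling l t ws X ps as C' ∈ C.live r) (hr : r ∈ ws)
    {J : Instr 𝓛} (hJ : J ∈ C.live r) (hJ' : J ∈ C'.stats) {k : Key} (hk : J.key = some k) :
    False := by
  have hs : (C.live r ++ C'.stats).Subperm C.stats := by
    rw [List.subperm_iff_count]
    intro J
    rw [List.count_append]
    exact Chor.count_live_add_count_stats h hr J
  have hs' : ((C.live r ++ C'.stats).filterMap Instr.key).Subperm C.keys := by
    obtain ⟨m, hp, hm⟩ := hs
    exact ⟨_, hp.filterMap _, hm.filterMap _⟩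
  obtain ⟨m, hp, hm⟩ := hs'
  have := hp.nodup_iff.1 (hn.sublist hm)
  rw [List.filterMap_append, List.nodup_append] at this
  exact this.2.2 k (List.mem_filterMap.2 ⟨J, hJ, hk⟩) k (List.mem_filterMap.2 ⟨J, hJ', hk⟩) rfl

theorem eq_of_nodup_filterMap {α β : Type*} {f : α → Option β} : ∀ {m : List α},
    (m.filterMap f).Nodup → ∀ {a b : α} {c : β}, a ∈ m → b ∈ m → f a = some c → f b = some c → a = b
  | [], _, _, _, _, ha, _, _, _ => by simp at ha
  | x :: m, hn, a, b, c, ha, hb, hac, hbc => by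
    have hn' : (m.filterMap f).Nodup :=
      hn.sublist ((List.sublist_cons_self x m).filterMap f)
    have hx : ∀ {y : α}, y ∈ m → f x = some c → f y ≠ some c := by
      intro y hy hxc hyc
      rw [List.filterMap_cons_some hxc, List.nodup_cons] at hn
      exact hn.1 (List.mem_filterMap.2 ⟨y, hy, hyc⟩)
    rcases List.mem_cons.1 ha with rfl | ha' <;> rcases List.mem_cons.1 hb with rfl | hb'
    · rfl
    · exact absurd hbc (hx hb' hac)
    · exact absurd hac (hx ha' hbc)
    · exact eq_of_nodup_filterMap hn' ha' hb' hac hbc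

theorem Branches.keys_append (t : Tok) (bs bs' : Branches 𝓛) :
    (bs.append bs').keys t = bs.keys t ++ bs'.keys t := by
  simp only [Branches.keys_eq, Branches.toList_append, List.flatMap_append]

/-- The keys in a projection are keys of the choreography. -/
theorem Proj.keys_sublist {r : 𝓛.Name} {C : Chor 𝓛} {P : Proc 𝓛} (h : Proj r C P) :
    P.keys.Sublist ((C.live r).filterMap Instr.key) := by
  induction h with
  | nil => exact .refl _
  | @skip I C P hr hb h ih =>
    rw [Chor.live, List.filterMap_append]
    exact ih.trans (List.sublist_append_right _ _)
  | expr he h ih => exact ih.cons _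
  | selBranch hr h ih =>
    simpa [Proc.keys, PInstr.keys, Branches.keys, Chor.live, Instr.live, Instr.key] using ih
  | recvSel h ih =>
    simpa [Proc.keys, PInstr.keys, Branches.keys, Chor.live, Instr.live, Instr.key] using ih
  | cond he h₁ h₂ h ih₁ ih₂ ih =>
    simp only [Proc.keys, PInstr.keys, Chor.live, Instr.live, List.filterMap_append]
    refine .append ?_ ih
    rw [List.filterMap_cons_some (by rfl), List.filterMap_append]
    exact (ih₁.append ih₂).cons _
  | merge hr hm hd h₁ h₂ h ih₁ ih₂ ih =>
    simp only [Proc.keys, PInstr.keys, Chor.live, Instr.live, List.filterMap_append,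
      Branches.keys_append, List.append_nil] at ih₁ ih₂ ⊢
    refine .append ?_ ih
    rw [List.filterMap_cons_some (by rfl), List.filterMap_append]
    exact (ih₁.append ih₂).cons _
  | wait hr hw h ih =>
    simpa [Proc.keys, PInstr.keys, Branches.keys, Chor.live, Instr.live, Instr.key, hw] using ih
  | entered hr hw h₁ h ih₁ ih =>
    simp only [Proc.keys, PInstr.keys, Chor.live, Instr.live, List.filterMap_append, if_neg hw]
    refine .append ?_ ih
    rw [List.filterMap_cons_some (by rfl)]
    exact ih₁.cons _
  | block h₁ h ih₁ ih =>
    simp only [Proc.keys, PInstr.keys, Chor.live, Instr.live, List.filterMap_append]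
    exact ih₁.append ih
  | _ =>
    rename_i ih
    exact ih.cons_cons _

theorem Proj.keys_sublist_keys {r : 𝓛.Name} {C : Chor 𝓛} {P : Proc 𝓛} (h : Proj r C P) :
    P.keys.Sublist C.keys := h.keys_sublist.trans ((C.live_sublist r).filterMap _)

theorem Proj.exists_of_mem_keys {r : 𝓛.Name} {C : Chor 𝓛} {P : Proc 𝓛} (h : Proj r C P)
    {k : Key} (hk : k ∈ P.keys) : ∃ I ∈ C.live r, I.key = some k :=
  List.mem_filterMap.1 (h.keys_sublist.subset hk)

/-- Every branching instruction in a projection has an alternative. -/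
theorem Proj.exists_mem_keys_of_activeToken {r : 𝓛.Name} {C : Chor 𝓛} {P : Proc 𝓛}
    (h : Proj r C P) {t : Tok} (ht : P.ActiveToken t) : ∃ l, (l, t) ∈ P.keys := by
  induction h with
  | nil => exact absurd ht id
  | skip hr hb h ih => exact ih ht
  | selBranch hr h ih =>
    obtain rfl : _ = t := by simpa [Proc.ActiveToken, PInstr.ActiveToken] using ht
    exact ⟨_, List.mem_cons_self⟩
  | recvSel h ih =>
    obtain rfl : _ = t := by simpa [Proc.ActiveToken, PInstr.ActiveToken] using ht
    exact ⟨_, List.mem_cons_self⟩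
  | merge hr hm hd h₁ h₂ h ih₁ ih₂ ih =>
    rcases ht with ht | ht
    · obtain ⟨l, hl⟩ := ih₁ (.inl ht)
      refine ⟨l, List.mem_append_left _ ?_⟩
      simp only [Proc.keys, PInstr.keys, List.append_nil] at hl
      rw [PInstr.keys, Branches.keys_append]
      exact List.mem_append_left _ hl
    · obtain ⟨l, hl⟩ := ih ht
      exact ⟨l, List.mem_append_right _ hl⟩
  | entered hr hw h₁ h ih₁ ih =>
    rcases ht with ht | ht
    · obtain ⟨l, hl⟩ := ih₁ ht
      exact ⟨l, List.mem_append_left _ hl⟩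
    · obtain ⟨l, hl⟩ := ih ht
      exact ⟨l, List.mem_append_right _ hl⟩
  | block h₁ h ih₁ ih =>
    rcases ht with ht | ht
    · obtain ⟨l, hl⟩ := ih₁ ht
      exact ⟨l, List.mem_append_left _ hl⟩
    · obtain ⟨l, hl⟩ := ih ht
      exact ⟨l, List.mem_append_right _ hl⟩
  | _ =>
    rename_i ih
    rcases ht with ht | ht
    · exact absurd ht id
    · obtain ⟨l, hl⟩ := ih ht
      exact ⟨l, List.mem_append_right _ hl⟩

mutual
/-- The process can come to a call with key `k` without making a choice. -/
def Proc.ActiveCall (k : Key) : Proc 𝓛 → Prop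
  | .nil => False
  | .seq I P => I.ActiveCall k ∨ P.ActiveCall k
def PInstr.ActiveCall (k : Key) : PInstr 𝓛 → Prop
  | .call _ _ _ l t => (l, t) = k
  | .block P => P.ActiveCall k
  | .send .. | .recv .. | .set .. | .choice .. | .cond .. | .branch .. => False
end

theorem Proj.exists_of_activeCall {r : 𝓛.Name} {C : Chor 𝓛} {P : Proc 𝓛}
    (h : Proj r C P) {k : Key} (hk : P.ActiveCall k) : ∃ I ∈ C.live r, I.key = some k ∧
      ∀ l t ws X ps as C', I = .calling l t ws X ps as C' → r ∈ ws := by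
  induction h with
  | nil => exact absurd hk id
  | skip hr hb h ih =>
    obtain ⟨I, hI, h⟩ := ih hk
    exact ⟨I, List.mem_append_right _ hI, h⟩
  | selBranch => simp [Proc.ActiveCall, PInstr.ActiveCall] at hk
  | recvSel => simp [Proc.ActiveCall, PInstr.ActiveCall] at hk
  | call hr h ih =>
    rcases hk with hk | hk
    · obtain rfl : _ = k := hk
      exact ⟨_, List.mem_cons_self, rfl, by simp⟩
    · obtain ⟨I, hI, h⟩ := ih hk
      exact ⟨I, List.mem_append_right _ hI, h⟩
  | wait hr hw h ih =>
    rcases hk with hk | hk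
    · obtain rfl : _ = k := hk
      refine ⟨_, List.mem_cons_self, rfl, ?_⟩
      intro _ _ _ _ _ _ _ h
      cases h
      exact hw
    · obtain ⟨I, hI, h⟩ := ih hk
      exact ⟨I, List.mem_append_right _ hI, h⟩
  | entered hr hw h₁ h ih₁ ih =>
    rcases hk with hk | hk
    · obtain ⟨I, hI, h⟩ := ih₁ hk
      refine ⟨I, List.mem_append_left _ ?_, h⟩
      rw [Instr.live, if_neg hw]
      exact List.mem_cons_of_mem _ hI
    · obtain ⟨I, hI, h⟩ := ih hk
      exact ⟨I, List.mem_append_right _ hI, h⟩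
  | block h₁ h ih₁ ih =>
    rcases hk with hk | hk
    · obtain ⟨I, hI, h⟩ := ih₁ hk
      exact ⟨I, List.mem_append_left _ hI, h⟩
    · obtain ⟨I, hI, h⟩ := ih hk
      exact ⟨I, List.mem_append_right _ hI, h⟩
  | _ =>
    rename_i ih
    rcases hk with hk | hk
    · exact absurd hk id
    · obtain ⟨I, hI, h⟩ := ih hk
      exact ⟨I, List.mem_append_right _ hI, h⟩

/-- Instructions in progress that `r` waits for. -/
def Instr.Awaited (r : 𝓛.Name) : Instr 𝓛 → Prop
  | .recvSel _ _ _ q _ => q = r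
  | .calling _ _ ws _ _ _ _ => r ∈ ws
  | _ => False

theorem Instr.Awaited.isRuntime {r : 𝓛.Name} {I : Instr 𝓛} (h : I.Awaited r) : I.IsRuntime := by
  cases I <;> trivial

theorem Instr.Awaited.mem_pn {𝒟 : CDecls 𝓛} {K : Pool 𝓛} {r : 𝓛.Name} {I : Instr 𝓛}
    (h : I.Awaited r) (hI : I.WF 𝒟 K) : r ∈ I.pn := by
  cases I <;> first | exact absurd h id | skip
  case recvSel => exact Finset.mem_singleton.2 (Eq.symm h)
  case calling => exact hI.2.1 h

theorem Chor.mem_pn_of_awaited {𝒟 : CDecls 𝓛} {K : Pool 𝓛} {r : 𝓛.Name} {C : Chor 𝓛}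
    (hwf : ∀ I ∈ C.stats, I.WF 𝒟 K) {I : Instr 𝓛} (hI : I ∈ C.stats) (h : I.Awaited r) :
    r ∈ C.pn :=
  Chor.pn_subset_of_mem_stats (fun _ _ _ _ _ _ _ h => (hwf _ h).2.2.1) hI (h.mem_pn (hwf I hI))

/-- What `r` waits for is visible in its behaviour. -/
theorem Proj.mem_keys_of_awaited {𝒟 : CDecls 𝓛} {K : Pool 𝓛} {r : 𝓛.Name} {C : Chor 𝓛}
    {P : Proc 𝓛} (h : Proj r C P) (hwf : ∀ I ∈ C.stats, I.WF 𝒟 K) {I : Instr 𝓛}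
    (hI : I ∈ C.live r) (hr : I.Awaited r) {k : Key} (hk : I.key = some k) : k ∈ P.keys := by
  induction h with
  | nil => simp [Chor.live] at hI
  | @skip J C P hrJ hb h ih =>
    rw [forall_stats_seq] at hwf
    refine (List.mem_append.1 hI).elim (fun hI => absurd ?_ hrJ) (ih hwf.2)
    cases J
    case block => exact absurd rfl (hb _)
    case cond l t p e C₁ C₂ =>
      simp only [Instr.live, List.mem_cons, List.mem_append] at hI
      have hn := hwf.1 _ List.mem_cons_self
      rcases hI with rfl | hI | hI
      · exact absurd hr id
      · exact absurd hr.isRuntime (hn.1 _ ((Chor.live_sublist _ _).subset hI))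
      · exact absurd hr.isRuntime (hn.2 _ ((Chor.live_sublist _ _).subset hI))
    case calling l t ws X ps as C₁ =>
      simp only [Instr.stats, List.forall_mem_cons] at hwf
      have hn := hwf.1.1
      rcases List.mem_cons.1 hI with rfl | hI
      · exact hr.mem_pn hn
      · split at hI
        · simp at hI
        · exact hn.2.2.1 (Chor.mem_pn_of_awaited hwf.1.2 ((Chor.live_sublist _ _).subset hI) hr)
    all_goals
      obtain rfl := List.mem_singleton.1 hI
      exact hr.mem_pn (hwf.1 _ (List.mem_singleton_self _))
  | selBranch hne h ih =>
    rcases List.mem_append.1 hI with hI | hI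
    · obtain rfl := List.mem_singleton.1 hI
      exact absurd hr id
    · simp only [Proc.keys, PInstr.keys, Branches.keys, List.append_nil]
      exact List.mem_cons_of_mem _ (ih (forall_stats_seq.1 hwf).2 hI)
  | recvSel h ih =>
    simp only [Proc.keys, PInstr.keys, Branches.keys, List.append_nil]
    rcases List.mem_append.1 hI with hI | hI
    · obtain rfl := List.mem_singleton.1 hI
      obtain rfl := Option.some.inj hk
      exact List.mem_cons_self
    · exact List.mem_cons_of_mem _ (ih (forall_stats_seq.1 hwf).2 hI)
  | cond he h₁ h₂ h ih₁ ih₂ ih =>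
    rw [forall_stats_seq] at hwf
    simp only [Chor.live, Instr.live, List.mem_cons, List.mem_append] at hI
    have hn := hwf.1 _ List.mem_cons_self
    rcases hI with (rfl | hI | hI) | hI
    · exact absurd hr id
    · exact absurd hr.isRuntime (hn.1 _ ((Chor.live_sublist _ _).subset hI))
    · exact absurd hr.isRuntime (hn.2 _ ((Chor.live_sublist _ _).subset hI))
    · exact List.mem_append_right _ (ih hwf.2 hI)
  | merge hne hm hd h₁ h₂ h ih₁ ih₂ ih =>
    rw [forall_stats_seq] at hwf
    simp only [Chor.live, Instr.live, List.mem_cons, List.mem_append] at hI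
    have hn := hwf.1 _ List.mem_cons_self
    rcases hI with (rfl | hI | hI) | hI
    · exact absurd hr id
    · exact absurd hr.isRuntime (hn.1 _ ((Chor.live_sublist _ _).subset hI))
    · exact absurd hr.isRuntime (hn.2 _ ((Chor.live_sublist _ _).subset hI))
    · exact List.mem_append_right _ (ih hwf.2 hI)
  | wait hrp hw h ih =>
    rw [forall_stats_seq] at hwf
    rw [Chor.live, Instr.live, if_pos hw] at hI
    rcases List.mem_append.1 hI with hI | hI
    · obtain rfl := List.mem_singleton.1 hI
      obtain rfl := Option.some.inj hk
      exact List.mem_cons_self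
    · exact List.mem_cons_of_mem _ (ih hwf.2 hI)
  | entered hrp hw h₁ h ih₁ ih =>
    simp only [forall_stats_seq, Instr.stats, List.forall_mem_cons] at hwf
    rw [Chor.live, Instr.live, if_neg hw] at hI
    simp only [List.cons_append, List.mem_cons, List.mem_append] at hI
    rcases hI with rfl | hI | hI
    · exact absurd hr hw
    · exact List.mem_append_left _ (ih₁ hwf.1.2 hI)
    · exact List.mem_append_right _ (ih hwf.2 hI)
  | block h₁ h ih₁ ih =>
    simp only [forall_stats_seq, Instr.stats] at hwf
    rcases List.mem_append.1 hI with hI | hI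
    · exact List.mem_append_left _ (ih₁ hwf.1 hI)
    · exact List.mem_append_right _ (ih hwf.2 hI)
  | _ =>
    rename_i ih
    rcases List.mem_append.1 hI with hI | hI
    · obtain rfl := List.mem_singleton.1 hI
      exact absurd hr id
    · exact List.mem_append_right _ (ih (forall_stats_seq.1 hwf).2 hI)

theorem Chor.mem_live_or_exists {r : 𝓛.Name} {C : Chor 𝓛} {I : Instr 𝓛} (h : I ∈ C.stats) :
    I ∈ C.live r ∨ ∃ l t ws X ps as C', Instr.calling l t ws X ps as C' ∈ C.live r ∧ r ∈ ws ∧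
      I ∈ C'.stats := by
  have mono : ∀ {m m' : List (Instr 𝓛)}, m ⊆ m' →
      (I ∈ m ∨ ∃ l t ws X ps as C', Instr.calling l t ws X ps as C' ∈ m ∧ r ∈ ws ∧
        I ∈ C'.stats) →
      (I ∈ m' ∨ ∃ l t ws X ps as C', Instr.calling l t ws X ps as C' ∈ m' ∧ r ∈ ws ∧
        I ∈ C'.stats) := fun hs => Or.imp (fun h => hs h)
    fun ⟨l, t, ws, X, ps, as, C', h, h'⟩ => ⟨l, t, ws, X, ps, as, C', hs h, h'⟩
  induction C using Chor.induction with
  | nil => simp [Chor.stats] at h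
  | cond l t p e C₁ C₂ C ih₁ ih₂ ih =>
    simp only [Chor.stats, Instr.stats, List.mem_append, List.mem_cons] at h
    rcases h with (rfl | h | h) | h
    · exact .inl List.mem_cons_self
    · exact mono (fun _ h => by simp [Chor.live, Instr.live, h]) (ih₁ h)
    · exact mono (fun _ h => by simp [Chor.live, Instr.live, h]) (ih₂ h)
    · exact mono (List.subset_append_right _ _) (ih h)
  | block C₁ C ih₁ ih =>
    rcases List.mem_append.1 h with h | h
    · exact mono (List.subset_append_left _ _) (ih₁ h)
    · exact mono (List.subset_append_right _ _) (ih h)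
  | calling l t ws X ps as C₁ C ih₁ ih =>
    simp only [Chor.stats, Instr.stats, List.mem_append, List.mem_cons] at h
    rcases h with (rfl | h) | h
    · exact .inl List.mem_cons_self
    · by_cases hw : r ∈ ws
      · exact .inr ⟨l, t, ws, X, ps, as, C₁, List.mem_cons_self, hw, h⟩
      · exact mono (fun _ h => by simp [Chor.live, Instr.live, hw, h]) (ih₁ h)
    · exact mono (List.subset_append_right _ _) (ih h)
  | _ =>
    rename_i ih
    rcases List.mem_append.1 h with h | h
    · exact .inl (List.mem_append_left _ h)
    · exact mono (List.subset_append_right _ _) (ih h)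

theorem Chor.keys_seq (I : Instr 𝓛) (C : Chor 𝓛) :
    (Chor.seq I C).keys = I.stats.filterMap Instr.key ++ C.keys := by
  simp only [Chor.keys, Chor.stats, List.filterMap_append]

theorem Chor.keys_subst (C : Chor 𝓛) : ∀ σ : CSub 𝓛, (C.subst σ).keys = C.keys := by
  induction C using Chor.induction with
  | nil => exact fun _ => rfl
  | cond l t p e C₁ C₂ C ih₁ ih₂ ih =>
    intro σ
    simp only [Chor.keys] at ih₁ ih₂
    simp only [Chor.subst, Instr.subst, Chor.keys_seq, Instr.stats, Instr.key, ih,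
      List.filterMap_append, List.filterMap_cons, ih₁, ih₂]
  | block C₁ C ih₁ ih =>
    intro σ
    simp only [Chor.keys] at ih₁
    simp only [Chor.subst, Instr.subst, Chor.keys_seq, Instr.stats, ih, ih₁]
  | calling l t ws X ps as C₁ C ih₁ ih =>
    intro σ
    simp only [Chor.keys] at ih₁
    simp only [Chor.subst, Instr.subst, Chor.keys_seq, Instr.stats, Instr.key, ih,
      List.filterMap_cons, ih₁]
  | _ =>
    intro σ
    rename_i ih
    simp only [Chor.subst, Instr.subst, Chor.keys_seq, Instr.stats, Instr.key, ih,
      List.filterMap_cons, List.filterMap_nil]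

theorem Chor.keys_inst (ρ : 𝓛.Name → 𝓛.Name) (τ : List ℕ) (C : Chor 𝓛) :
    (C.inst ρ τ).keys = C.keys.map fun k => (k.1, k.2.inst τ) := by
  simp only [Chor.keys, Chor.stats_inst, List.filterMap_map, List.map_filterMap]
  congr 1
  funext I
  cases I <;> rfl

theorem CDef.WF.token_of_mem_keys_instantiate {𝒟 : CDecls 𝓛} {K : Pool 𝓛} {d : CDef 𝓛}
    (hd : d.WF 𝒟 K) {ps : List 𝓛.Name} {as : List (CAtom 𝓛)} {τ : List ℕ} {k : Key}
    (hk : k ∈ (d.instantiate ps as τ).keys) : k.2 = .tok τ := by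
  rw [CDef.instantiate, Chor.keys_subst, Chor.keys_inst, List.mem_map] at hk
  obtain ⟨k', hk', rfl⟩ := hk
  simp only [hd.keys_hole k' hk']
  rfl

/-- The token of what `r` waits for in the body of a call that `r` has not entered extends the key
of this call: the body is known to `r` only as an instance of the procedure. -/
theorem Instr.WF.suffix_of_awaited {𝒟 : CDecls 𝓛} {K : Pool 𝓛}
    (h𝒟 : ∀ X d, 𝒟 X = some d → d.WF 𝒟 K) {r : 𝓛.Name} (n : ℕ) :
    ∀ {l τ ws X ps as C} {I : Instr 𝓛} {l' τ'}, C.stats.length = n →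
      Instr.WF 𝒟 K (.calling l (.tok τ) ws X ps as C) → r ∈ ws →
      (∀ I ∈ C.stats, I.WF 𝒟 K) → I ∈ C.stats → I.Awaited r →
      I.key = some (l', .tok τ') → (l :: τ) <:+ τ' := by
  induction n using Nat.strong_induction_on with
  | _ n ih =>
    intro l τ ws X ps as C I l' τ' hn hw hr hwf hI ha hk
    obtain ⟨-, -, -, τ₀, d, hτ, hd, hw⟩ := hw
    obtain rfl : τ = τ₀ := by simpa using hτ
    obtain ⟨P, Q, hP, hQ, hs⟩ := hw r hr
    have hP := Proj.of_proj hP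
    have hQ := Proj.of_proj hQ
    have htok : ∀ {J : Instr 𝓛} {k : Key}, J ∈ C.live r → J.Awaited r → J.key = some k →
        k.2 = .tok (l :: τ) := fun hJ ha hk =>
      (h𝒟 X d hd).token_of_mem_keys_instantiate (hP.keys_sublist_keys.subset
        (hs.keys_subperm.subset (hQ.mem_keys_of_awaited hwf hJ ha hk)))
    rcases Chor.mem_live_or_exists (r := r) hI with
      hI' | ⟨l₂, t₂, ws₂, X₂, ps₂, as₂, C₂, h, hr₂, hI₂⟩
    · have := htok hI' ha hk
      simp only [Tok.tok.injEq] at this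
      rw [this]
    · obtain rfl : t₂ = .tok (l :: τ) := htok h hr₂ rfl
      have hm := (Chor.live_sublist _ _).subset h
      have hsub := Chor.cons_stats_sublist hm
      have := ih C₂.stats.length (by have := hsub.length_le; simp at this; omega) rfl (hwf _ hm)
        hr₂ (fun J hJ => hwf J (hsub.subset (List.mem_cons_of_mem _ hJ))) hI₂ ha hk
      exact (List.suffix_cons _ _).trans this

theorem Key.anc_of_suffix {l l' : ℕ} {τ τ' : List ℕ} (h : (l :: τ) <:+ τ') :
    Key.Anc (l, .tok τ) (l', .tok τ') :=
  ⟨l, τ, l', τ', rfl, rfl, h.trans (List.suffix_cons _ _), fun e => by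
    have := h.length_le
    rw [e] at this
    simp at this⟩

/-- If a label has been sent to `r`, then `r` sees its key, unless the selection belongs to a call
that `r` has not entered; in the latter case `r` cannot come to a branching instruction with the
token of the message. -/
theorem ConfigWF.mem_keys_or {𝒟 : CDecls 𝓛} {C : Chor 𝓛} {K : Pool 𝓛} (hC : ConfigWF 𝒟 C K)
    {r : 𝓛.Name} {P : Proc 𝓛} (hP : Proj r C P) {l : ℕ} {τ : List ℕ} {L : 𝓛.Lab}
    (hm : (⟨l, τ, .lab L⟩ : Msg 𝓛) ∈ K r) (ha : P.ActiveToken (.tok τ)) :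
    (l, Tok.tok τ) ∈ P.keys := by
  obtain ⟨p, hp⟩ := hC.lab_of_mem r l τ L hm
  rcases Chor.mem_live_or_exists (r := r) hp with h | ⟨l₁, t₁, ws, X, ps, as, C', h, hr, hI⟩
  · exact hP.mem_keys_of_awaited hC.stats_wf h rfl rfl
  · exfalso
    have hm := (Chor.live_sublist _ _).subset h
    have hsub := Chor.cons_stats_sublist hm
    obtain ⟨τ₁, rfl⟩ : ∃ τ₁, t₁ = .tok τ₁ := by
      obtain ⟨_, _, _, τ₁, _, hτ, _⟩ := hC.stats_wf _ hm
      exact ⟨τ₁, hτ⟩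
    have hs := Instr.WF.suffix_of_awaited hC.defs_wf _ rfl (hC.stats_wf _ hm) hr
      (fun J hJ => hC.stats_wf J (hsub.subset (List.mem_cons_of_mem _ hJ))) hI rfl rfl
    obtain ⟨l', hl'⟩ := hP.exists_mem_keys_of_activeToken ha
    obtain ⟨J, hJ, hJk⟩ := hP.exists_of_mem_keys hl'
    obtain ⟨_, _, _, _, _, _, _, e, hJ'⟩ := hC.anc _ hm _ ((Chor.live_sublist _ _).subset hJ) _ _
      rfl hJk (Key.anc_of_suffix hs)
    cases e
    exact Chor.false_of_mem_live hC.keys_nodup h hr hJ hJ' hJk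

mutual
theorem Proc.keys_subst : ∀ (P : Proc 𝓛) (σ : PSub 𝓛), (P.subst σ).keys = P.keys
  | .nil, _ => rfl
  | .seq I P, σ => by simp only [Proc.subst, Proc.keys, PInstr.keys_subst I, Proc.keys_subst P]
theorem PInstr.keys_subst : ∀ (I : PInstr 𝓛) (σ : PSub 𝓛), (I.subst σ).keys = I.keys
  | .branch t bs, σ => by simp only [PInstr.subst, PInstr.keys, Branches.keys_subst bs]
  | .cond _ P Q, σ => by
    simp only [PInstr.subst, PInstr.keys, Proc.keys_subst P, Proc.keys_subst Q]
  | .block P, σ => by simp only [PInstr.subst, PInstr.keys, Proc.keys_subst P]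
  | .send .., _ | .recv .., _ | .set .., _ | .choice .., _ | .call .., _ => rfl
theorem Branches.keys_subst : ∀ (bs : Branches 𝓛) (σ : PSub 𝓛) (t : Tok),
    (bs.subst σ).keys t = bs.keys t
  | .nil, _, _ => rfl
  | .cons _ _ P bs, σ, t => by
    simp only [Branches.subst, Branches.keys, Proc.keys_subst P, Branches.keys_subst bs]
end

mutual
theorem Proc.keys_inst (ρ : 𝓛.Name → 𝓛.Name) (τ : List ℕ) : ∀ P : Proc 𝓛,
    (P.inst ρ τ).keys = P.keys.map fun k => (k.1, k.2.inst τ)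
  | .nil => rfl
  | .seq I P => by
    simp only [Proc.inst, Proc.keys, PInstr.keys_inst ρ τ I, Proc.keys_inst ρ τ P, List.map_append]
theorem PInstr.keys_inst (ρ : 𝓛.Name → 𝓛.Name) (τ : List ℕ) : ∀ I : PInstr 𝓛,
    (I.inst ρ τ).keys = I.keys.map fun k => (k.1, k.2.inst τ)
  | .branch t bs => by simp only [PInstr.inst, PInstr.keys, Branches.keys_inst ρ τ bs]
  | .cond _ P Q => by
    simp only [PInstr.inst, PInstr.keys, Proc.keys_inst ρ τ P, Proc.keys_inst ρ τ Q,
      List.map_append]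
  | .block P => by simp only [PInstr.inst, PInstr.keys, Proc.keys_inst ρ τ P]
  | .send .. | .recv .. | .set .. | .choice .. | .call .. => rfl
theorem Branches.keys_inst (ρ : 𝓛.Name → 𝓛.Name) (τ : List ℕ) : ∀ (bs : Branches 𝓛) (t : Tok),
    (bs.inst ρ τ).keys (t.inst τ) = (bs.keys t).map fun k => (k.1, k.2.inst τ)
  | .nil, _ => rfl
  | .cons _ _ P bs, t => by
    simp only [Branches.inst, Branches.keys, Proc.keys_inst ρ τ P, Branches.keys_inst ρ τ bs,
      List.map_cons, List.map_append]
end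

/-- A step creates keys only when a procedure is called. -/
theorem PStep.keys_subperm {𝒬 : PDecls 𝓛} {p : 𝓛.Name} {P P' : Proc 𝓛} {S S' : Store 𝓛}
    {K K' : Pool 𝓛} (h : PStep 𝒬 p P S K P' S' K') :
    P'.keys.Subperm P.keys ∨ ∃ X d l τ, 𝒬 X = some d ∧ P.ActiveCall (l, .tok τ) ∧
      P'.keys.Subperm
        (P.keys ++ d.body.keys.map fun k => (k.1, k.2.inst (nextToken l τ))) := by
  induction h with
  | recv => left; rw [Proc.keys_subst]; exact (List.sublist_append_right _ _).subperm
  | compute => left; rw [Proc.keys_subst]; exact (List.sublist_append_right _ _).subperm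
  | @onSelect τ bs l L Q₁ Q _ _ _ hK hb =>
    left
    simp only [Proc.keys, PInstr.keys, Branches.keys_eq]
    refine (List.Sublist.append ?_ (.refl _)).subperm
    refine (List.sublist_cons_self (l, Tok.tok τ) _).trans ?_
    exact List.sublist_flatten_of_mem
      (List.mem_map_of_mem (f := fun b => (b.1, Tok.tok τ) :: b.2.2.keys) hb)
  | ifTrue =>
    left
    exact ((List.sublist_append_left _ _).append (.refl _)).subperm
  | ifFalse =>
    left
    exact ((List.sublist_append_right _ _).append (.refl _)).subperm
  | @block P₁ P₁' P₂ _ _ _ _ _ ih =>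
    rcases ih with ih | ⟨X, d, l, τ, hd, ha, ih⟩
    · exact .inl (ih.append (.refl _))
    · refine .inr ⟨X, d, l, τ, hd, .inl ha, ?_⟩
      refine (ih.append (.refl P₂.keys)).trans (List.Perm.subperm ?_)
      simp only [Proc.keys, PInstr.keys, List.append_assoc]
      exact List.perm_append_comm.append_left _
  | @delay I P P' _ _ _ _ _ ih =>
    rcases ih with ih | ⟨X, d, l, τ, hd, ha, ih⟩
    · exact .inl ((List.Subperm.refl _).append ih)
    · refine .inr ⟨X, d, l, τ, hd, .inr ha, ?_⟩
      simp only [Proc.keys, List.append_assoc]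
      exact (List.Subperm.refl _).append ih
  | call hd _ _ =>
    refine .inr ⟨_, _, _, _, hd, .inl rfl, ?_⟩
    simp only [Proc.keys, PInstr.keys, Proc.keys_subst, Proc.keys_inst]
    refine List.perm_append_comm.subperm.trans (List.Sublist.subperm ?_)
    exact (List.sublist_append_right _ _).append (.refl _)
  | _ => exact .inl (List.sublist_append_right _ _).subperm

/-- Keys stay distinct: those that a call creates extend its key, and by the ancestor condition
nothing that the process sees has such a key. -/
theorem ConfigWF.nodup_keys_of_pStep {𝒟 : CDecls 𝓛} {C : Chor 𝓛} {K : Pool 𝓛}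
    (hC : ConfigWF 𝒟 C K) {p : 𝓛.Name} {P P' : Proc 𝓛} (hP : Proj p C P)
    {S S' : Store 𝓛} {K₁ K₁' : Pool 𝓛} (h : PStep 𝒟.proj p P S K₁ P' S' K₁') :
    P'.keys.Nodup := by
  have hn : P.keys.Nodup := hC.keys_nodup.sublist hP.keys_sublist_keys
  have hsub : ∀ {m m' : List Key}, m'.Nodup → m.Subperm m' → m.Nodup := by
    rintro m m' hn ⟨l, hp, hs⟩
    exact hp.nodup_iff.1 (hn.sublist hs)
  rcases h.keys_subperm with h | ⟨⟨X, j⟩, d', l, τ, hd', ha, h⟩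
  · exact hsub hn h
  · refine hsub ?_ h
    simp only [CDecls.proj, Option.bind_eq_bind, Option.bind_eq_some_iff, Option.pure_def,
      Option.some.injEq] at hd'
    obtain ⟨d, hd, q, -, Q, hQ, rfl⟩ := hd'
    have hQ := (Proj.of_proj hQ).keys_sublist_keys
    have hw := hC.defs_wf X d hd
    have hhole : ∀ k ∈ Q.keys, k.2 = .hole := fun k hk => hw.keys_hole k (hQ.subset hk)
    rw [List.nodup_append]
    refine ⟨hn, (hw.keys_nodup.sublist hQ).map_on ?_, ?_⟩
    · intro a ha b hb e
      exact Prod.ext (Prod.ext_iff.1 e).1 ((hhole a ha).trans (hhole b hb).symm)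
    · rintro k hk k' hk' rfl
      obtain ⟨k₀, hk₀, rfl⟩ := List.mem_map.1 hk'
      rw [hhole k₀ hk₀, Tok.inst] at hk
      obtain ⟨I, hI, hIk, hIw⟩ := hP.exists_of_activeCall ha
      obtain ⟨J, hJ, hJk⟩ := hP.exists_of_mem_keys hk
      obtain ⟨_, _, ws, _, _, _, _, rfl, hJ'⟩ := hC.anc _ ((Chor.live_sublist _ _).subset hI) _
        ((Chor.live_sublist _ _).subset hJ) _ _ hIk hJk (Key.anc_of_suffix (List.suffix_refl _))
      exact Chor.false_of_mem_live hC.keys_nodup hI (hIw _ _ _ _ _ _ _ rfl) hJ hJ' hJk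

end Keys

/-! ### Soundness -/

section Soundness
variable {𝓛 : Lang.{u}}

/-- A branching instruction that is merged from the branches of a conditional cannot act before the
conditional is resolved, because no label with one of its keys has been sent. -/
theorem Proj.false_of_mem_branches {r : 𝓛.Name} {C₁ : Chor 𝓛} {K : Pool 𝓛} {τ : List ℕ}
    {bs : Branches 𝓛} (h : Proj r C₁ (.seq (.branch (.tok τ) bs) .nil)) (hn : C₁.NoRuntime)
    {l : ℕ} {L : 𝓛.Lab} {Q : Proc 𝓛} (hb : (l, L, Q) ∈ bs.toList)
    (hm : (⟨l, τ, .lab L⟩ : Msg 𝓛) ∈ K r)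
    (hsel : ∀ l τ L, (⟨l, τ, .lab L⟩ : Msg 𝓛) ∈ K r → ∀ I ∈ C₁.stats,
      I.key = some (l, .tok τ) → I.IsRuntime) : False := by
  obtain ⟨I, hI, hk⟩ := h.exists_of_mem_keys (k := (l, .tok τ)) (by
    simp only [Proc.keys, PInstr.keys, Branches.keys_eq, List.append_nil, List.mem_flatMap]
    exact ⟨_, hb, List.mem_cons_self⟩)
  have hI := (Chor.live_sublist _ _).subset hI
  exact hn I hI (hsel l τ L hm I hI hk)

/-- The choreography can follow its projection. The hypothesis `hsel` says that labels are only
sent for selections in progress. -/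
theorem Proj.exists_cStep {𝒟 : CDecls 𝓛} (hp𝒟 : 𝒟.Projectable) {r : 𝓛.Name} {K : Pool 𝓛}
    (h𝒟 : ∀ X d, 𝒟 X = some d → d.WF 𝒟 K) {C : Chor 𝓛} {P P' : Proc 𝓛} (hP : Proj r C P)
    (hwf : ∀ I ∈ C.stats, I.WF 𝒟 K) (htok : ∀ I ∈ C.stats, ∀ k, I.key = some k → k.2 ≠ .hole)
    (hsel : ∀ l τ L, (⟨l, τ, .lab L⟩ : Msg 𝓛) ∈ K r → ∀ I ∈ C.stats,
      I.key = some (l, .tok τ) → I.IsRuntime)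
    {S S' : Store 𝓛} {K' : Pool 𝓛} (hs : PStep 𝒟.proj r P S K P' S' K') :
    ∃ C' Q, CStep 𝒟 C S K r C' S' K' ∧ Proj r C' Q ∧ P'.Sup Q := by
  have htail : ∀ {I : Instr 𝓛} {C : Chor 𝓛},
      (∀ l τ L, (⟨l, τ, .lab L⟩ : Msg 𝓛) ∈ K r → ∀ J ∈ (Chor.seq I C).stats,
        J.key = some (l, .tok τ) → J.IsRuntime) →
      ∀ l τ L, (⟨l, τ, .lab L⟩ : Msg 𝓛) ∈ K r → ∀ J ∈ C.stats,
        J.key = some (l, .tok τ) → J.IsRuntime :=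
    fun h l τ L hm J hJ => h l τ L hm J (List.mem_append_right _ hJ)
  induction hP generalizing P' with
  | nil => cases hs
  | @skip I C P hr hb h ih =>
    obtain ⟨C', Q, hC, hQ, hs'⟩ := ih (forall_stats_seq.1 hwf).2 (forall_stats_seq.1 htok).2
      (htail hsel) hs
    refine ⟨_, Q, .delay hC ?_, .skip hr hb hQ, hs'⟩
    intro hI
    cases I <;> first | exact hI | exact hr (by simp [Instr.pn, ← show _ = r from hI])
  | @send l t e q C e' P he h ih =>
    cases hs with
    | send hv =>
      simp only [forall_stats_seq, Instr.stats, List.forall_mem_singleton] at hwf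
      refine ⟨_, P, .send ((CExpr.eval_iff_of_proj he).2 hv), .skip ?_ (by simp) h, .refl _⟩
      simpa [Instr.pn] using hwf.1.1
    | delay hs =>
      obtain ⟨C', Q, hC, hQ, hs'⟩ := ih (forall_stats_seq.1 hwf).2 (forall_stats_seq.1 htok).2
        (htail hsel) hs
      exact ⟨_, _, .delay hC id, .send he hQ, .seq _ hs'⟩
  | @commRecv l t p e C P hne h ih =>
    cases hs with
    | @recv _ _ _ _ _ v M hK =>
      have := (hwf _ List.mem_cons_self).2 _ rfl v
      rw [hK] at this
      exact absurd (Multiset.mem_cons_self _ _) this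
    | delay hs =>
      obtain ⟨C', Q, hC, hQ, hs'⟩ := ih (forall_stats_seq.1 hwf).2 (forall_stats_seq.1 htok).2
        (htail hsel) hs
      exact ⟨_, _, .delay hC id, .commRecv hne hQ, .seq _ hs'⟩
  | @recv l t p C P h ih =>
    cases hs with
    | recv hK =>
      exact ⟨_, _, .recv hK, h.subst (SubRel.single_self r _)
        fun I hI => ((forall_stats_seq.1 hwf).2 I hI).distinct, .refl _⟩
    | delay hs =>
      obtain ⟨C', Q, hC, hQ, hs'⟩ := ih (forall_stats_seq.1 hwf).2 (forall_stats_seq.1 htok).2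
        (htail hsel) hs
      exact ⟨_, _, .delay hC id, .recv hQ, .seq _ hs'⟩
  | @expr l t e C e' P he h ih =>
    cases hs with
    | compute hv =>
      cases t with
      | hole => exact absurd rfl (htok _ List.mem_cons_self _ rfl)
      | tok τ =>
        exact ⟨_, _, .compute ((CExpr.eval_iff_of_proj he).2 hv), h.subst (SubRel.single_self r _)
          fun I hI => ((forall_stats_seq.1 hwf).2 I hI).distinct, .refl _⟩
    | delay hs =>
      obtain ⟨C', Q, hC, hQ, hs'⟩ := ih (forall_stats_seq.1 hwf).2 (forall_stats_seq.1 htok).2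
        (htail hsel) hs
      exact ⟨_, _, .delay hC id, .expr he hQ, .seq _ hs'⟩
  | @choice l t q L C P h ih =>
    have hne := (hwf _ List.mem_cons_self).1
    cases hs with
    | select =>
      refine ⟨_, _, .select, .skip ?_ (by simp) h, .refl _⟩
      simpa [Instr.pn] using hne
    | delay hs =>
      obtain ⟨C', Q, hC, hQ, hs'⟩ := ih (forall_stats_seq.1 hwf).2 (forall_stats_seq.1 htok).2
        (htail hsel) hs
      exact ⟨_, _, .delay hC fun e => hne e.symm, .choice hQ, .seq _ hs'⟩
  | @selBranch l t p L C P hne h ih =>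
    cases hs with
    | onSelect hK hb =>
      obtain ⟨rfl, rfl, rfl⟩ : _ ∧ _ ∧ _ := by simpa [Branches.toList] using hb
      have := (hwf _ List.mem_cons_self).2 _ rfl
      rw [hK] at this
      exact absurd (Multiset.mem_cons_self _ _) this
    | delay hs => cases hs
  | @recvSel l t p L C P h ih =>
    cases hs with
    | onSelect hK hb =>
      obtain ⟨rfl, rfl, rfl⟩ : _ ∧ _ ∧ _ := by simpa [Branches.toList] using hb
      exact ⟨_, _, .onSelect hK, h, .tail _⟩
    | delay hs => cases hs
  | @cond l t e C₁ C₂ C e' P₁ P₂ P he h₁ h₂ h ih₁ ih₂ ih =>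
    cases hs with
    | ifTrue hv =>
      cases t with
      | hole => exact absurd rfl (htok _ List.mem_cons_self _ rfl)
      | tok τ =>
        obtain ⟨Q, hQ, hs⟩ := h₁.blockSeq h
        exact ⟨_, Q, .ifTrue ((CExpr.eval_iff_of_proj he).2 hv), hQ, hs⟩
    | ifFalse hv hne =>
      cases t with
      | hole => exact absurd rfl (htok _ List.mem_cons_self _ rfl)
      | tok τ =>
        obtain ⟨Q, hQ, hs⟩ := h₂.blockSeq h
        exact ⟨_, Q, .ifFalse ((CExpr.eval_iff_of_proj he).2 hv) hne, hQ, hs⟩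
    | delay hs =>
      obtain ⟨C', Q, hC, hQ, hs'⟩ := ih (forall_stats_seq.1 hwf).2 (forall_stats_seq.1 htok).2
        (htail hsel) hs
      exact ⟨_, _, .delay hC id, .cond he h₁ h₂ hQ, .seq _ hs'⟩
  | @merge l t p e C₁ C₂ C t' bs₁ bs₂ P hne hm hd h₁ h₂ h ih₁ ih₂ ih =>
    cases hs with
    | onSelect hK hb =>
      have hn := hwf _ List.mem_cons_self
      have hmem : _ ∈ K r := hK ▸ Multiset.mem_cons_self _ _
      simp only [Chor.stats, Instr.stats, List.cons_append, List.mem_cons, List.mem_append] at hsel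
      rw [Branches.toList_append, List.mem_append] at hb
      rcases hb with hb | hb
      · exact (h₁.false_of_mem_branches hn.1 hb hmem
          fun l τ L hm I hI => hsel l τ L hm I (.inr (.inl (.inl hI)))).elim
      · exact (h₂.false_of_mem_branches hn.2 hb hmem
          fun l τ L hm I hI => hsel l τ L hm I (.inr (.inl (.inr hI)))).elim
    | delay hs =>
      obtain ⟨C', Q, hC, hQ, hs'⟩ := ih (forall_stats_seq.1 hwf).2 (forall_stats_seq.1 htok).2
        (htail hsel) hs
      exact ⟨_, _, .delay hC id, .merge hne hm hd h₁ h₂ hQ, .seq _ hs'⟩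
  | @call l t X ps as C P hr h ih =>
    cases hs with
    | call hd₀ _ _ =>
      obtain ⟨d, d', hd, hd', hl, ha, hproj⟩ :=
        CallWF.exists_proj hp𝒟 h𝒟 (hwf _ List.mem_cons_self) hr
      obtain rfl := Option.some.inj (hd'.symm.trans hd₀)
      exact ⟨_, _, .first hd hr, .entered hr (by simp) (hproj _) h, .refl _⟩
    | delay hs =>
      obtain ⟨C', Q, hC, hQ, hs'⟩ := ih (forall_stats_seq.1 hwf).2 (forall_stats_seq.1 htok).2
        (htail hsel) hs
      exact ⟨_, _, .delay hC id, .call hr hQ, .seq _ hs'⟩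
  | @wait l t ws X ps as C₁ C P hr hw h ih =>
    cases hs with
    | @call _ _ _ _ τ _ _ _ _ hd₀ _ _ =>
      obtain ⟨hcall, _, _, τ', d₁, hτ, hd₁, hw'⟩ := hwf _ List.mem_cons_self
      obtain ⟨d, d', hd, hd', hl, ha, hproj⟩ := hcall.exists_proj hp𝒟 h𝒟 hr
      obtain rfl := Option.some.inj (hd'.symm.trans hd₀)
      obtain rfl := Option.some.inj (hd₁.symm.trans hd)
      obtain rfl : τ = τ' := by simpa using hτ
      obtain ⟨P₀, Q₀, hP₀, hQ₀, hs⟩ := hw' r hw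
      obtain rfl := (Proj.of_proj hP₀).unique (hproj _)
      -- Even the last process can enter without ending the call: nobody waits any longer.
      exact ⟨_, _, .enter hw, .entered hr (by simp) (Proj.of_proj hQ₀) h, .block _ hs⟩
    | delay hs =>
      obtain ⟨C', Q, hC, hQ, hs'⟩ := ih (forall_stats_seq.1 hwf).2 (forall_stats_seq.1 htok).2
        (htail hsel) hs
      exact ⟨_, _, .delay hC id, .wait hr hw hQ, .seq _ hs'⟩
  | @entered l t ws X ps as C₁ C P₁ P hr hw h₁ h ih₁ ih =>
    cases hs with
    | block hs =>
      obtain ⟨_, _, _, τ, _, rfl, _⟩ := hwf _ List.mem_cons_self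
      simp only [forall_stats_seq, Instr.stats, List.forall_mem_cons] at hwf htok
      obtain ⟨C', Q, hC, hQ, hs'⟩ := ih₁ hwf.1.2 htok.1.2
        (fun l τ L hm J hJ => hsel l τ L hm J
          (List.mem_append_left _ (List.mem_cons_of_mem _ hJ))) hs
      exact ⟨_, _, .delayProc hC hw, .entered hr hw hQ h, .block _ hs'⟩
    | delay hs =>
      obtain ⟨C', Q, hC, hQ, hs'⟩ := ih (forall_stats_seq.1 hwf).2 (forall_stats_seq.1 htok).2
        (htail hsel) hs
      exact ⟨_, _, .delay hC id, .entered hr hw h₁ hQ, .seq _ hs'⟩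
  | @block C₁ C P₁ P h₁ h ih₁ ih =>
    cases hs with
    | block hs =>
      simp only [forall_stats_seq, Instr.stats] at hwf htok
      obtain ⟨C', Q, hC, hQ, hs'⟩ := ih₁ hwf.1 htok.1
        (fun l τ L hm J hJ => hsel l τ L hm J (List.mem_append_left _ hJ)) hs
      obtain ⟨R, hR, hs''⟩ := hQ.blockSeq h
      exact ⟨_, R, .block hC, hR, (Proc.Sup.block _ hs').trans hs''⟩
    | delay hs =>
      obtain ⟨C', Q, hC, hQ, hs'⟩ := ih (forall_stats_seq.1 hwf).2 (forall_stats_seq.1 htok).2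
        (htail hsel) hs
      exact ⟨_, _, .delay hC id, .block h₁ hQ, .seq _ hs'⟩

theorem ConfigWF.isRuntime_of_key {𝒟 : CDecls 𝓛} {C : Chor 𝓛} {K : Pool 𝓛} (hC : ConfigWF 𝒟 C K)
    {r : 𝓛.Name} {l : ℕ} {τ : List ℕ} {L : 𝓛.Lab} (hm : (⟨l, τ, .lab L⟩ : Msg 𝓛) ∈ K r)
    {I : Instr 𝓛} (hI : I ∈ C.stats) (hk : I.key = some (l, .tok τ)) : I.IsRuntime := by
  obtain ⟨p, hp⟩ := hC.lab_of_mem r l τ L hm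
  rw [eq_of_nodup_filterMap hC.keys_nodup hI hp hk rfl]
  trivial

/-- After a step, a network that is above `⟦C⟧` at all other processes is above `⟦C'⟧` as soon as
it is so at the process that acted. -/
theorem CStep.exists_epp {𝒟 : CDecls 𝓛} {C C' : Chor 𝓛} {S S' : Store 𝓛} {K K' : Pool 𝓛}
    {p : 𝓛.Name} (h : CStep 𝒟 C S K p C' S' K') (hwf : ∀ I ∈ C.stats, I.WF 𝒟 K) {N N₀ : Net 𝓛}
    (hN₀ : EPP C N₀) (hN : N.Sup N₀) {P Q : Proc 𝓛} (hQ : Proj p C' Q) (hP : P.Sup Q) :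
    ∃ N₀', EPP C' N₀' ∧ Net.Sup (Function.update N p P) N₀' := by
  have : ∀ r, ∃ R, Proj r C' R ∧ (Function.update N p P r).Sup R := by
    intro r
    by_cases hr : r = p
    · subst hr
      exact ⟨Q, hQ, by rwa [Function.update_self]⟩
    · obtain ⟨R, hR, hs⟩ := h.sup_of_ne hwf hr (Proj.of_proj (hN₀ r))
      exact ⟨R, hR, by rw [Function.update_of_ne hr]; exact (hN r).trans hs⟩
  choose N₀' h₁ h₂ using this
  exact ⟨N₀', fun r => (h₁ r).proj_eq, h₂⟩

end Soundness
end O3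

theorem mainTheorem1 (𝓛 : O3.Lang.{u}) (𝒟 : O3.CDecls 𝓛) (h𝒟 : 𝒟.Projectable)
    (C : O3.Chor 𝓛) (S : O3.Store 𝓛) (K : O3.Pool 𝓛) (hC : O3.ConfigWF 𝒟 C K)
    (N₀ : O3.Net 𝓛) (hN₀ : O3.EPP C N₀) :
    (∀ (p : 𝓛.Name) (C' : O3.Chor 𝓛) (S' : O3.Store 𝓛) (K' : O3.Pool 𝓛),
      O3.CStep 𝒟 C S K p C' S' K' →
        ∃ N' N₀' : O3.Net 𝓛, O3.NStep 𝒟.proj N₀ S K p N' S' K' ∧ N'.WF ∧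
          O3.EPP C' N₀' ∧ N'.Sup N₀') ∧
    (∀ N : O3.Net 𝓛, N.WF → N.Sup N₀ →
      ∀ (r : 𝓛.Name) (N' : O3.Net 𝓛) (S' : O3.Store 𝓛) (K' : O3.Pool 𝓛),
        O3.NStep 𝒟.proj N S K r N' S' K' →
          ∃ (C' : O3.Chor 𝓛) (N₀' : O3.Net 𝓛), O3.CStep 𝒟 C S K r C' S' K' ∧
            O3.EPP C' N₀' ∧ N'.Sup N₀') := by
  have hproj : ∀ r, O3.Proj r C (N₀ r) := fun r => O3.Proj.of_proj (hN₀ r)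
  constructor
  · intro p C' S' K' hstep
    obtain ⟨P', Q, hP, hQ, hs⟩ := hstep.exists_pStep h𝒟 hC.defs_wf hC.stats_wf (hproj p)
    obtain ⟨N₀', hN₀', hs'⟩ := hstep.exists_epp hC.stats_wf hN₀ (fun r => .refl _) hQ hs
    refine ⟨_, N₀', ⟨P', hP, rfl⟩, fun r => ?_, hN₀', hs'⟩
    by_cases hr : r = p
    · subst hr
      rw [Function.update_self]
      exact hC.nodup_keys_of_pStep (hproj r) hP
    · rw [Function.update_of_ne hr]
      exact hC.keys_nodup.sublist (hproj r).keys_sublist_keys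
  · rintro N hN hs r _ S' K' ⟨P', hP, rfl⟩
    obtain ⟨Q', hQ', hs₁⟩ := (hs r).exists_pStep (hN r)
      (fun l τ L hm ha _ => hC.mem_keys_or (hproj r) hm ha) hP
    obtain ⟨C', Q, hstep, hQ, hs₂⟩ := (hproj r).exists_cStep h𝒟 hC.defs_wf hC.stats_wf
      (fun I hI k hk => hC.keys_tok k (List.mem_filterMap.2 ⟨I, hI, hk⟩))
      (fun l τ L hm I hI hk => hC.isRuntime_of_key hm hI hk) hQ'
    obtain ⟨N₀', hN₀', hs'⟩ := hstep.exists_epp hC.stats_wf hN₀ hs hQ (hs₁.trans hs₂)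
    exact ⟨C', N₀', hstep, hN₀', hs'⟩
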